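/- **Setting.** Let $\Omega\subset\mathbb C^n$ be open, let $\Phi\in C^\infty(\Omega;\mathbb R)$ be strictly plurisubharmonic, i.e. $\sum_{j,k}\frac{\partial^2\Phi}{\partial x_j\partial\bar x_k}(x)\,\xi_j\bar\xi_k\ge c(x)|\xi|^2$ for $x\in\Omega$, $\xi\in\mathbb C^n$, with $0<c\in C(\Omega)$, and let $x_0\in\Omega$. Call a function $f\in C^\infty(U)$, $U\subset\mathbb C^{2n}_{x,\tilde y}$ open, *almost holomorphic along the anti-diagonal* if for all $j$ and $N$, $\partial_{\bar x_j}f=O(|\tilde y-\bar x|^N)$ and $\partial_{\bar{\tilde y}_j}f=O(|\tilde y-\bar x|^N)$, uniformly on compact subsets of $U$. Let $\Psi\in C^\infty(W)$ be almost holomorphic along the anti-diagonal, where $W\subset\mathbb C^{2n}$ is an open neighbourhood of $(x_0,\overline{x_0})$, with $\Psi(x,\bar x)=\Phi(x)$ for $x$ near $x_0$. Put $$\varphi(y,\tilde x;x,\tilde y)=\Psi(x,\tilde y)-\Psi(x,\tilde x)-\Psi(y,\tilde y)+\Psi(y,\tilde x).$$ **Good contours.** Let $V\subset\mathbb C^n$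 be open. A *family of good contours* for $\mathrm{Re}\,\varphi(y,\bar y;\cdot)$, $y\in V$, is a family $\Gamma(y)=\{\gamma(y,s):s\in D\}\subset\mathbb C^{2n}_{x,\tilde y}$, where $D\subset\mathbb R^{2n}$ is compact and $\gamma$ is $C^\infty$ on $V\times O$ for some open $O\supset D$, such that for every $y\in V$: $\gamma(y,\cdot)$ is injective on $D$ and an immersion at every point of $D$; $\Gamma(y)$ lies in the domain where $\varphi(y,\bar y;\cdot)$ is defined; $\gamma(y,s)=(y,\bar y)$ for some interior point $s$ of $D$; and, for some $C>0$ independent of $y$, $$\mathrm{Re}\,\varphi(y,\bar y;x,\tilde y)\le-\tfrac1C\,\mathrm{dist}\big((x,\tilde y),(y,\bar y)\big)^2,\qquad (x,\tilde y)\in\Gamma(y).$$ $\Gamma(y)$ is oriented by the parametrization. Two families of good contours are *compatibly oriented* if for each $y\in V$ the real-linear map $(z,w)\mapsto z-\bar w$, which maps the tangent space at $(y,\bar y)$ of each of the two contours isomorphically onto $\mathbb C^n$, carries their orientations to the same orientation of $\mathbb C^n$. **Amplitudes.** For an open set $U$, $f(\cdot\,;h)=O(h^N)$ in $C^\infty(U)$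 means that $f(\cdot\,;h)\in C^\infty(U)$ for all small $h>0$ and that every derivative of $f$ is $O(h^N)$ as $h\to0^+$, uniformly on compact subsets of $U$; $O(h^\infty)$ means $O(h^N)$ for all $N$. An *admissible amplitude* on an open set $U\subset\mathbb C^{2n}$ is a function $a(x,\tilde y;h)$ for which there are $a_j\in C^\infty(U)$, $j\ge0$, almost holomorphic along the anti-diagonal, with $a-\sum_{j<N}h^ja_j=O(h^N)$ in $C^\infty(U)$ for all $N\ge0$. If $\Gamma(y)\subset U$, put $$(A_\Gamma a)(y,\bar y;h)=\frac1{h^n}\iint_{\Gamma(y)}e^{\frac2h\varphi(y,\bar y;x,\tilde y)}\,a(x,\tilde y;h)\,dx\,d\tilde y,$$ where $dx\,d\tilde y$ is the form $dx_1\wedge\dots\wedge dx_n\wedge d\tilde y_1\wedge\dots\wedge d\tilde y_n$. **Proposition.** There exists an open neighbourhood $V_0\Subset\Omega$ of $x_0$ such that for every open $V\subset V_0$ (in particular $V=V_0$), any two compatibly oriented families of good contours $\Gamma(y),\Gamma_0(y)$, $y\in V$, and any admissible amplitude $a$ on an open set containing all $\Gamma(y)$ and $\Gamma_0(y)$, $y\in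 V$, one has $$(A_\Gamma a)(y,\bar y;h)-(A_{\Gamma_0}a)(y,\bar y;h)=O(h^\infty)\quad\text{in }C^\infty(V).$$ -/

import Mathlib

open Filter Topology Set
open scoped ContDiff

noncomputable section

namespace ContourFIO

/-- The space `ℂⁿ`. Its sup norm is only used in estimates "up to a constant"; squared Euclidean
lengths are written out as sums. Complex conjugation on `ℂⁿ` is `star`. -/
abbrev Cn (n : ℕ) : Type := Fin n → ℂ

/-- The parameter space `ℝ²ⁿ` of the contours, with its Lebesgue measure. -/
abbrev Par (n : ℕ) : Type := Fin n ⊕ Fin n → ℝ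

section Wirtinger

variable {E : Type*} [NormedAddCommGroup E] [NormedSpace ℝ E] [NormedSpace ℂ E]

/-- The `∂`-derivative of `f` at `p` in the direction `v`. For `v` the `j`-th unit vector this is
`∂f/∂x_j = (∂f/∂(Re x_j) - i ∂f/∂(Im x_j)) / 2`. -/
def dHol (f : E → ℂ) (p v : E) : ℂ :=
  (1 / 2) * (fderiv ℝ f p v - Complex.I * fderiv ℝ f p (Complex.I • v))

/-- The `∂̄`-derivative of `f` at `p` in the direction `v`. For `v` the `j`-th unit vector this is
`∂f/∂x̄_j = (∂f/∂(Re x_j) + i ∂f/∂(Im x_j)) / 2`. -/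
def dBar (f : E → ℂ) (p v : E) : ℂ :=
  (1 / 2) * (fderiv ℝ f p v + Complex.I * fderiv ℝ f p (Complex.I • v))

end Wirtinger

/-- The Levi form `∑ ∂²Φ/∂x_j∂x̄_k (x) ξ_j ξ̄_k` (a real number, as `Φ` is real valued). -/
def leviForm {n : ℕ} (Φ : Cn n → ℝ) (x ξ : Cn n) : ℝ :=
  (∑ j, ∑ k, dHol (fun z => dBar (fun w => (Φ w : ℂ)) z (Pi.single k 1)) x (Pi.single j 1)
    * ξ j * star (ξ k)).re

/-- `Φ` is a smooth strictly plurisubharmonic function in `Ω`. -/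
structure IsStrictlyPSH {n : ℕ} (Φ : Cn n → ℝ) (Ω : Set (Cn n)) : Prop where
  smooth : ContDiffOn ℝ ∞ Φ Ω
  levi : ∃ c : Cn n → ℝ, ContinuousOn c Ω ∧ ∀ x ∈ Ω, 0 < c x ∧
    ∀ ξ : Cn n, c x * ∑ j, ‖ξ j‖ ^ 2 ≤ leviForm Φ x ξ

/-- `f` is smooth in the open set `U ⊆ ℂⁿ × ℂⁿ`, and all the derivatives `∂f/∂x̄_j`, `∂f/∂ȳ_j` are
`O(|y - x̄|^N)` for every `N`, locally uniformly in `U`. -/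
structure IsAlmostHolomorphic {n : ℕ} (f : Cn n × Cn n → ℂ) (U : Set (Cn n × Cn n)) : Prop where
  smooth : ContDiffOn ℝ ∞ f U
  dbar : ∀ K ⊆ U, IsCompact K → ∀ N : ℕ, ∃ C : ℝ, ∀ p ∈ K, ∀ j : Fin n,
    ‖dBar f p (Pi.single j 1, 0)‖ ≤ C * ‖p.2 - star p.1‖ ^ N ∧
    ‖dBar f p (0, Pi.single j 1)‖ ≤ C * ‖p.2 - star p.1‖ ^ N

/-- `f(·; h) = O(h^N)` in `C^∞(U)` as `h → 0⁺`: `f(·; h)` is smooth in the open set `U` for all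
small `h > 0`, and each derivative is `O(h^N)`, uniformly on compact subsets of `U`. -/
structure IsBigOPow {E : Type*} [NormedAddCommGroup E] [NormedSpace ℝ E]
    (f : ℝ → E → ℂ) (U : Set E) (N : ℕ) : Prop where
  smooth : ∀ᶠ h in 𝓝[>] (0 : ℝ), ContDiffOn ℝ ∞ (f h) U
  bound : ∀ K ⊆ U, IsCompact K → ∀ k : ℕ, ∃ C : ℝ, ∀ᶠ h in 𝓝[>] (0 : ℝ), ∀ p ∈ K,
    ‖iteratedFDeriv ℝ k (f h) p‖ ≤ C * h ^ N

/-- `f(·; h) = O(h^∞)` in `C^∞(U)`. -/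
def IsBigOInfty {E : Type*} [NormedAddCommGroup E] [NormedSpace ℝ E]
    (f : ℝ → E → ℂ) (U : Set E) : Prop :=
  ∀ N : ℕ, IsBigOPow f U N

/-- `a(x, ỹ; h)` is a classical symbol of order `0` in the open set `U`, `a ∼ ∑ h^j a_j` in
`C^∞(U)`, whose coefficients are almost holomorphic along the anti-diagonal `ỹ = x̄`. -/
structure IsAdmissibleAmplitude {n : ℕ} (a : ℝ → Cn n × Cn n → ℂ) (U : Set (Cn n × Cn n)) :
    Prop where
  expansion : ∃ aj : ℕ → Cn n × Cn n → ℂ, (∀ j, IsAlmostHolomorphic (aj j) U) ∧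
    ∀ N : ℕ, IsBigOPow
      (fun h p => a h p - ∑ j ∈ Finset.range N, (h : ℂ) ^ j * aj j p) U N

/-- The phase `φ(y, x̃; x, ỹ) = Ψ(x, ỹ) - Ψ(x, x̃) - Ψ(y, ỹ) + Ψ(y, x̃)`, where `p = (x, ỹ)`. -/
def phase {n : ℕ} (Ψ : Cn n × Cn n → ℂ) (y xt : Cn n) (p : Cn n × Cn n) : ℂ :=
  Ψ p - Ψ (p.1, xt) - Ψ (y, p.2) + Ψ (y, xt)

/-- The data of a family of parametrized `2n`-dimensional contours in `ℂⁿ × ℂⁿ`: for each `y`, the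
contour `Γ(y)` is the image of `dom` under `s ↦ map y s`, oriented by the standard orientation
of `ℝ²ⁿ`. -/
structure ContourFamily (n : ℕ) where
  dom : Set (Par n)
  map : Cn n → Par n → Cn n × Cn n

/-- `Γ(y)`, `y ∈ V`, is a smooth family of good contours for `Re φ(y, ȳ; ·)`. Here `W` is the
domain of definition of `Ψ`. -/
structure IsGoodContour {n : ℕ} (Ψ : Cn n × Cn n → ℂ) (W : Set (Cn n × Cn n)) (V : Set (Cn n))
    (Γ : ContourFamily n) : Prop where
  compact_dom : IsCompact Γ.dom
  /-- smooth dependence on the parameters and on `y`, up to the boundary of the contour -/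
  smooth : ∃ O : Set (Par n), IsOpen O ∧ Γ.dom ⊆ O ∧
    ContDiffOn ℝ ∞ (fun q : Cn n × Par n => Γ.map q.1 q.2) (V ×ˢ O)
  /-- each `Γ(y)` is an embedded `2n`-dimensional contour -/
  injOn : ∀ y ∈ V, InjOn (Γ.map y) Γ.dom
  immersion : ∀ y ∈ V, ∀ s ∈ Γ.dom, Function.Injective (fderiv ℝ (Γ.map y) s)
  /-- `Γ(y)` lies where `φ(y, ȳ; ·)` is defined -/
  mem_domain : ∀ y ∈ V, ∀ s ∈ Γ.dom,
    Γ.map y s ∈ W ∧ ((Γ.map y s).1, star y) ∈ W ∧ (y, (Γ.map y s).2) ∈ W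
  /-- `Γ(y)` passes through the critical point `(y, ȳ)`, at an interior point of the contour -/
  passes : ∀ y ∈ V, ∃ s ∈ interior Γ.dom, Γ.map y s = (y, star y)
  /-- `Re φ(y, ȳ; x, ỹ) ≤ - dist((x, ỹ), (y, ȳ))² / C` along `Γ(y)`, with the Euclidean distance -/
  good : ∃ C : ℝ, 0 < C ∧ ∀ y ∈ V, ∀ s ∈ Γ.dom,
    (phase Ψ y (star y) (Γ.map y s)).re ≤
      -(1 / C) * (∑ j, ‖(Γ.map y s).1 j - y j‖ ^ 2 + ∑ j, ‖(Γ.map y s).2 j - star (y j)‖ ^ 2)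

/-- The density, with respect to Lebesgue measure on `ℝ²ⁿ`, of the pull-back under `g` of the form
`dx ∧ dỹ = dx_1 ∧ ⋯ ∧ dx_n ∧ dỹ_1 ∧ ⋯ ∧ dỹ_n`. -/
def pullbackDensity {n : ℕ} (g : Par n → Cn n × Cn n) (s : Par n) : ℂ :=
  (Matrix.of fun i j : Fin n ⊕ Fin n =>
    Sum.elim (fderiv ℝ g s (Pi.single j 1)).1 (fderiv ℝ g s (Pi.single j 1)).2 i).det

/-- `(A_Γ a)(y, ȳ; h) = h⁻ⁿ ∫_{Γ(y)} exp((2/h) φ(y, ȳ; x, ỹ)) a(x, ỹ; h) dx dỹ`. -/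
def opA {n : ℕ} (Ψ : Cn n × Cn n → ℂ) (Γ : ContourFamily n) (a : ℝ → Cn n × Cn n → ℂ)
    (h : ℝ) (y : Cn n) : ℂ :=
  1 / (h : ℂ) ^ n * ∫ s in Γ.dom,
    Complex.exp (2 / (h : ℂ) * phase Ψ y (star y) (Γ.map y s)) * a h (Γ.map y s)
      * pullbackDensity (Γ.map y) s

/-- The real Jacobian determinant of `s ↦ x - conj ỹ ∈ ℂⁿ = ℝⁿ × ℝⁿ`, where `(x, ỹ) = g s`. -/
def orientDet {n : ℕ} (g : Par n → Cn n × Cn n) (s : Par n) : ℝ :=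
  (Matrix.of fun i j : Fin n ⊕ Fin n =>
    Sum.elim
      (fun k => ((fderiv ℝ g s (Pi.single j 1)).1 k - star ((fderiv ℝ g s (Pi.single j 1)).2 k)).re)
      (fun k => ((fderiv ℝ g s (Pi.single j 1)).1 k - star ((fderiv ℝ g s (Pi.single j 1)).2 k)).im)
      i).det

/-- `Γ(y)` and `Γ₀(y)` are compatibly oriented for `y ∈ V`. The Hessian of `Re φ(y, ȳ; ·)` at
`(y, ȳ)` is positive definite on `{(z, z̄)}`, the kernel of `(z, w) ↦ z - w̄`, and negative definite
on the tangent spaces of good contours; so `(z, w) ↦ z - w̄` identifies the latter with `ℂⁿ`, and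
the orientations of the two contours at `(y, ȳ)` are compared there. -/
def SameOrientation {n : ℕ} (V : Set (Cn n)) (Γ Γ₀ : ContourFamily n) : Prop :=
  ∀ y ∈ V, ∀ s ∈ Γ.dom, ∀ s₀ ∈ Γ₀.dom, Γ.map y s = (y, star y) → Γ₀.map y s₀ = (y, star y) →
    0 < orientDet (Γ.map y) s * orientDet (Γ₀.map y) s₀

end ContourFIO

end

/-!
The proof compares each of the two contours with one fixed contour which depends only on `y`: the
standard linear contour `(y, ȳ) + {(z, -z̄)}`.

*Geometry.* Since `Ψ` is almost holomorphic, its second differential at `(y, ȳ)` is complex bilinear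
(`IsAlmostHolomorphic.fderiv_fderiv_I_smul`), so that the second order part of `φ(y, ȳ; ·)` at
`(y, ȳ)` only involves the mixed Hessian of `Ψ`, which is the Levi form of `Φ` (`leviForm_eq`). At
`(z, w)` the real part of this quadratic form is a quarter of the Levi form of `z + w̄` minus that of
`z - w̄`. It is negative on the tangent space of a good contour, and because the Levi form is
nonnegative it stays so when `z + w̄` is scaled down to `0` with `z - w̄` kept fixed
(`re_mixed_hessian_contract_le`). Hence the linear homotopy from a good contour to a linear
parametrization of the standard one runs through contours along which `Re φ ≤ -c |s|²`, as long as
the parameter `s`, which is `0` at the critical point, is small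
(`IsGoodContour.exists_isNegativeHomotopy`).

*Stokes' formula.* The form `e^(2φ/h) b dx ∧ dỹ` is closed up to the `∂̄`-derivatives of its
coefficient, which on the homotopy are `O(|s|^N / h) e^(-2c|s|²/h) = O(h^∞)`. With a cutoff equal to
`1` near the critical point, the terms produced by differentiating the cutoff are exponentially
small, and so are the parts of the contour away from the critical point, because a good contour is
embedded and the phase is strictly negative there. So the integral over a good contour equals, up to
`O(h^∞)`, the cut off integral over the standard contour, times the sign of the orientation
determinant (`IsGoodContour.exists_norm_integral_sub_stdIntegral_le`). Compatible orientation says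
that this sign is the same for both contours. All estimates are uniform for `y` in compact sets, and
expanding the amplitude gives the estimate of the difference in the sup norm
(`exists_norm_opA_sub_le`).

*Derivatives in `y`.* Along good contours `Re φ ≤ 0`, so every derivative of the operators is bounded
by a power of `1 / h` (`IsGoodContour.contDiffOn_opA_and_isTemperate`). A Landau–Kolmogorov
interpolation argument then turns the sup norm estimate into estimates of all derivatives
(`isBigOInfty_of_sup`).
-/

namespace ContourFIO

open MeasureTheory

/-! ### Interpolation of derivatives -/

/-- A Landau–Kolmogorov inequality: the derivative at `y` is controlled by the size of `f` and by
the oscillation of the derivative in a ball around `y`. -/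
lemma norm_fderiv_le_of_ball {E F : Type*} [NormedAddCommGroup E] [NormedSpace ℝ E]
    [NormedAddCommGroup F] [NormedSpace ℝ F] {f : E → F} {y : E} {τ ε M : ℝ} (hτ : 0 < τ)
    (hf : ∀ z ∈ Metric.closedBall y τ, DifferentiableAt ℝ f z)
    (hε : ∀ z ∈ Metric.closedBall y τ, ‖f z‖ ≤ ε)
    (hM : ∀ z ∈ Metric.closedBall y τ, ‖fderiv ℝ f z - fderiv ℝ f y‖ ≤ M) :
    ‖fderiv ℝ f y‖ ≤ 2 * ε / τ + M := by
  have hy : y ∈ Metric.closedBall y τ := Metric.mem_closedBall_self hτ.le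
  have hε0 : 0 ≤ ε := (norm_nonneg _).trans (hε y hy)
  have hM0 : 0 ≤ M := (norm_nonneg _).trans (hM y hy)
  refine ContinuousLinearMap.opNorm_le_of_unit_norm (by positivity) fun v hv => ?_
  have hz : y + τ • v ∈ Metric.closedBall y τ := by
    simp [Metric.mem_closedBall, dist_eq_norm, norm_smul, hv, abs_of_pos hτ]
  have key := (convex_closedBall y τ).norm_image_sub_le_of_norm_hasFDerivWithin_le'
    (fun z hz => (hf z hz).hasFDerivAt.hasFDerivWithinAt) hM hy hz
  have e : y + τ • v - y = τ • v := by abel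
  rw [e, map_smul, norm_smul, hv, Real.norm_of_nonneg hτ.le, mul_one] at key
  have h3 : ‖τ • fderiv ℝ f y v‖ ≤ 2 * ε + M * τ := by
    calc ‖τ • fderiv ℝ f y v‖
        = ‖f (y + τ • v) - f y - (f (y + τ • v) - f y - τ • fderiv ℝ f y v)‖ := by congr 1; abel
      _ ≤ ‖f (y + τ • v)‖ + ‖f y‖ + ‖f (y + τ • v) - f y - τ • fderiv ℝ f y v‖ :=
          (norm_sub_le _ _).trans (add_le_add_left (norm_sub_le _ _) _)
      _ ≤ 2 * ε + M * τ := by linarith [hε _ hz, hε _ hy]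
  rw [norm_smul, Real.norm_of_nonneg hτ.le] at h3
  rw [div_add' _ _ _ hτ.ne', le_div_iff₀ hτ]
  linarith

lemma norm_fderiv_iteratedFDeriv_sub {E F : Type*} [NormedAddCommGroup E] [NormedSpace ℝ E]
    [NormedAddCommGroup F] [NormedSpace ℝ F] (f : E → F) (k : ℕ) (z y : E) :
    ‖fderiv ℝ (iteratedFDeriv ℝ k f) z - fderiv ℝ (iteratedFDeriv ℝ k f) y‖
      = ‖iteratedFDeriv ℝ (k + 1) f z - iteratedFDeriv ℝ (k + 1) f y‖ := by
  have h : iteratedFDeriv ℝ (k + 1) f z - iteratedFDeriv ℝ (k + 1) f y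
      = (fderiv ℝ (iteratedFDeriv ℝ k f) z - fderiv ℝ (iteratedFDeriv ℝ k f) y).uncurryLeft := by
    ext m
    rfl
  rw [h, ContinuousLinearMap.uncurryLeft_norm]

/-- A family of smooth functions which is `O(h^∞)` locally uniformly, and all of whose derivatives
grow at most like a power of `1 / h`, is `O(h^∞)` in `C^∞`: by induction on `k`, the derivative of
order `k + 1` is interpolated between those of order `k` and `k + 2`. -/
lemma isBigOInfty_of_sup {E : Type*} [NormedAddCommGroup E] [NormedSpace ℝ E] [ProperSpace E]
    {G : ℝ → E → ℂ} {V : Set E} (hV : IsOpen V)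
    (hsm : ∀ᶠ h in 𝓝[>] (0 : ℝ), ContDiffOn ℝ ∞ (G h) V)
    (hmod : ∀ K ⊆ V, IsCompact K → ∀ k : ℕ, ∃ M : ℕ, ∃ C : ℝ, ∀ᶠ h in 𝓝[>] (0 : ℝ), ∀ p ∈ K,
      ‖iteratedFDeriv ℝ k (G h) p‖ * h ^ M ≤ C)
    (h0 : ∀ K ⊆ V, IsCompact K → ∀ N : ℕ, ∃ C : ℝ, ∀ᶠ h in 𝓝[>] (0 : ℝ), ∀ p ∈ K,
      ‖G h p‖ ≤ C * h ^ N) : IsBigOInfty G V := by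
  suffices H : ∀ k : ℕ, ∀ K ⊆ V, IsCompact K → ∀ N : ℕ, ∃ C : ℝ, ∀ᶠ h in 𝓝[>] (0 : ℝ),
      ∀ p ∈ K, ‖iteratedFDeriv ℝ k (G h) p‖ ≤ C * h ^ N from
    fun N => ⟨hsm, fun K hK hKc k => H k K hK hKc N⟩
  intro k
  induction k with
  | zero => simpa [norm_iteratedFDeriv_zero] using h0
  | succ k ih =>
    intro K hK hKc N
    obtain ⟨r, hr, hrV⟩ := hKc.exists_cthickening_subset_open hV hK
    have hK'c : IsCompact (Metric.cthickening r K) := hKc.cthickening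
    obtain ⟨M, C₂, hC₂⟩ := hmod _ hrV hK'c (k + 2)
    -- on balls of radius `τ = h ^ (N + M + 1)` the derivative of order `k + 1` oscillates by at
    -- most `O(h ^ (-M) * τ)`; hence that of order `k` is needed up to `O(h ^ N * τ)`
    obtain ⟨C₁, hC₁⟩ := ih _ hrV hK'c (N + (N + M + 1))
    refine ⟨2 * C₁ + |C₂|, ?_⟩
    have hsmall : ∀ᶠ h in 𝓝[>] (0 : ℝ), h < min r 1 :=
      mem_nhdsWithin_of_mem_nhds (Iio_mem_nhds (lt_min hr one_pos))
    have hpos : ∀ᶠ h in 𝓝[>] (0 : ℝ), 0 < h := self_mem_nhdsWithin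
    filter_upwards [hsm, hC₁, hC₂, hsmall, hpos] with h hsm hC₁ hC₂ hh hp y hy
    have hh1 : h ≤ 1 := hh.le.trans (min_le_right _ _)
    set τ := h ^ (N + M + 1) with hτ
    have hτ0 : 0 < τ := pow_pos hp _
    have hτr : τ ≤ r :=
      (pow_le_of_le_one hp.le hh1 (Nat.succ_ne_zero _)).trans (hh.le.trans (min_le_left _ _))
    have hball : Metric.closedBall y τ ⊆ Metric.cthickening r K :=
      (Metric.closedBall_subset_closedBall hτr).trans (Metric.closedBall_subset_cthickening hy r)
    have hdiff : ∀ m : ℕ, ∀ z ∈ V, DifferentiableAt ℝ (iteratedFDeriv ℝ m (G h)) z := fun m z hz =>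
      (hsm.contDiffAt (hV.mem_nhds hz)).differentiableAt_iteratedFDeriv
        (by exact_mod_cast WithTop.coe_lt_top (m : ℕ))
    have hlip : ∀ z ∈ Metric.closedBall y τ,
        ‖fderiv ℝ (iteratedFDeriv ℝ k (G h)) z - fderiv ℝ (iteratedFDeriv ℝ k (G h)) y‖
          ≤ C₂ / h ^ M * τ := by
      intro z hz
      rw [norm_fderiv_iteratedFDeriv_sub]
      have := (convex_closedBall y τ).norm_image_sub_le_of_norm_fderiv_le (𝕜 := ℝ)
        (f := iteratedFDeriv ℝ (k + 1) (G h)) (C := C₂ / h ^ M)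
        (fun w hw => hdiff _ w (hrV (hball hw)))
        (fun w hw => by
          rw [norm_fderiv_iteratedFDeriv, le_div_iff₀ (pow_pos hp _)]
          exact hC₂ w (hball hw)) (Metric.mem_closedBall_self hτ0.le) hz
      have hC0 : 0 ≤ C₂ / h ^ M := by
        refine div_nonneg ?_ (pow_pos hp _).le
        exact (mul_nonneg (norm_nonneg _) (pow_pos hp _).le).trans (hC₂ z (hball hz))
      exact this.trans (mul_le_mul_of_nonneg_left (by simpa [dist_eq_norm] using hz) hC0)
    have key := norm_fderiv_le_of_ball hτ0 (fun z hz => hdiff k z (hrV (hball hz)))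
      (fun z hz => hC₁ z (hball hz)) hlip
    rw [norm_fderiv_iteratedFDeriv] at key
    refine key.trans ?_
    have e1 : 2 * (C₁ * h ^ (N + (N + M + 1))) / τ = 2 * C₁ * h ^ N := by
      rw [pow_add, ← hτ]; field_simp
    have e2 : C₂ / h ^ M * τ = C₂ * h ^ N * h := by
      rw [hτ, pow_add, pow_add]; field_simp
    rw [e1, e2, add_mul]
    refine add_le_add le_rfl ?_
    calc C₂ * h ^ N * h ≤ |C₂| * h ^ N * 1 := by
          gcongr
          exact le_abs_self _
      _ = _ := mul_one _

/-! ### Smoothness of integrals depending on a parameter -/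

section ParametricIntegral

variable {E S : Type} [NormedAddCommGroup E] [NormedSpace ℝ E] [ProperSpace E]
  [NormedAddCommGroup S] [NormedSpace ℝ S] [MeasurableSpace S] [BorelSpace S]
  [SecondCountableTopology S]

/-- Differentiation under the integral sign over a compact set. -/
lemma hasFDerivAt_setIntegral_of_contDiffOn {F : Type} [NormedAddCommGroup F] [NormedSpace ℝ F]
    {μ : Measure S} [IsFiniteMeasureOnCompacts μ] {V : Set E} (hV : IsOpen V) {D : Set S}
    (hD : IsCompact D) {N : Set (E × S)} (hN : IsOpen N) (hVN : V ×ˢ D ⊆ N)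
    {f : E × S → F} (hf : ContDiffOn ℝ ∞ f N) {y : E} (hy : y ∈ V) :
    HasFDerivAt (fun z => ∫ s in D, f (z, s) ∂μ)
      (∫ s in D, (fderiv ℝ f (y, s)).comp (ContinuousLinearMap.inl ℝ E S) ∂μ) y := by
  obtain ⟨r, hr, hrV⟩ := (isCompact_singleton (x := y)).exists_cthickening_subset_open hV
    (by simpa using hy)
  set K := Metric.cthickening r ({y} : Set E)
  have hKc : IsCompact K := (isCompact_singleton).cthickening
  have hfd : ContinuousOn (fun q : E × S => (fderiv ℝ f q).comp (ContinuousLinearMap.inl ℝ E S)) N :=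
    (hf.continuousOn_fderiv_of_isOpen hN (by simp)).clm_comp continuousOn_const
  obtain ⟨C, hC⟩ := (hKc.prod hD).exists_bound_of_continuousOn
    (hfd.mono ((prod_mono_left hrV).trans hVN))
  have hmeas : ∀ z ∈ V, ∀ {F' : Type} [NormedAddCommGroup F'] [NormedSpace ℝ F'] {g : E × S → F'},
      ContinuousOn g N → ContinuousOn (fun s => g (z, s)) D := fun z hz F' _ _ g hg =>
    hg.comp (by fun_prop) fun s hs => hVN ⟨hz, hs⟩
  refine hasFDerivAt_integral_of_dominated_of_fderiv_le (bound := fun _ => C)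
    (F' := fun z s => (fderiv ℝ f (z, s)).comp (ContinuousLinearMap.inl ℝ E S))
    (s := K) ?_ ?_ ?_ ?_ ?_ ?_ ?_
  · exact mem_of_superset (Metric.closedBall_mem_nhds y hr)
      (Metric.closedBall_subset_cthickening (mem_singleton y) r)
  · filter_upwards [hV.mem_nhds hy] with z hz
    exact (hmeas z hz hf.continuousOn).aestronglyMeasurable hD.measurableSet
  · exact (hmeas y hy hf.continuousOn).integrableOn_compact hD
  · exact (hmeas y hy hfd).aestronglyMeasurable hD.measurableSet
  · exact (ae_restrict_mem hD.measurableSet).mono fun s hs z hz => hC (z, s) ⟨hz, hs⟩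
  · exact integrableOn_const hD.measure_lt_top.ne
  · refine (ae_restrict_mem hD.measurableSet).mono fun s hs z hz => ?_
    have h1 : HasFDerivAt f (fderiv ℝ f (z, s)) (z, s) :=
      ((hf.contDiffAt (hN.mem_nhds (hVN ⟨hrV hz, hs⟩))).differentiableAt (by simp)).hasFDerivAt
    exact h1.comp z (hasFDerivAt_prodMk_left z s)

/-- Smoothness of parametric integrals over a compact set, together with the bound on the
derivatives that one gets by differentiating under the integral sign. -/
lemma contDiffOn_setIntegral_and_bound {μ : Measure S} [IsFiniteMeasureOnCompacts μ]
    {V : Set E} (hV : IsOpen V) {D : Set S}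
    (hD : IsCompact D) {N : Set (E × S)} (hN : IsOpen N) (hVN : V ×ˢ D ⊆ N) (k : ℕ) :
    ∀ {F : Type} [NormedAddCommGroup F] [NormedSpace ℝ F] {f : E × S → F}, ContDiffOn ℝ ∞ f N →
    ContDiffOn ℝ k (fun z => ∫ s in D, f (z, s) ∂μ) V ∧
    ∀ y ∈ V, ∀ B : ℝ, (∀ s ∈ D, ‖iteratedFDeriv ℝ k (fun z => f (z, s)) y‖ ≤ B) →
      ‖iteratedFDeriv ℝ k (fun z => ∫ s in D, f (z, s) ∂μ) y‖ ≤ B * μ.real D := by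
  induction k with
  | zero =>
    intro F _ _ f hf
    refine ⟨?_, fun y hy B hB => ?_⟩
    · rw [Nat.cast_zero, contDiffOn_zero]
      exact fun y hy =>
        (hasFDerivAt_setIntegral_of_contDiffOn hV hD hN hVN hf hy).continuousAt.continuousWithinAt
    · rw [norm_iteratedFDeriv_zero]
      exact norm_setIntegral_le_of_norm_le_const hD.measure_lt_top
        fun s hs => by simpa using hB s hs
  | succ k ih =>
    intro F _ _ f hf
    set g : E × S → (E →L[ℝ] F) := fun q => (fderiv ℝ f q).comp (ContinuousLinearMap.inl ℝ E S)
    have hg : ContDiffOn ℝ ∞ g N :=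
      (hf.fderiv_of_isOpen hN (m := ∞) (by simp)).clm_comp contDiffOn_const
    obtain ⟨ih1, ih2⟩ := ih hg
    have hder : ∀ y ∈ V, HasFDerivAt (fun z => ∫ s in D, f (z, s) ∂μ) (∫ s in D, g (y, s) ∂μ) y :=
      fun y hy => hasFDerivAt_setIntegral_of_contDiffOn hV hD hN hVN hf hy
    have heq : ∀ y ∈ V, fderiv ℝ (fun z => ∫ s in D, f (z, s) ∂μ) =ᶠ[𝓝 y]
        fun z => ∫ s in D, g (z, s) ∂μ := fun y hy => by
      filter_upwards [hV.mem_nhds hy] with z hz using (hder z hz).fderiv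
    refine ⟨?_, fun y hy B hB => ?_⟩
    · rw [Nat.cast_succ, contDiffOn_succ_iff_fderiv_of_isOpen hV]
      exact ⟨fun y hy => (hder y hy).differentiableAt.differentiableWithinAt, by simp,
        ih1.congr fun y hy => (hder y hy).fderiv⟩
    · rw [← norm_iteratedFDeriv_fderiv, ((heq y hy).iteratedFDeriv (𝕜 := ℝ) k).eq_of_nhds]
      refine ih2 y hy B fun s hs => ?_
      have h2 : fderiv ℝ (fun z => f (z, s)) =ᶠ[𝓝 y] fun z => g (z, s) := by
        have : ∀ᶠ z in 𝓝 y, z ∈ V := hV.mem_nhds hy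
        filter_upwards [this] with z hz
        have h1 : HasFDerivAt f (fderiv ℝ f (z, s)) (z, s) :=
          ((hf.contDiffAt (hN.mem_nhds (hVN ⟨hz, hs⟩))).differentiableAt (by simp)).hasFDerivAt
        exact (h1.comp z (hasFDerivAt_prodMk_left z s)).fderiv
      rw [← (h2.iteratedFDeriv (𝕜 := ℝ) k).eq_of_nhds, norm_iteratedFDeriv_fderiv]
      exact hB s hs

end ParametricIntegral

/-! ### The holomorphic volume form -/

/-- The form `dx₁ ∧ ⋯ ∧ dx_n ∧ dỹ₁ ∧ ⋯ ∧ dỹ_n` on `ℂⁿ × ℂⁿ`, as an alternating `ℂ`-multilinear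
map. -/
noncomputable def volForm (n : ℕ) : (Cn n × Cn n) [⋀^Fin n ⊕ Fin n]→ₗ[ℂ] ℂ :=
  (Matrix.detRowAlternating (n := Fin n ⊕ Fin n) (R := ℂ)).compLinearMap
    (LinearEquiv.sumArrowLequivProdArrow (Fin n) (Fin n) ℂ ℂ).symm.toLinearMap

lemma volForm_apply {n : ℕ} (c : Fin n ⊕ Fin n → Cn n × Cn n) :
    volForm n c = (Matrix.of fun i j => Sum.elim (c j).1 (c j).2 i).det := by
  rw [← Matrix.det_transpose]
  unfold volForm Matrix.det
  rw [AlternatingMap.compLinearMap_apply]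
  congr 1

lemma pullbackDensity_eq_volForm {n : ℕ} (g : Par n → Cn n × Cn n) (s : Par n) :
    pullbackDensity g s = volForm n fun j => fderiv ℝ g s (Pi.single j 1) := by
  rw [volForm_apply]; rfl

/-- `volForm` as a continuous real multilinear map. -/
noncomputable def volFormR (n : ℕ) :
    ContinuousMultilinearMap ℝ (fun _ : Fin n ⊕ Fin n => Cn n × Cn n) ℂ where
  toMultilinearMap := (volForm n).toMultilinearMap.restrictScalars ℝ
  cont := by
    change Continuous fun c => volForm n c
    simp only [volForm_apply]
    refine Continuous.matrix_det (continuous_matrix fun i j => ?_)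
    rcases i with i | i <;> simp only [Matrix.of_apply, Sum.elim_inl, Sum.elim_inr] <;> fun_prop

@[simp] lemma volFormR_apply {n : ℕ} (c : Fin n ⊕ Fin n → Cn n × Cn n) :
    volFormR n c = volForm n c := rfl

lemma norm_volForm_le {n : ℕ} {B : ℝ} (c : Fin n ⊕ Fin n → Cn n × Cn n) (h : ∀ i, ‖c i‖ ≤ B) :
    ‖volForm n c‖ ≤ ‖volFormR n‖ * B ^ (2 * n) := by
  have h1 := (volFormR n).le_opNorm c
  rw [volFormR_apply] at h1
  refine h1.trans (mul_le_mul_of_nonneg_left ?_ (norm_nonneg _))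
  calc ∏ i, ‖c i‖ ≤ ∏ _i : Fin n ⊕ Fin n, B :=
        Finset.prod_le_prod (fun i _ => norm_nonneg _) fun i _ => h i
    _ = B ^ (2 * n) := by simp [two_mul]

/-- Cramer's rule, evaluated by a linear form `l`. It expresses that `dl ∧ dx ∧ dỹ = 0`. -/
lemma volForm_cramer {n : ℕ} (l : Cn n × Cn n →ₗ[ℂ] ℂ) (c : Fin n ⊕ Fin n → Cn n × Cn n)
    (c₀ : Cn n × Cn n) :
    l c₀ * volForm n c = ∑ i, l (c i) * volForm n (Function.update c i c₀) := by
  set e := (LinearEquiv.sumArrowLequivProdArrow (Fin n) (Fin n) ℂ ℂ)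
  set A : Matrix (Fin n ⊕ Fin n) (Fin n ⊕ Fin n) ℂ :=
    Matrix.of fun i j => Sum.elim (c j).1 (c j).2 i with hA
  have h1 := Matrix.mulVec_cramer A (e.symm c₀)
  have h2 : ∀ i, Matrix.cramer A (e.symm c₀) i = volForm n (Function.update c i c₀) := by
    intro i
    rw [Matrix.cramer_apply, volForm_apply]
    congr 1
    ext k j
    by_cases hj : j = i
    · subst hj
      rcases k with k | k <;> simp only [Matrix.updateCol_self, Matrix.of_apply,
        Function.update_self] <;> rfl
    · simp [hj, A]
  have h4 : volForm n c • c₀ = ∑ i, volForm n (Function.update c i c₀) • c i := by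
    apply e.symm.injective
    rw [map_smul, volForm_apply, ← hA, ← h1, map_sum]
    funext k
    simp only [Matrix.mulVec, dotProduct, h2, Finset.sum_apply, map_smul, Pi.smul_apply,
      smul_eq_mul]
    refine Finset.sum_congr rfl fun i _ => ?_
    rw [mul_comm]
    rcases k with k | k <;> rfl
  have h5 := congrArg l h4
  simp only [map_smul, map_sum, smul_eq_mul] at h5
  rw [mul_comm, h5]
  exact Finset.sum_congr rfl fun i _ => mul_comm _ _

/-! ### Wirtinger derivatives -/

section Wirtinger

variable {E : Type*} [NormedAddCommGroup E] [NormedSpace ℝ E] [NormedSpace ℂ E]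

lemma map_complex_smul [IsScalarTower ℝ ℂ E] {F : Type*} [AddCommGroup F] [Module ℝ F]
    [TopologicalSpace F] (T : E →L[ℝ] F) (c : ℂ) (v : E) :
    T (c • v) = c.re • T v + c.im • T (Complex.I • v) := by
  have h : c • v = c.re • v + c.im • (Complex.I • v) := by
    conv_lhs => rw [← Complex.re_add_im c, add_smul, mul_smul]
    rw [← algebraMap_smul ℂ c.re v, ← algebraMap_smul ℂ c.im (Complex.I • v)]
    rfl
  rw [h, map_add, map_smul, map_smul]

/-- The `ℂ`-linear part `∂f(p)` of the differential of `f` at `p`. -/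
noncomputable def dHolLinear [IsScalarTower ℝ ℂ E] (f : E → ℂ) (p : E) : E →ₗ[ℂ] ℂ where
  toFun := dHol f p
  map_add' v w := by simp only [dHol, smul_add, map_add]; ring
  map_smul' c v := by
    have h2 : Complex.I • Complex.I • v = -v := by rw [smul_smul]; simp
    simp only [dHol, smul_comm Complex.I c v, map_complex_smul _ c, h2, map_neg, smul_eq_mul,
      RingHom.id_apply, Complex.real_smul]
    linear_combination (1 / 2 * (fderiv ℝ f p v - Complex.I * fderiv ℝ f p (Complex.I • v)))
      * Complex.re_add_im c + 1 / 2 * c.im * fderiv ℝ f p (Complex.I • v) * Complex.I_sq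

lemma dHol_add_dBar (f : E → ℂ) (p v : E) : dHol f p v + dBar f p v = fderiv ℝ f p v := by
  simp only [dHol, dBar]; ring

lemma dBar_add_right (f : E → ℂ) (p v w : E) : dBar f p (v + w) = dBar f p v + dBar f p w := by
  simp only [dBar, smul_add, map_add]; ring

lemma dBar_smul [IsScalarTower ℝ ℂ E] (f : E → ℂ) (p : E) (c : ℂ) (v : E) :
    dBar f p (c • v) = star c * dBar f p v := by
  have h2 : Complex.I • Complex.I • v = -v := by rw [smul_smul]; simp
  simp only [dBar, smul_comm Complex.I c v, map_complex_smul _ c, h2, map_neg,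
    Complex.real_smul]
  have h3 : star c = c.re - c.im * Complex.I := by
    apply Complex.ext <;> simp
  rw [h3]
  linear_combination (1 / 2 * c.im * fderiv ℝ f p (Complex.I • v)) * Complex.I_sq

/-- `∂̄f(p)` as an additive map, to expand it in a basis. -/
noncomputable def dBarAddHom (f : E → ℂ) (p : E) : E →+ ℂ where
  toFun := dBar f p
  map_zero' := by simp [dBar]
  map_add' := dBar_add_right f p

end Wirtinger

lemma prod_eq_sum_single {n : ℕ} (v : Cn n × Cn n) :
    v = ∑ j, v.1 j • ((Pi.single j 1 : Cn n), (0 : Cn n))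
      + ∑ j, v.2 j • ((0 : Cn n), (Pi.single j 1 : Cn n)) := by
  have h : ∀ w : Cn n, ∑ j, w j • (Pi.single j 1 : Cn n) = w := fun w => by
    funext i
    simp [Finset.sum_apply, Pi.single_apply]
  ext1 <;> simp [Prod.fst_sum, Prod.snd_sum, h]

/-- `∂̄f(p)` is controlled by its values on the standard basis. -/
lemma norm_dBar_le {n : ℕ} {f : Cn n × Cn n → ℂ} {p : Cn n × Cn n} {ε : ℝ}
    (h : ∀ j : Fin n, ‖dBar f p (Pi.single j 1, 0)‖ ≤ ε ∧ ‖dBar f p (0, Pi.single j 1)‖ ≤ ε)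
    (v : Cn n × Cn n) : ‖dBar f p v‖ ≤ 2 * n * ε * ‖v‖ := by
  have h1 : dBar f p v = ∑ j, star (v.1 j) * dBar f p (Pi.single j 1, 0)
      + ∑ j, star (v.2 j) * dBar f p (0, Pi.single j 1) := by
    conv_lhs => rw [prod_eq_sum_single v]
    rw [dBar_add_right]
    have h2 : ∀ u : Fin n → Cn n × Cn n, dBar f p (∑ j, u j) = ∑ j, dBar f p (u j) := fun u =>
      map_sum (dBarAddHom f p) u _
    simp only [h2, dBar_smul]
  have h3 : ∀ j, ‖star (v.1 j) * dBar f p (Pi.single j 1, 0)‖ ≤ ‖v‖ * ε := fun j => by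
    rw [norm_mul, norm_star]
    exact mul_le_mul ((norm_le_pi_norm v.1 j).trans (norm_fst_le v)) (h j).1 (norm_nonneg _)
      (norm_nonneg _)
  have h4 : ∀ j, ‖star (v.2 j) * dBar f p (0, Pi.single j 1)‖ ≤ ‖v‖ * ε := fun j => by
    rw [norm_mul, norm_star]
    exact mul_le_mul ((norm_le_pi_norm v.2 j).trans (norm_snd_le v)) (h j).2 (norm_nonneg _)
      (norm_nonneg _)
  rw [h1]
  calc _ ≤ ∑ j : Fin n, ‖v‖ * ε + ∑ j : Fin n, ‖v‖ * ε :=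
        (norm_add_le _ _).trans (add_le_add (norm_sum_le_of_le _ fun j _ => h3 j)
          (norm_sum_le_of_le _ fun j _ => h4 j))
    _ = 2 * n * ε * ‖v‖ := by simp; ring

/-! ### Deformation of contours -/

section Homotopy

variable {n : ℕ} {X : Type*} [NormedAddCommGroup X] [NormedSpace ℝ X]

/-- The differential of the coefficient of `P^* (G dx ∧ dỹ)` in the directions `v`. -/
lemma hasFDerivAt_mul_volForm {P : X → Cn n × Cn n} {G : Cn n × Cn n → ℂ} {q : X}
    (hP : ContDiffAt ℝ ∞ P q) (hG : DifferentiableAt ℝ G (P q)) (v : Fin n ⊕ Fin n → X) :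
    ∃ L : X →L[ℝ] ℂ,
      HasFDerivAt (fun q => G (P q) * volForm n fun j => fderiv ℝ P q (v j)) L q ∧
      ∀ w, L w = fderiv ℝ G (P q) (fderiv ℝ P q w) * volForm n (fun j => fderiv ℝ P q (v j))
        + G (P q) * ∑ j, volForm n (Function.update (fun j => fderiv ℝ P q (v j)) j
            (fderiv ℝ (fderiv ℝ P) q w (v j))) := by
  have h1 : HasFDerivAt (fun q => G (P q)) ((fderiv ℝ G (P q)).comp (fderiv ℝ P q)) q :=
    hG.hasFDerivAt.comp q (hP.differentiableAt (by simp)).hasFDerivAt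
  have h2 : HasFDerivAt (fderiv ℝ P) (fderiv ℝ (fderiv ℝ P) q) q :=
    ((hP.fderiv_right (m := 1) (by norm_cast)).differentiableAt (by simp)).hasFDerivAt
  have h3 : ∀ j, HasFDerivAt (fun q => fderiv ℝ P q (v j))
      ((ContinuousLinearMap.apply ℝ _ (v j)).comp (fderiv ℝ (fderiv ℝ P) q)) q := fun j =>
    (ContinuousLinearMap.hasFDerivAt (x := fderiv ℝ P q)
      (ContinuousLinearMap.apply ℝ (Cn n × Cn n) (v j))).comp q h2
  have h4 := HasFDerivAt.multilinear_comp (f := volFormR n) h3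
  refine ⟨_, h1.mul h4, fun w => ?_⟩
  simp
  ring

/-- The form `G dx ∧ dỹ` is closed up to `∂̄G`: if `G` is holomorphic at `P q`, the right hand side
vanishes by Cramer's rule. -/
lemma fderiv_mul_volForm_sub_sum {P : X → Cn n × Cn n} {G : Cn n × Cn n → ℂ} {q : X}
    (hP : ContDiffAt ℝ ∞ P q) (hG : DifferentiableAt ℝ G (P q)) (v : Fin n ⊕ Fin n → X) (v₀ : X) :
    fderiv ℝ (fun q => G (P q) * volForm n fun j => fderiv ℝ P q (v j)) q v₀
      - ∑ i, fderiv ℝ (fun q => G (P q) * volForm n fun j =>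
          fderiv ℝ P q (Function.update v i v₀ j)) q (v i)
      = dBar G (P q) (fderiv ℝ P q v₀) * volForm n (fun j => fderiv ℝ P q (v j))
        - ∑ i, dBar G (P q) (fderiv ℝ P q (v i))
          * volForm n (Function.update (fun j => fderiv ℝ P q (v j)) i (fderiv ℝ P q v₀)) := by
  have hsymm : ∀ a b, fderiv ℝ (fderiv ℝ P) q a b = fderiv ℝ (fderiv ℝ P) q b a :=
    fun a b => (hP.isSymmSndFDerivAt (by simp; norm_cast)) a b
  have hform : ∀ v : Fin n ⊕ Fin n → X, ∀ w,
      fderiv ℝ (fun q => G (P q) * volForm n fun j => fderiv ℝ P q (v j)) q w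
      = fderiv ℝ G (P q) (fderiv ℝ P q w) * volForm n (fun j => fderiv ℝ P q (v j))
        + G (P q) * ∑ j, volForm n (Function.update (fun j => fderiv ℝ P q (v j)) j
            (fderiv ℝ (fderiv ℝ P) q w (v j))) := fun v w => by
    obtain ⟨L, hL, hL'⟩ := hasFDerivAt_mul_volForm hP hG v
    rw [hL.fderiv, hL']
  set c : Fin n ⊕ Fin n → Cn n × Cn n := fun j => fderiv ℝ P q (v j) with hc
  set c₀ := fderiv ℝ P q v₀ with hc₀
  have hupd : ∀ i, (fun j => fderiv ℝ P q (Function.update v i v₀ j)) = Function.update c i c₀ := by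
    intro i
    funext j
    by_cases hj : j = i
    · subst hj; simp [hc₀]
    · simp [hj, hc]
  -- the terms with two replaced columns are antisymmetric
  set T : Fin n ⊕ Fin n → Fin n ⊕ Fin n → ℂ := fun i j =>
    if j = i then 0 else volForm n (Function.update (Function.update c i c₀) j
      (fderiv ℝ (fderiv ℝ P) q (v i) (v j))) with hT
  have hanti : ∀ i j, T i j = -T j i := by
    intro i j
    by_cases hij : j = i
    · simp [hT, hij]
    · simp only [hT, if_neg hij, if_neg (Ne.symm hij)]
      rw [← AlternatingMap.map_swap _ _ (i := i) (j := j) (Ne.symm hij)]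
      congr 1
      funext k
      simp only [Function.comp_apply]
      by_cases hki : k = i
      · subst hki; simp [hij, Ne.symm hij]
      · by_cases hkj : k = j
        · subst hkj; simp [hsymm]
        · simp [hki, hkj, Equiv.swap_apply_of_ne_of_ne hki hkj]
  have hTsum : ∑ i, ∑ j, T i j = 0 := by
    have h1 : ∑ i, ∑ j, T i j = -∑ i, ∑ j, T i j := by
      conv_lhs => rw [Finset.sum_comm]
      rw [← Finset.sum_neg_distrib]
      refine Finset.sum_congr rfl fun i _ => ?_
      rw [← Finset.sum_neg_distrib]
      exact Finset.sum_congr rfl fun j _ => hanti j i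
    exact self_eq_neg.mp h1
  have hsnd : ∀ i, ∑ j, volForm n (Function.update (Function.update c i c₀) j
      (fderiv ℝ (fderiv ℝ P) q (v i) (Function.update v i v₀ j)))
      = volForm n (Function.update c i (fderiv ℝ (fderiv ℝ P) q v₀ (v i))) + ∑ j, T i j := by
    intro i
    rw [← Finset.add_sum_erase _ _ (Finset.mem_univ i), ← Finset.add_sum_erase (f := T i) _
      (Finset.mem_univ i)]
    simp only [Function.update_self, Function.update_idem, hT, if_true, zero_add]
    rw [hsymm]
    congr 1
    refine Finset.sum_congr rfl fun j hj => ?_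
    have : j ≠ i := Finset.ne_of_mem_erase hj
    simp [this]
  have hcr := volForm_cramer (dHolLinear G (P q)) c c₀
  change dHol G (P q) c₀ * _ = ∑ i, dHol G (P q) (c i) * _ at hcr
  simp only [hform, hupd, hsnd, ← dHol_add_dBar, add_mul, mul_add, Finset.sum_add_distrib,
    ← Finset.mul_sum, hTsum]
  rw [hcr]
  ring

end Homotopy

lemma integral_fderiv_apply_eq_zero {n : ℕ} {f : Par n → ℂ} (hf : ContDiff ℝ 1 f)
    (hfc : HasCompactSupport f) (v : Par n) : ∫ s, fderiv ℝ f s v = 0 := by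
  have h1 : Integrable fun s => fderiv ℝ f s v :=
    ((hf.continuous_fderiv (by simp)).clm_apply continuous_const).integrable_of_hasCompactSupport
      (hfc.fderiv_apply (𝕜 := ℝ) v)
  have h2 := integral_mul_fderiv_eq_neg_fderiv_mul_of_integrable (𝕜 := ℂ) (μ := volume)
    (f := fun _ : Par n => (1 : ℂ)) (g := f) (v := v) (by simp) (by simpa using h1)
    (by simpa using hf.continuous.integrable_of_hasCompactSupport hfc)
    (fun _ _ => differentiableAt_const _) fun s _ => (hf.differentiable (by simp)) s
  simpa using h2

/-- The integrand obtained when the variable `i` of the homotopy parameter domain is traded for the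
homotopy time. -/
noncomputable def fluxDensity {n : ℕ} (P : ℝ × Par n → Cn n × Cn n) (q : ℝ × Par n)
    (i : Fin n ⊕ Fin n) : ℂ :=
  volForm n (Function.update (fun j => fderiv ℝ P q (0, Pi.single j 1)) i (fderiv ℝ P q (1, 0)))

lemma contDiffOn_mul_volForm {n : ℕ} {X : Type*} [NormedAddCommGroup X] [NormedSpace ℝ X]
    {P : X → Cn n × Cn n} {G : Cn n × Cn n → ℂ} {N : Set X} (hN : IsOpen N)
    (hP : ContDiffOn ℝ ∞ P N) {Q : Set (Cn n × Cn n)} (hG : ContDiffOn ℝ ∞ G Q)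
    (hPQ : MapsTo P N Q) (v : Fin n ⊕ Fin n → X) :
    ContDiffOn ℝ ∞ (fun q => G (P q) * volForm n fun j => fderiv ℝ P q (v j)) N := by
  refine (hG.comp hP hPQ).mul ?_
  have h1 : ContDiffOn ℝ ∞ (fun q j => fderiv ℝ P q (v j)) N := by
    rw [contDiffOn_pi]
    exact fun j => (hP.fderiv_of_isOpen hN (m := ∞) (by simp)).clm_apply contDiffOn_const
  exact (volFormR n).contDiff.comp_contDiffOn h1

/-- Stokes' formula for a homotopy `P` of contours, with a cutoff `χ` in the parameter domain: the
integrals of `G dx ∧ dỹ` over the two ends of the homotopy differ only by contributions from `∂̄G`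
and from the region where the cutoff is not constant. -/
lemma norm_integral_homotopy_sub_le {n : ℕ} {P : ℝ × Par n → Cn n × Cn n}
    {G : Cn n × Cn n → ℂ} {χ : Par n → ℝ} (hχ : ContDiff ℝ ∞ χ) (hχc : HasCompactSupport χ)
    {N : Set (ℝ × Par n)} (hN : IsOpen N) (hχN : Ioo (-1 : ℝ) 2 ×ˢ tsupport χ ⊆ N)
    (hP : ContDiffOn ℝ ∞ P N) {Q : Set (Cn n × Cn n)} (hQ : IsOpen Q) (hG : ContDiffOn ℝ ∞ G Q)
    (hPQ : MapsTo P N Q) {B : ℝ}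
    (hB : ∀ t ∈ Icc (0 : ℝ) 1, ∀ s ∈ tsupport χ,
      ‖(χ s : ℂ) * (dBar G (P (t, s)) (fderiv ℝ P (t, s) (1, 0))
            * volForm n (fun j => fderiv ℝ P (t, s) (0, Pi.single j 1))
          - ∑ i, dBar G (P (t, s)) (fderiv ℝ P (t, s) (0, Pi.single i 1)) * fluxDensity P (t, s) i)
        - ∑ i, (fderiv ℝ χ s (Pi.single i 1) : ℂ) * (G (P (t, s)) * fluxDensity P (t, s) i)‖
        ≤ B) :
    ‖(∫ s, (χ s : ℂ) * (G (P (1, s)) * volForm n fun j => fderiv ℝ P (1, s) (0, Pi.single j 1)))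
      - ∫ s, (χ s : ℂ) * (G (P (0, s)) * volForm n fun j => fderiv ℝ P (0, s) (0, Pi.single j 1))‖
      ≤ B * volume.real (tsupport χ) := by
  set D := tsupport χ with hDdef
  have hD : IsCompact D := hχc
  set v : Fin n ⊕ Fin n → ℝ × Par n := fun j => (0, Pi.single j 1) with hv
  set v₀ : ℝ × Par n := (1, 0) with hv₀
  set Φ : (Fin n ⊕ Fin n → ℝ × Par n) → ℝ × Par n → ℂ := fun v q =>
    G (P q) * volForm n fun j => fderiv ℝ P q (v j) with hΦ
  have hΦs : ∀ v, ContDiffOn ℝ ∞ (Φ v) N := contDiffOn_mul_volForm hN hP hG hPQ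
  have hχs : ContDiff ℝ ∞ fun q : ℝ × Par n => (χ q.2 : ℂ) :=
    Complex.ofRealCLM.contDiff.comp (hχ.comp contDiff_snd)
  set f : ℝ × Par n → ℂ := fun q => (χ q.2 : ℂ) * Φ v q with hf
  have hfs : ContDiffOn ℝ ∞ f N := hχs.contDiffOn.mul (hΦs v)
  have hflux : ∀ q i, Φ (Function.update v i v₀) q = G (P q) * fluxDensity P q i := by
    intro q i
    simp only [hΦ, fluxDensity]
    congr 2
    funext j
    by_cases hj : j = i
    · subst hj; simp [hv₀]
    · simp [hj, hv]
  have hset : ∀ t, ∫ s, f (t, s) = ∫ s in D, f (t, s) := fun t =>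
    (setIntegral_eq_integral_of_forall_compl_eq_zero fun s hs => by
      simp [hf, image_eq_zero_of_notMem_tsupport hs]).symm
  have hder : ∀ t ∈ Ioo (-1 : ℝ) 2, HasDerivAt (fun t => ∫ s in D, f (t, s))
      ((∫ s in D, (fderiv ℝ f (t, s)).comp (ContinuousLinearMap.inl ℝ ℝ (Par n))) 1) t :=
    fun t ht => (hasFDerivAt_setIntegral_of_contDiffOn isOpen_Ioo hD hN hχN hfs ht).hasDerivAt
  have hI : Icc (0 : ℝ) 1 ⊆ Ioo (-1) 2 := fun t ht => ⟨by linarith [ht.1], by linarith [ht.2]⟩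
  have hbound : ∀ t ∈ Icc (0 : ℝ) 1,
      ‖(∫ s in D, (fderiv ℝ f (t, s)).comp (ContinuousLinearMap.inl ℝ ℝ (Par n))) 1‖
        ≤ B * volume.real D := by
    intro t ht
    have htN : ∀ s ∈ D, (t, s) ∈ N := fun s hs => hχN ⟨hI ht, hs⟩
    have hemb : ContinuousOn (fun s : Par n => (t, s)) D := by fun_prop
    have hfint : IntegrableOn
        (fun s => (fderiv ℝ f (t, s)).comp (ContinuousLinearMap.inl ℝ ℝ (Par n))) D := by
      refine ContinuousOn.integrableOn_compact hD ?_
      exact ((hfs.continuousOn_fderiv_of_isOpen hN (by simp)).comp hemb htN).clm_comp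
        continuousOn_const
    rw [ContinuousLinearMap.integral_apply hfint]
    -- the divergence terms
    set g : Fin n ⊕ Fin n → Par n → ℂ := fun i s => (χ s : ℂ) * Φ (Function.update v i v₀) (t, s)
      with hg
    have hgsupp : ∀ i, tsupport (g i) ⊆ D := fun i =>
      closure_mono fun s hs => by
        simp only [hg, Function.mem_support] at hs ⊢
        intro h
        simp [h] at hs
    have hgd : ∀ i, ∀ s ∈ D, HasFDerivAt (g i)
        ((χ s : ℂ) • (fderiv ℝ (Φ (Function.update v i v₀)) (t, s)).comp
            (ContinuousLinearMap.inr ℝ ℝ (Par n))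
          + Φ (Function.update v i v₀) (t, s) • Complex.ofRealCLM.comp (fderiv ℝ χ s)) s := by
      intro i s hs
      have h1 : HasFDerivAt (Φ (Function.update v i v₀))
          (fderiv ℝ (Φ (Function.update v i v₀)) (t, s)) (t, s) :=
        (((hΦs _).contDiffAt (hN.mem_nhds (htN s hs))).differentiableAt (by simp)).hasFDerivAt
      have h2 : HasFDerivAt (fun s => Φ (Function.update v i v₀) (t, s)) _ s :=
        h1.comp s (hasFDerivAt_prodMk_right t s)
      have h3 : HasFDerivAt (fun s => (χ s : ℂ)) (Complex.ofRealCLM.comp (fderiv ℝ χ s)) s :=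
        Complex.ofRealCLM.hasFDerivAt.comp s (hχ.differentiable (by simp) s).hasFDerivAt
      exact h3.mul h2
    have hgs : ∀ i, ContDiff ℝ 1 (g i) := by
      intro i
      refine contDiff_iff_contDiffAt.2 fun s => ?_
      by_cases hs : s ∈ tsupport (g i)
      swap
      · exact contDiffAt_const.congr_of_eventuallyEq (notMem_tsupport_iff_eventuallyEq.1 hs)
      have hs' := htN s (hgsupp i hs)
      have h1 : ContDiffAt ℝ 1 (Φ (Function.update v i v₀)) (t, s) :=
        ((hΦs _).contDiffAt (hN.mem_nhds hs')).of_le (by norm_cast)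
      have h2 : ContDiffAt ℝ 1 (fun s => (χ s : ℂ)) s :=
        ((Complex.ofRealCLM.contDiff.comp hχ).of_le (by norm_cast)).contDiffAt
      exact h2.mul (h1.comp s (by fun_prop))
    have hgc : ∀ i, HasCompactSupport (g i) := fun i =>
      hD.of_isClosed_subset isClosed_closure (hgsupp i)
    have hgint : ∀ i, ∫ s in D, fderiv ℝ (g i) s (Pi.single i 1) = 0 := by
      intro i
      rw [setIntegral_eq_integral_of_forall_compl_eq_zero,
        integral_fderiv_apply_eq_zero (hgs i) (hgc i)]
      intro s hs
      have : s ∉ tsupport (fderiv ℝ (g i)) := fun h =>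
        hs (hgsupp i (tsupport_fderiv_subset ℝ h))
      simp [image_eq_zero_of_notMem_tsupport this]
    have hgi : ∀ i, IntegrableOn (fun s => fderiv ℝ (g i) s (Pi.single i 1)) D := fun i =>
      ((((hgs i).continuous_fderiv (by simp)).clm_apply
        continuous_const).continuousOn).integrableOn_compact hD
    have hsum : ∫ s in D, ∑ i, fderiv ℝ (g i) s (Pi.single i 1) = 0 := by
      rw [integral_finsetSum _ fun i _ => hgi i]
      exact Finset.sum_eq_zero fun i _ => hgint i
    have hfint' : IntegrableOn
        (fun s => ((fderiv ℝ f (t, s)).comp (ContinuousLinearMap.inl ℝ ℝ (Par n))) 1) D :=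
      (ContinuousLinearMap.apply ℝ ℂ (1 : ℝ)).integrable_comp hfint
    rw [← sub_zero (∫ s in D, _), ← hsum,
      ← integral_sub hfint' (integrable_finsetSum _ fun i _ => hgi i)]
    refine norm_setIntegral_le_of_norm_le_const hD.measure_lt_top fun s hs => ?_
    refine le_of_eq_of_le (congrArg _ ?_) (hB t ht s hs)
    have hq := hN.mem_nhds (htN s hs)
    have hPd := hP.contDiffAt hq
    have hGd : DifferentiableAt ℝ G (P (t, s)) :=
      (hG.contDiffAt (hQ.mem_nhds (hPQ (htN s hs)))).differentiableAt (by simp)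
    have hdiv := fderiv_mul_volForm_sub_sum hPd hGd v v₀
    have hfd : fderiv ℝ f (t, s) v₀ = (χ s : ℂ) * fderiv ℝ (Φ v) (t, s) v₀ := by
      have h1 : HasFDerivAt (Φ v) (fderiv ℝ (Φ v) (t, s)) (t, s) :=
        (((hΦs v).contDiffAt hq).differentiableAt (by simp)).hasFDerivAt
      have h3 : HasFDerivAt (fun q : ℝ × Par n => (χ q.2 : ℂ))
          ((Complex.ofRealCLM.comp (fderiv ℝ χ s)).comp (ContinuousLinearMap.snd ℝ ℝ (Par n)))
          (t, s) :=
        HasFDerivAt.comp (t, s) (g := fun s => (χ s : ℂ)) (f := Prod.snd)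
          (Complex.ofRealCLM.hasFDerivAt.comp s (hχ.differentiable (by simp) s).hasFDerivAt)
          hasFDerivAt_snd
      have h4 : HasFDerivAt f _ (t, s) := h3.mul h1
      rw [h4.fderiv]
      simp [hv₀]
    have hgd' : ∀ i, fderiv ℝ (g i) s (Pi.single i 1)
        = (χ s : ℂ) * fderiv ℝ (Φ (Function.update v i v₀)) (t, s) (v i)
          + (fderiv ℝ χ s (Pi.single i 1) : ℂ) * (G (P (t, s)) * fluxDensity P (t, s) i) := by
      intro i
      rw [(hgd i s hs).fderiv, ← hflux]
      simp [hv]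
      ring
    have hinl : ((fderiv ℝ f (t, s)).comp (ContinuousLinearMap.inl ℝ ℝ (Par n))) 1
        = fderiv ℝ f (t, s) v₀ := by simp [hv₀]
    rw [hinl, hfd]
    simp only [hgd', Finset.sum_add_distrib, ← Finset.mul_sum]
    rw [← sub_sub, ← mul_sub]
    congr 2
  have key := norm_image_sub_le_of_norm_deriv_le_segment_01'
    (fun t ht => (hder t (hI ht)).hasDerivWithinAt)
    (fun t ht => hbound t (Ico_subset_Icc_self ht))
  rw [← hset, ← hset] at key
  exact key

/-! ### Almost holomorphic functions along the anti-diagonal -/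

/-- The parametrization `y ↦ (y, ȳ)` of the anti-diagonal, as a real linear map. -/
noncomputable def antiDiag (n : ℕ) : Cn n →L[ℝ] Cn n × Cn n :=
  (ContinuousLinearMap.id ℝ (Cn n)).prod (starL' ℝ : Cn n ≃L[ℝ] Cn n).toContinuousLinearMap

@[simp] lemma antiDiag_apply {n : ℕ} (y : Cn n) : antiDiag n y = (y, star y) := rfl

lemma IsAlmostHolomorphic.exists_norm_dBar_le {n : ℕ} {f : Cn n × Cn n → ℂ}
    {U : Set (Cn n × Cn n)} (hf : IsAlmostHolomorphic f U) {K : Set (Cn n × Cn n)} (hK : K ⊆ U)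
    (hKc : IsCompact K) (N : ℕ) :
    ∃ C : ℝ, 0 ≤ C ∧ ∀ p ∈ K, ∀ v, ‖dBar f p v‖ ≤ C * ‖p.2 - star p.1‖ ^ N * ‖v‖ := by
  obtain ⟨C, hC⟩ := hf.dbar K hK hKc N
  refine ⟨2 * n * |C|, by positivity, fun p hp v => ?_⟩
  have h : ∀ x : ℝ, x ≤ C * ‖p.2 - star p.1‖ ^ N → x ≤ |C| * ‖p.2 - star p.1‖ ^ N := fun x hx =>
    hx.trans (mul_le_mul_of_nonneg_right (le_abs_self C) (by positivity))
  refine (norm_dBar_le (fun j => ⟨h _ (hC p hp j).1, h _ (hC p hp j).2⟩) v).trans (le_of_eq ?_)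
  ring

lemma hasFDerivAt_fderiv {E F : Type*} [NormedAddCommGroup E] [NormedSpace ℝ E]
    [NormedAddCommGroup F] [NormedSpace ℝ F] {f : E → F} {W : Set E} (hW : IsOpen W)
    (hf : ContDiffOn ℝ ∞ f W) {p : E} (hp : p ∈ W) :
    HasFDerivAt (fderiv ℝ f) (fderiv ℝ (fderiv ℝ f) p) p :=
  (((hf.contDiffAt (hW.mem_nhds hp)).fderiv_right (m := 1) (by norm_cast)).differentiableAt
    (by simp)).hasFDerivAt

lemma fderiv_fderiv_symm {E F : Type*} [NormedAddCommGroup E] [NormedSpace ℝ E]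
    [NormedAddCommGroup F] [NormedSpace ℝ F] {f : E → F} {W : Set E} (hW : IsOpen W)
    (hf : ContDiffOn ℝ ∞ f W) {p : E} (hp : p ∈ W) (a b : E) :
    fderiv ℝ (fderiv ℝ f) p a b = fderiv ℝ (fderiv ℝ f) p b a :=
  (hf.contDiffAt (hW.mem_nhds hp)).isSymmSndFDerivAt (by simp; norm_cast) a b

/-- On the anti-diagonal the second differential of an almost holomorphic function is complex
bilinear, because `∂̄f` vanishes there to second order. -/
lemma IsAlmostHolomorphic.fderiv_fderiv_I_smul {n : ℕ} {f : Cn n × Cn n → ℂ}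
    {W : Set (Cn n × Cn n)} (hW : IsOpen W) (hf : IsAlmostHolomorphic f W) {y : Cn n}
    (hy : (y, star y) ∈ W) (a b : Cn n × Cn n) :
    fderiv ℝ (fderiv ℝ f) (y, star y) a (Complex.I • b)
      = Complex.I * fderiv ℝ (fderiv ℝ f) (y, star y) a b := by
  set p : Cn n × Cn n := (y, star y) with hp
  have hH := hasFDerivAt_fderiv hW hf.smooth hy
  have hder : ∀ b, HasFDerivAt (fun q => fderiv ℝ f q b)
      ((ContinuousLinearMap.apply ℝ ℂ b).comp (fderiv ℝ (fderiv ℝ f) p)) p := fun b =>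
    (ContinuousLinearMap.hasFDerivAt (x := fderiv ℝ f p)
      (ContinuousLinearMap.apply ℝ ℂ b)).comp p hH
  obtain ⟨r, hr, hrW⟩ := Metric.isOpen_iff.1 hW p hy
  have hK : Metric.closedBall p (r / 2) ⊆ W :=
    (Metric.closedBall_subset_ball (by linarith)).trans hrW
  obtain ⟨C, hC0, hC⟩ := hf.exists_norm_dBar_le hK (isCompact_closedBall _ _) 2
  have hzero : HasFDerivAt (fun q => dBar f q b) (0 : Cn n × Cn n →L[ℝ] ℂ) p := by
    refine Asymptotics.IsBigO.hasFDerivAt (n := 2) (Asymptotics.IsBigO.of_bound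
      (C * 4 * ‖b‖) ?_) one_lt_two
    filter_upwards [Metric.closedBall_mem_nhds p (half_pos hr)] with q hq
    refine (hC q hq b).trans ?_
    have h1 : ‖q.2 - star q.1‖ ≤ 2 * ‖q - p‖ := by
      have : q.2 - star q.1 = (q - p).2 - star (q - p).1 := by simp [hp]
      rw [this, two_mul]
      refine (norm_sub_le _ _).trans (add_le_add (norm_snd_le _) ?_)
      rw [norm_star]
      exact norm_fst_le _
    rw [norm_pow, norm_norm]
    calc C * ‖q.2 - star q.1‖ ^ 2 * ‖b‖ ≤ C * (2 * ‖q - p‖) ^ 2 * ‖b‖ := by gcongr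
      _ = C * 4 * ‖b‖ * ‖q - p‖ ^ 2 := by ring
  have h2 := ((hder b).add ((hder (Complex.I • b)).const_mul Complex.I)).const_mul (1 / 2 : ℂ)
  have h3 := congrArg (fun T : Cn n × Cn n →L[ℝ] ℂ => T a) (h2.unique hzero)
  simp at h3
  linear_combination (-2 * Complex.I) * h3 + fderiv ℝ (fderiv ℝ f) p a (Complex.I • b) * Complex.I_sq

/-- The second differential of `x ↦ Ψ(x, x̄)`. -/
lemma fderiv_fderiv_comp_antiDiag {n : ℕ} {f : Cn n × Cn n → ℂ} {W : Set (Cn n × Cn n)}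
    (hW : IsOpen W) (hf : ContDiffOn ℝ ∞ f W) {y : Cn n} (hy : (y, star y) ∈ W) (u v : Cn n) :
    fderiv ℝ (fderiv ℝ fun x => f (x, star x)) y u v
      = fderiv ℝ (fderiv ℝ f) (y, star y) (u, star u) (v, star v) := by
  have hopen : IsOpen (antiDiag n ⁻¹' W) := hW.preimage (antiDiag n).continuous
  have h1 : fderiv ℝ (fun x => f (x, star x)) =ᶠ[𝓝 y]
      fun x => (fderiv ℝ f (x, star x)).comp (antiDiag n) := by
    filter_upwards [hopen.mem_nhds hy] with x hx
    have hx' : HasFDerivAt f (fderiv ℝ f (x, star x)) (antiDiag n x) :=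
      ((hf.contDiffAt (hW.mem_nhds hx)).differentiableAt (by simp)).hasFDerivAt
    exact (hx'.comp x (antiDiag n).hasFDerivAt).fderiv
  rw [h1.fderiv_eq]
  have h2 : HasFDerivAt (fderiv ℝ f) (fderiv ℝ (fderiv ℝ f) (y, star y)) (antiDiag n y) :=
    hasFDerivAt_fderiv hW hf hy
  have h3 : HasFDerivAt (fun x => fderiv ℝ f (x, star x)) _ y :=
    h2.comp y (antiDiag n).hasFDerivAt
  rw [(h3.clm_comp (hasFDerivAt_const (antiDiag n) y)).fderiv]
  simp

section Hessian

variable {n : ℕ} {Ψ : Cn n × Cn n → ℂ} {W : Set (Cn n × Cn n)} {Φ : Cn n → ℝ} {y : Cn n}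

/-- Polarization: the second differential of `x ↦ Ψ(x, x̄)` determines the mixed Hessian of `Ψ`. -/
lemma mixed_hessian_identities (hW : IsOpen W) (hΨ : IsAlmostHolomorphic Ψ W)
    (hy : (y, star y) ∈ W) (u v : Cn n) :
    fderiv ℝ (fderiv ℝ fun x => Ψ (x, star x)) y u v
        + fderiv ℝ (fderiv ℝ fun x => Ψ (x, star x)) y (Complex.I • u) (Complex.I • v)
      = 2 * fderiv ℝ (fderiv ℝ Ψ) (y, star y) (u, 0) (0, star v)
        + 2 * fderiv ℝ (fderiv ℝ Ψ) (y, star y) (v, 0) (0, star u) ∧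
    Complex.I * (fderiv ℝ (fderiv ℝ fun x => Ψ (x, star x)) y u (Complex.I • v)
        - fderiv ℝ (fderiv ℝ fun x => Ψ (x, star x)) y (Complex.I • u) v)
      = 2 * fderiv ℝ (fderiv ℝ Ψ) (y, star y) (u, 0) (0, star v)
        - 2 * fderiv ℝ (fderiv ℝ Ψ) (y, star y) (v, 0) (0, star u) := by
  simp only [fderiv_fderiv_comp_antiDiag hW hΨ.smooth hy]
  set H := fderiv ℝ (fderiv ℝ Ψ) (y, star y)
  have hsymm : ∀ a b, H a b = H b a := fderiv_fderiv_symm hW hΨ.smooth hy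
  have hI : ∀ a b, H a (Complex.I • b) = Complex.I * H a b := hΨ.fderiv_fderiv_I_smul hW hy
  have hI' : ∀ a b, H (Complex.I • a) b = Complex.I * H a b := fun a b => by
    rw [hsymm, hI, hsymm]
  have e1 : ∀ u : Cn n, ((u, star u) : Cn n × Cn n) = (u, 0) + (0, star u) := by simp
  have e2 : ∀ u : Cn n, ((Complex.I • u, star (Complex.I • u)) : Cn n × Cn n)
      = Complex.I • ((u, 0) - (0, star u)) := fun u => by
    ext1 <;> simp
  rw [e2, e2, e1, e1]
  simp only [hI, hI', map_add, map_sub, add_apply,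
    sub_apply]
  rw [hsymm (0, star u) (v, 0)]
  constructor
  · linear_combination (H (u, 0) (v, 0) - H (u, 0) (0, star v) - H (v, 0) (0, star u)
      + H (0, star u) (0, star v)) * Complex.I_sq
  · linear_combination (2 * H (v, 0) (0, star u) - 2 * H (u, 0) (0, star v)) * Complex.I_sq

/-- As `Ψ` is real on the anti-diagonal, the mixed Hessian is Hermitian; only the real parts are
needed. -/
lemma re_mixed_hessian_symm (hW : IsOpen W) (hΨ : IsAlmostHolomorphic Ψ W)
    (hy : (y, star y) ∈ W) (hΦ : ContDiffAt ℝ ∞ Φ y)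
    (hΨΦ : ∀ᶠ x in 𝓝 y, Ψ (x, star x) = (Φ x : ℂ)) (u v : Cn n) :
    (fderiv ℝ (fderiv ℝ Ψ) (y, star y) (u, 0) (0, star v)).re
      = (fderiv ℝ (fderiv ℝ Ψ) (y, star y) (v, 0) (0, star u)).re := by
  have hreal : ∀ a b, (fderiv ℝ (fderiv ℝ fun x => Ψ (x, star x)) y a b).im = 0 := by
    intro a b
    have h1 : (fderiv ℝ fun x => Ψ (x, star x)) =ᶠ[𝓝 y]
        fun x => Complex.ofRealCLM.comp (fderiv ℝ Φ x) := by
      have h2 : ∀ᶠ x in 𝓝 y, ContDiffAt ℝ 1 Φ x :=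
        (hΦ.of_le (by norm_cast)).eventually (by simp)
      filter_upwards [hΨΦ.eventually_nhds, h2] with x hx hx2
      rw [Filter.EventuallyEq.fderiv_eq hx]
      exact (Complex.ofRealCLM.hasFDerivAt.comp x
        (hx2.differentiableAt (by simp)).hasFDerivAt).fderiv
    rw [h1.fderiv_eq]
    have h3 : HasFDerivAt (fderiv ℝ Φ) (fderiv ℝ (fderiv ℝ Φ) y) y :=
      ((hΦ.fderiv_right (m := 1) (by norm_cast)).differentiableAt (by simp)).hasFDerivAt
    rw [((hasFDerivAt_const Complex.ofRealCLM y).clm_comp h3).fderiv]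
    simp
  have h := congrArg Complex.re (mixed_hessian_identities hW hΨ hy u v).2
  simp [hreal] at h
  linarith

/-- The Levi form of `Φ` is the mixed Hessian of `Ψ` on the diagonal `(ξ, ξ̄)`. -/
lemma leviForm_eq (hW : IsOpen W) (hΨ : IsAlmostHolomorphic Ψ W)
    (hy : (y, star y) ∈ W) (hΨΦ : ∀ᶠ x in 𝓝 y, Ψ (x, star x) = (Φ x : ℂ)) (ξ : Cn n) :
    leviForm Φ y ξ = (fderiv ℝ (fderiv ℝ Ψ) (y, star y) (ξ, 0) (0, star ξ)).re := by
  set H := fderiv ℝ (fderiv ℝ Ψ) (y, star y) with hH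
  have hsymm : ∀ a b, H a b = H b a := fderiv_fderiv_symm hW hΨ.smooth hy
  have hI : ∀ a b, H a (Complex.I • b) = Complex.I * H a b := hΨ.fderiv_fderiv_I_smul hW hy
  have hc : ∀ (c : ℂ) a b, H a (c • b) = c * H a b := fun c a b => by
    rw [map_complex_smul, hI]
    simp only [Complex.real_smul]
    linear_combination H a b * Complex.re_add_im c
  have hc' : ∀ (c : ℂ) a b, H (c • a) b = c * H a b := fun c a b => by
    rw [hsymm, hc, hsymm]
  set f : Cn n → ℂ := fun x => Ψ (x, star x) with hf
  have hfs : ContDiffOn ℝ ∞ f (antiDiag n ⁻¹' W) :=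
    hΨ.smooth.comp (antiDiag n).contDiff.contDiffOn fun x hx => hx
  have hopen : IsOpen (antiDiag n ⁻¹' W) := hW.preimage (antiDiag n).continuous
  have hf2 := hasFDerivAt_fderiv hopen hfs (p := y) hy
  have hder : ∀ b, HasFDerivAt (fun q => fderiv ℝ f q b)
      ((ContinuousLinearMap.apply ℝ ℂ b).comp (fderiv ℝ (fderiv ℝ f) y)) y := fun b =>
    (ContinuousLinearMap.hasFDerivAt (x := fderiv ℝ f y)
      (ContinuousLinearMap.apply ℝ ℂ b)).comp y hf2
  have hterm : ∀ j k : Fin n, dHol (fun z => dBar (fun w => (Φ w : ℂ)) z (Pi.single k 1)) y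
      (Pi.single j 1) = H (Pi.single j 1, 0) (0, Pi.single k 1) := by
    intro j k
    have h1 : (fun z => dBar (fun w => (Φ w : ℂ)) z (Pi.single k 1)) =ᶠ[𝓝 y]
        fun z => (1 / 2 : ℂ) * (fderiv ℝ f z (Pi.single k 1)
          + Complex.I * fderiv ℝ f z (Complex.I • Pi.single k 1)) := by
      filter_upwards [hΨΦ.eventually_nhds] with z hz
      have h2 : (fun w => (Φ w : ℂ)) =ᶠ[𝓝 z] f := by
        filter_upwards [hz] with w hw using hw.symm
      simp only [dBar, h2.fderiv_eq]
    have h2 := ((hder (Pi.single k 1)).add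
      ((hder (Complex.I • Pi.single k 1)).const_mul Complex.I)).const_mul (1 / 2 : ℂ)
    have hst : star (Pi.single k 1 : Cn n) = Pi.single k 1 := by
      funext i
      by_cases hi : i = k
      · subst hi; simp
      · simp [hi]
    obtain ⟨m1, m2⟩ := mixed_hessian_identities hW hΨ hy (Pi.single j 1) (Pi.single k 1)
    rw [hst] at m1 m2
    simp only [dHol]
    rw [h1.fderiv_eq]
    erw [h2.fderiv]
    simp
    linear_combination (1 / 4 : ℂ) * (m1 + m2) - (1 / 4 : ℂ) * fderiv ℝ (fderiv ℝ f) y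
      (Complex.I • Pi.single j 1) (Complex.I • Pi.single k 1) * Complex.I_sq
  have hξ1 : ((ξ, 0) : Cn n × Cn n) = ∑ j, ξ j • ((Pi.single j 1 : Cn n), (0 : Cn n)) := by
    conv_lhs => rw [prod_eq_sum_single (ξ, (0 : Cn n))]
    simp
  have hξ2 : ((0, star ξ) : Cn n × Cn n)
      = ∑ j, star (ξ j) • ((0 : Cn n), (Pi.single j 1 : Cn n)) := by
    conv_lhs => rw [prod_eq_sum_single ((0 : Cn n), star ξ)]
    simp
  simp only [leviForm, hterm]
  rw [hξ1, hξ2]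
  simp only [map_sum, sum_apply, hc, hc']
  congr 1
  rw [Finset.sum_comm]
  refine Finset.sum_congr rfl fun j _ => Finset.sum_congr rfl fun k _ => ?_
  ring

/-- The projection of `ℂⁿ × ℂⁿ` onto `{(z, -z̄)}` along the anti-diagonal. -/
noncomputable def skewPart (n : ℕ) : Cn n × Cn n →L[ℝ] Cn n × Cn n :=
  (1 / 2 : ℝ) • (ContinuousLinearMap.id ℝ (Cn n × Cn n)
    - (starL' ℝ : (Cn n × Cn n) ≃L[ℝ] (Cn n × Cn n)).toContinuousLinearMap.comp
      (ContinuousLinearEquiv.prodComm ℝ (Cn n) (Cn n)).toContinuousLinearMap)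

lemma skewPart_apply (ζ : Cn n × Cn n) :
    skewPart n ζ = (1 / 2 : ℝ) • (ζ.1 - star ζ.2, ζ.2 - star ζ.1) := rfl

/-- Contracting a vector to its skew part decreases the quadratic part of the phase: in terms of
`u = z - w̄`, `v = z + w̄`, that quadratic form is the difference of the Levi forms of `v` and `u`,
up to a factor `4`, and the contraction replaces `v` by `(1 - t) v`. -/
lemma re_mixed_hessian_contract_le (hW : IsOpen W) (hΨ : IsAlmostHolomorphic Ψ W)
    (hy : (y, star y) ∈ W) (hΦ : ContDiffAt ℝ ∞ Φ y)
    (hΨΦ : ∀ᶠ x in 𝓝 y, Ψ (x, star x) = (Φ x : ℂ)) (hlevi : ∀ ξ, 0 ≤ leviForm Φ y ξ)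
    (ζ : Cn n × Cn n) {t : ℝ} (ht : t ∈ Icc (0 : ℝ) 1) {ζ' : Cn n × Cn n}
    (hζ' : ζ' = (1 - t) • ζ + t • skewPart n ζ) :
    (fderiv ℝ (fderiv ℝ Ψ) (y, star y) (ζ'.1, 0) (0, ζ'.2)).re
      ≤ (fderiv ℝ (fderiv ℝ Ψ) (y, star y) (ζ.1, 0) (0, ζ.2)).re := by
  set H := fderiv ℝ (fderiv ℝ Ψ) (y, star y) with hH
  set u := ζ.1 - star ζ.2 with hu
  set v := ζ.1 + star ζ.2 with hv
  have hsymm := re_mixed_hessian_symm hW hΨ hy hΦ hΨΦ u v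
  have hpos : 0 ≤ (H (v, 0) (0, star v)).re := by
    rw [← leviForm_eq hW hΨ hy hΨΦ]; exact hlevi v
  have hexp : ∀ τ : ℝ, (H ((1 / 2 : ℝ) • (u + τ • v), 0)
        (0, (1 / 2 : ℝ) • (τ • star v - star u))).re
      = (1 / 4) * (τ ^ 2 * (H (v, 0) (0, star v)).re - (H (u, 0) (0, star u)).re) := by
    intro τ
    have e1 : (((1 / 2 : ℝ) • (u + τ • v), 0) : Cn n × Cn n)
        = (1 / 2 : ℝ) • ((u, 0) + τ • (v, 0)) := by simp
    have e2 : ((0, (1 / 2 : ℝ) • (τ • star v - star u)) : Cn n × Cn n)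
        = (1 / 2 : ℝ) • (τ • (0, star v) - (0, star u)) := by simp
    rw [e1, e2]
    simp only [map_add, map_smul, map_sub, add_apply,
      smul_apply, Complex.add_re, Complex.sub_re, Complex.smul_re, smul_eq_mul]
    rw [hsymm]
    ring
  have e1 : ζ'.1 = (1 / 2 : ℝ) • (u + (1 - t) • v) := by
    rw [hζ', skewPart_apply, hu, hv]
    simp only [Prod.fst_add, Prod.smul_fst]
    module
  have e2 : ζ'.2 = (1 / 2 : ℝ) • ((1 - t) • star v - star u) := by
    rw [hζ', skewPart_apply, hu, hv]
    simp only [Prod.snd_add, Prod.smul_snd, star_add, star_sub, star_star]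
    module
  have e3 : ζ.1 = (1 / 2 : ℝ) • (u + (1 : ℝ) • v) := by
    rw [hu, hv]; module
  have e4 : ζ.2 = (1 / 2 : ℝ) • ((1 : ℝ) • star v - star u) := by
    rw [hu, hv]
    simp only [star_add, star_sub, star_star]
    module
  have l1 := hexp (1 - t)
  have l2 := hexp 1
  rw [← e1, ← e2] at l1
  rw [← e3, ← e4] at l2
  rw [l1, l2]
  have : (1 - t) ^ 2 ≤ 1 := by nlinarith [ht.1, ht.2]
  nlinarith

end Hessian

/-! ### Uniform estimates for the phase near the anti-diagonal -/

/-- A function which is continuous in an open neighbourhood of a compact set is equicontinuous at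
the points of that set. -/
lemma exists_forall_dist_le_of_isCompact {X Y : Type*} [PseudoMetricSpace X] [ProperSpace X]
    [PseudoMetricSpace Y] {K W : Set X} (hK : IsCompact K) (hW : IsOpen W) (hKW : K ⊆ W)
    {f : X → Y} (hf : ContinuousOn f W) {ε : ℝ} (hε : 0 < ε) :
    ∃ r > 0, ∀ p ∈ K, ∀ q, dist q p ≤ r → q ∈ W ∧ dist (f q) (f p) ≤ ε := by
  obtain ⟨r, hr, hrW⟩ := hK.exists_cthickening_subset_open hW hKW
  have hu := (hK.cthickening (r := r)).uniformContinuousOn_of_continuous (hf.mono hrW)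
  obtain ⟨δ, hδ, hδf⟩ := Metric.uniformContinuousOn_iff_le.1 hu ε hε
  refine ⟨min r δ, lt_min hr hδ, fun p hp q hq => ?_⟩
  have hq' : q ∈ Metric.cthickening r K := Metric.closedBall_subset_cthickening hp r
    (hq.trans (min_le_left _ _))
  exact ⟨hrW hq', hδf q hq' p (Metric.self_subset_cthickening K hp) (hq.trans (min_le_right _ _))⟩

/-- The set of points where `φ(y, ȳ; ·)` is defined. -/
def phaseDomain {n : ℕ} (W : Set (Cn n × Cn n)) (y : Cn n) : Set (Cn n × Cn n) :=
  {p | p ∈ W ∧ (p.1, star y) ∈ W ∧ (y, p.2) ∈ W}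

section Phase

variable {n : ℕ} {Ψ : Cn n × Cn n → ℂ} {W : Set (Cn n × Cn n)}

lemma isOpen_phaseDomain (hW : IsOpen W) (y : Cn n) : IsOpen (phaseDomain W y) :=
  hW.inter ((hW.preimage (f := fun p : Cn n × Cn n => (p.1, star y)) (by fun_prop)).inter
    (hW.preimage (f := fun p : Cn n × Cn n => (y, p.2)) (by fun_prop)))

lemma contDiffOn_phase (hΨ : ContDiffOn ℝ ∞ Ψ W) (y : Cn n) :
    ContDiffOn ℝ ∞ (phase Ψ y (star y)) (phaseDomain W y) := by
  refine ((hΨ.mono fun p hp => hp.1).sub ?_).sub ?_ |>.add contDiffOn_const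
  · exact hΨ.comp (contDiff_fst.prodMk contDiff_const).contDiffOn fun p hp => hp.2.1
  · exact hΨ.comp (contDiff_const.prodMk contDiff_snd).contDiffOn fun p hp => hp.2.2

lemma dBar_phase (hW : IsOpen W) (hΨ : ContDiffOn ℝ ∞ Ψ W) {y : Cn n} {p : Cn n × Cn n}
    (hp : p ∈ phaseDomain W y) (v : Cn n × Cn n) :
    dBar (phase Ψ y (star y)) p v
      = dBar Ψ p v - dBar Ψ (p.1, star y) (v.1, 0) - dBar Ψ (y, p.2) (0, v.2) := by
  have hd : ∀ q ∈ W, HasFDerivAt Ψ (fderiv ℝ Ψ q) q := fun q hq =>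
    ((hΨ.contDiffAt (hW.mem_nhds hq)).differentiableAt (by simp)).hasFDerivAt
  have h1 : HasFDerivAt (fun p : Cn n × Cn n => Ψ (p.1, star y)) _ p :=
    (hd _ hp.2.1).comp p (hasFDerivAt_fst.prodMk (hasFDerivAt_const (star y) p))
  have h2 : HasFDerivAt (fun p : Cn n × Cn n => Ψ (y, p.2)) _ p :=
    (hd _ hp.2.2).comp p ((hasFDerivAt_const y p).prodMk hasFDerivAt_snd)
  have h3 : HasFDerivAt (phase Ψ y (star y)) _ p :=
    (((hd p hp.1).sub h1).sub h2).add (hasFDerivAt_const (Ψ (y, star y)) p)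
  simp only [dBar, h3.fderiv]
  simp
  ring

/-- Mean value estimate of a mixed second difference. -/
lemma norm_mixed_difference_sub_le (hW : IsOpen W) (hΨ : ContDiffOn ℝ ∞ Ψ W)
    {p : Cn n × Cn n} {r ε : ℝ}
    (hball : ∀ q, dist q p ≤ r →
      q ∈ W ∧ dist (fderiv ℝ (fderiv ℝ Ψ) q) (fderiv ℝ (fderiv ℝ Ψ) p) ≤ ε)
    {ζ : Cn n × Cn n} (hζ : ‖ζ‖ ≤ r) :
    ‖Ψ (p + ζ) - Ψ (p + (ζ.1, 0)) - Ψ (p + (0, ζ.2)) + Ψ p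
      - fderiv ℝ (fderiv ℝ Ψ) p (ζ.1, 0) (0, ζ.2)‖ ≤ ε * ‖ζ‖ ^ 2 := by
  set H := fderiv ℝ (fderiv ℝ Ψ) p with hH
  have hr : 0 ≤ r := (norm_nonneg _).trans hζ
  have hε : 0 ≤ ε := dist_nonneg.trans (hball p (by simpa using hr)).2
  have hpW : p ∈ W := (hball p (by simpa using hr)).1
  have hsymm : ∀ a b, H a b = H b a := fderiv_fderiv_symm hW hΨ hpW
  have hd : ∀ q ∈ W, HasFDerivAt Ψ (fderiv ℝ Ψ q) q := fun q hq =>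
    ((hΨ.contDiffAt (hW.mem_nhds hq)).differentiableAt (by simp)).hasFDerivAt
  have hmem : ∀ z : Cn n, ∀ w : Cn n, ‖z‖ ≤ ‖ζ‖ → ‖w‖ ≤ ‖ζ‖ →
      p + (z, w) ∈ Metric.closedBall p r := fun z w hz hw => by
    simp only [Metric.mem_closedBall, dist_eq_norm, add_sub_cancel_left, Prod.norm_mk]
    exact (max_le hz hw).trans hζ
  have hw : ‖ζ.2‖ ≤ ‖ζ‖ := norm_snd_le ζ
  have hz : ‖ζ.1‖ ≤ ‖ζ‖ := norm_fst_le ζ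
  -- the differential of `Ψ` in between `p + (z, 0)` and `p + (z, w)`
  have hfirst : ∀ z ∈ Metric.closedBall (0 : Cn n) ‖ζ‖,
      ‖fderiv ℝ Ψ (p + (z, ζ.2)) - fderiv ℝ Ψ (p + (z, 0)) - H (0, ζ.2)‖ ≤ ε * ‖ζ‖ := by
    intro z hz'
    have hz' : ‖z‖ ≤ ‖ζ‖ := by simpa using hz'
    have := (convex_closedBall p r).norm_image_sub_le_of_norm_hasFDerivWithin_le'
      (f := fderiv ℝ Ψ) (f' := fderiv ℝ (fderiv ℝ Ψ)) (φ := H) (C := ε)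
      (fun q hq => (hasFDerivAt_fderiv hW hΨ (hball q hq).1).hasFDerivWithinAt)
      (fun q hq => by rw [← dist_eq_norm]; exact (hball q hq).2)
      (hmem z 0 hz' (by simp)) (hmem z ζ.2 hz' hw)
    have e : p + (z, ζ.2) - (p + (z, 0)) = (0, ζ.2) := by simp
    rw [e] at this
    refine this.trans (mul_le_mul_of_nonneg_left ?_ hε)
    simpa using hw
  set m : Cn n → ℂ := fun z => Ψ (p + (z, ζ.2)) - Ψ (p + (z, 0)) - H (z, 0) (0, ζ.2) with hm
  have hmd : ∀ z ∈ Metric.closedBall (0 : Cn n) ‖ζ‖, HasFDerivAt m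
      ((fderiv ℝ Ψ (p + (z, ζ.2)) - fderiv ℝ Ψ (p + (z, 0)) - H (0, ζ.2)).comp
        (ContinuousLinearMap.inl ℝ (Cn n) (Cn n))) z := by
    intro z hz'
    have hz' : ‖z‖ ≤ ‖ζ‖ := by simpa using hz'
    have h0 : ∀ w : Cn n, HasFDerivAt (fun z : Cn n => p + (z, w))
        (ContinuousLinearMap.inl ℝ (Cn n) (Cn n)) z := fun w =>
      (hasFDerivAt_prodMk_left z w).const_add p
    have h1 : HasFDerivAt (fun z => Ψ (p + (z, ζ.2))) _ z :=
      (hd _ (hball _ (hmem z ζ.2 hz' hw)).1).comp z (h0 ζ.2)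
    have h2 : HasFDerivAt (fun z => Ψ (p + (z, 0))) _ z :=
      (hd _ (hball _ (hmem z 0 hz' (by simp))).1).comp z (h0 0)
    have h3 : HasFDerivAt (fun z : Cn n => H (z, 0) (0, ζ.2))
        ((H (0, ζ.2)).comp (ContinuousLinearMap.inl ℝ (Cn n) (Cn n))) z := by
      have : (fun z : Cn n => H (z, 0) (0, ζ.2))
          = (H (0, ζ.2)).comp (ContinuousLinearMap.inl ℝ (Cn n) (Cn n)) := by
        funext z; simp [hsymm (z, 0)]
      rw [this]
      exact ContinuousLinearMap.hasFDerivAt _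
    exact (h1.sub h2).sub h3
  have key := (convex_closedBall (0 : Cn n) ‖ζ‖).norm_image_sub_le_of_norm_hasFDerivWithin_le
    (C := ε * ‖ζ‖) (fun z hz' => (hmd z hz').hasFDerivWithinAt)
    (fun z hz' => by
      refine (ContinuousLinearMap.opNorm_comp_le _ _).trans ?_
      refine (mul_le_mul (hfirst z hz') (ContinuousLinearMap.norm_inl_le_one ℝ _ _)
        (norm_nonneg _) (by positivity)).trans (by simp))
    (Metric.mem_closedBall_self (norm_nonneg ζ)) (by simpa using hz : ζ.1 ∈ _)
  have e : m ζ.1 - m 0 = Ψ (p + ζ) - Ψ (p + (ζ.1, 0)) - Ψ (p + (0, ζ.2)) + Ψ p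
      - H (ζ.1, 0) (0, ζ.2) := by
    have h0 : ((0 : Cn n), (0 : Cn n)) = 0 := rfl
    simp only [hm, Prod.mk.eta, h0, add_zero, map_zero, zero_apply]
    ring
  rw [e] at key
  refine key.trans ?_
  rw [sub_zero, pow_two, ← mul_assoc]
  exact mul_le_mul_of_nonneg_left hz (by positivity)

variable {K : Set (Cn n)}

lemma isCompact_antiDiag_image (hK : IsCompact K) : IsCompact (antiDiag n '' K) :=
  hK.image (antiDiag n).continuous

/-- The second order Taylor expansion of the phase at its critical point, with a uniform
remainder. -/
lemma exists_phase_taylor (hW : IsOpen W) (hΨ : ContDiffOn ℝ ∞ Ψ W) (hK : IsCompact K)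
    (hKW : ∀ y ∈ K, (y, star y) ∈ W) {ε : ℝ} (hε : 0 < ε) :
    ∃ r > 0, ∀ y ∈ K, ∀ ζ : Cn n × Cn n, ‖ζ‖ ≤ r →
      ‖phase Ψ y (star y) ((y, star y) + ζ)
        - fderiv ℝ (fderiv ℝ Ψ) (y, star y) (ζ.1, 0) (0, ζ.2)‖ ≤ ε * ‖ζ‖ ^ 2 := by
  have hcont : ContinuousOn (fderiv ℝ (fderiv ℝ Ψ)) W :=
    (hΨ.fderiv_of_isOpen hW (m := ∞) (by simp)).continuousOn_fderiv_of_isOpen hW (by simp)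
  obtain ⟨r, hr, h⟩ := exists_forall_dist_le_of_isCompact (isCompact_antiDiag_image hK) hW
    (by rintro _ ⟨y, hy, rfl⟩; exact hKW y hy)
    (Y := Cn n × Cn n →L[ℝ] Cn n × Cn n →L[ℝ] ℂ) hcont hε
  refine ⟨r, hr, fun y hy ζ hζ => ?_⟩
  refine le_of_eq_of_le ?_ (norm_mixed_difference_sub_le hW hΨ
    (h (y, star y) ⟨y, hy, rfl⟩) hζ)
  simp [phase]

/-- Bounds for an almost holomorphic function near the anti-diagonal; `∂̄b` vanishes to infinite
order there. -/
lemma IsAlmostHolomorphic.exists_norm_dBar_add_le {b : Cn n × Cn n → ℂ} {U : Set (Cn n × Cn n)}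
    (hU : IsOpen U) (hb : IsAlmostHolomorphic b U) (hK : IsCompact K)
    (hKU : ∀ y ∈ K, (y, star y) ∈ U) :
    ∃ r > 0, (∀ y ∈ K, ∀ ζ : Cn n × Cn n, ‖ζ‖ ≤ r → (y, star y) + ζ ∈ U) ∧
      (∃ M : ℝ, ∀ y ∈ K, ∀ ζ : Cn n × Cn n, ‖ζ‖ ≤ r → ‖b ((y, star y) + ζ)‖ ≤ M) ∧
      ∀ N : ℕ, ∃ C : ℝ, 0 ≤ C ∧ ∀ y ∈ K, ∀ ζ : Cn n × Cn n, ‖ζ‖ ≤ r →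
        ∀ v, ‖dBar b ((y, star y) + ζ) v‖ ≤ C * ‖ζ‖ ^ N * ‖v‖ := by
  have hKc := isCompact_antiDiag_image hK
  obtain ⟨r, hr, hrU⟩ := hKc.exists_cthickening_subset_open hU
    (by rintro _ ⟨y, hy, rfl⟩; exact hKU y hy)
  have hc : IsCompact (Metric.cthickening r (antiDiag n '' K)) := hKc.cthickening
  have hmem : ∀ y ∈ K, ∀ ζ : Cn n × Cn n, ‖ζ‖ ≤ r →
      (y, star y) + ζ ∈ Metric.cthickening r (antiDiag n '' K) := fun y hy ζ hζ =>
    Metric.closedBall_subset_cthickening (show (y, star y) ∈ antiDiag n '' K from ⟨y, hy, rfl⟩) r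
      (by simpa [dist_eq_norm] using hζ)
  obtain ⟨M, hM⟩ := hc.exists_bound_of_continuousOn (hb.smooth.continuousOn.mono hrU)
  refine ⟨r, hr, fun y hy ζ hζ => hrU (hmem y hy ζ hζ),
    ⟨M, fun y hy ζ hζ => hM _ (hmem y hy ζ hζ)⟩, fun N => ?_⟩
  obtain ⟨C, hC0, hC⟩ := hb.exists_norm_dBar_le hrU hc N
  refine ⟨C * 2 ^ N, by positivity, fun y hy ζ hζ v => (hC _ (hmem y hy ζ hζ) v).trans ?_⟩
  have h1 : ‖((y, star y) + ζ).2 - star ((y, star y) + ζ).1‖ ≤ 2 * ‖ζ‖ := by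
    have : ((y, star y) + ζ).2 - star ((y, star y) + ζ).1 = ζ.2 - star ζ.1 := by simp
    rw [this, two_mul]
    refine (norm_sub_le _ _).trans (add_le_add (norm_snd_le _) ?_)
    rw [norm_star]
    exact norm_fst_le _
  calc _ ≤ C * (2 * ‖ζ‖) ^ N * ‖v‖ := by gcongr
    _ = _ := by ring

lemma exists_norm_dBar_phase_le (hW : IsOpen W) (hΨ : IsAlmostHolomorphic Ψ W) (hK : IsCompact K)
    (hKW : ∀ y ∈ K, (y, star y) ∈ W) :
    ∃ r > 0, (∀ y ∈ K, ∀ ζ : Cn n × Cn n, ‖ζ‖ ≤ r → (y, star y) + ζ ∈ phaseDomain W y) ∧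
      ∀ N : ℕ, ∃ C : ℝ, 0 ≤ C ∧ ∀ y ∈ K, ∀ ζ : Cn n × Cn n, ‖ζ‖ ≤ r →
        ∀ v, ‖dBar (phase Ψ y (star y)) ((y, star y) + ζ) v‖ ≤ C * ‖ζ‖ ^ N * ‖v‖ := by
  obtain ⟨r, hr, hrW, -, h⟩ := hΨ.exists_norm_dBar_add_le hW hK hKW
  have h1 : ∀ ζ : Cn n × Cn n, ‖((ζ.1, 0) : Cn n × Cn n)‖ ≤ ‖ζ‖ := fun ζ => by
    simpa using norm_fst_le ζ
  have h2 : ∀ ζ : Cn n × Cn n, ‖((0, ζ.2) : Cn n × Cn n)‖ ≤ ‖ζ‖ := fun ζ => by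
    simpa using norm_snd_le ζ
  have e1 : ∀ y : Cn n, ∀ ζ : Cn n × Cn n,
      ((((y, star y) + ζ).1, star y) : Cn n × Cn n) = (y, star y) + (ζ.1, 0) := by simp
  have e2 : ∀ y : Cn n, ∀ ζ : Cn n × Cn n,
      ((y, ((y, star y) + ζ).2) : Cn n × Cn n) = (y, star y) + (0, ζ.2) := by simp
  have hdom : ∀ y ∈ K, ∀ ζ : Cn n × Cn n, ‖ζ‖ ≤ r → (y, star y) + ζ ∈ phaseDomain W y := by
    intro y hy ζ hζ
    refine ⟨hrW y hy ζ hζ, ?_, ?_⟩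
    · rw [e1]; exact hrW y hy _ ((h1 ζ).trans hζ)
    · rw [e2]; exact hrW y hy _ ((h2 ζ).trans hζ)
  refine ⟨r, hr, hdom, fun N => ?_⟩
  obtain ⟨C, hC0, hC⟩ := h N
  refine ⟨C + C + C, by positivity, fun y hy ζ hζ v => ?_⟩
  rw [dBar_phase hW hΨ.smooth (hdom y hy ζ hζ), e1, e2]
  have b1 := hC y hy ζ hζ v
  have b2 : ‖dBar Ψ ((y, star y) + (ζ.1, 0)) (v.1, 0)‖ ≤ C * ‖ζ‖ ^ N * ‖v‖ :=
    (hC y hy _ ((h1 ζ).trans hζ) _).trans (by gcongr <;> apply h1)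
  have b3 : ‖dBar Ψ ((y, star y) + (0, ζ.2)) (0, v.2)‖ ≤ C * ‖ζ‖ ^ N * ‖v‖ :=
    (hC y hy _ ((h2 ζ).trans hζ) _).trans (by gcongr <;> apply h2)
  calc _ ≤ C * ‖ζ‖ ^ N * ‖v‖ + C * ‖ζ‖ ^ N * ‖v‖ + C * ‖ζ‖ ^ N * ‖v‖ :=
        (norm_sub_le _ _).trans (add_le_add ((norm_sub_le _ _).trans (add_le_add b1 b2)) b3)
    _ = _ := by ring

lemma dBar_exp_mul {E : Type*} [NormedAddCommGroup E] [NormedSpace ℝ E] [NormedSpace ℂ E]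
    {F b : E → ℂ} {p : E} (hF : DifferentiableAt ℝ F p) (hb : DifferentiableAt ℝ b p)
    (c : ℂ) (v : E) :
    dBar (fun q => Complex.exp (c * F q) * b q) p v
      = Complex.exp (c * F p) * (c * dBar F p v * b p + dBar b p v) := by
  have h : HasFDerivAt (fun q => Complex.exp (c * F q) * b q) _ p :=
    ((hF.hasFDerivAt.const_mul c).cexp).mul hb.hasFDerivAt
  simp only [dBar, h.fderiv]
  simp
  ring

end Phase

/-! ### Homotopies along which the phase is quadratically negative -/

lemma pow_mul_exp_neg_div_le {c h x : ℝ} (hc : 0 < c) (hh : 0 < h) (hx : 0 ≤ x) (k : ℕ) :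
    x ^ k * Real.exp (-(c * x / h)) ≤ k.factorial * (h / c) ^ k := by
  have h0 : 0 ≤ c * x / h := by positivity
  have h1 : (c * x / h) ^ k ≤ k.factorial * Real.exp (c * x / h) := by
    have := Real.pow_div_factorial_le_exp (c * x / h) h0 k
    rw [div_le_iff₀ (by positivity)] at this
    linarith
  have h2 : x ^ k = (c * x / h) ^ k * (h / c) ^ k := by
    rw [← mul_pow]; congr 1; field_simp
  rw [h2, Real.exp_neg]
  calc (c * x / h) ^ k * (h / c) ^ k * (Real.exp (c * x / h))⁻¹
      ≤ k.factorial * Real.exp (c * x / h) * (h / c) ^ k * (Real.exp (c * x / h))⁻¹ := by gcongr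
    _ = _ := by field_simp

lemma norm_exp_two_div_mul {h : ℝ} (z : ℂ) :
    ‖Complex.exp (2 / (h : ℂ) * z)‖ = Real.exp (2 / h * z.re) := by
  rw [Complex.norm_exp]
  congr 1
  have : (2 / (h : ℂ)) = ((2 / h : ℝ) : ℂ) := by push_cast; rfl
  rw [this, Complex.re_ofReal_mul]

/-- A homotopy `P(t, s)` of contours, with time `t ∈ [0, 1]` and parameter `s` in the ball of radius
`ρ`, along which `Re F ≤ -c |s|²`, while `∂̄F` and `∂̄b` are `O(|s|^(2 k))` with constant `C`, and `b`
and the differential of `P` are bounded by `M`. Smoothness is required for `t` in the larger open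
interval `(-1, 2)`, in order to differentiate at the end points. -/
structure IsNegativeHomotopy {n : ℕ} (c M C ρ : ℝ) (k : ℕ) (F b : Cn n × Cn n → ℂ)
    (P : ℝ × Par n → Cn n × Cn n) : Prop where
  smooth : ∃ N : Set (ℝ × Par n), ∃ Q : Set (Cn n × Cn n), IsOpen N ∧
    Ioo (-1 : ℝ) 2 ×ˢ Metric.closedBall 0 ρ ⊆ N ∧ ContDiffOn ℝ ∞ P N ∧ IsOpen Q ∧
    ContDiffOn ℝ ∞ F Q ∧ ContDiffOn ℝ ∞ b Q ∧ MapsTo P N Q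
  neg : ∀ t ∈ Icc (0 : ℝ) 1, ∀ s, ‖s‖ ≤ ρ → (F (P (t, s))).re ≤ -c * ‖s‖ ^ 2
  amplitude : ∀ t ∈ Icc (0 : ℝ) 1, ∀ s, ‖s‖ ≤ ρ → ‖b (P (t, s))‖ ≤ M
  deriv_time : ∀ t ∈ Icc (0 : ℝ) 1, ∀ s, ‖s‖ ≤ ρ → ‖fderiv ℝ P (t, s) (1, 0)‖ ≤ M
  deriv_space : ∀ t ∈ Icc (0 : ℝ) 1, ∀ s, ‖s‖ ≤ ρ → ∀ j,
    ‖fderiv ℝ P (t, s) (0, Pi.single j 1)‖ ≤ M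
  dBar_phase : ∀ t ∈ Icc (0 : ℝ) 1, ∀ s, ‖s‖ ≤ ρ → ∀ v,
    ‖dBar F (P (t, s)) v‖ ≤ C * ‖s‖ ^ (2 * k) * ‖v‖
  dBar_amplitude : ∀ t ∈ Icc (0 : ℝ) 1, ∀ s, ‖s‖ ≤ ρ → ∀ v,
    ‖dBar b (P (t, s)) v‖ ≤ C * ‖s‖ ^ (2 * k) * ‖v‖

/-- The two ends of a homotopy along which the phase is negative give the same integral up to
`O(h^k)`, with a constant which depends only on the constants in the estimates. The error terms are
`O(|s|^(2 k + 2) / h)` times `e^(-2c|s|²/h)`; where the cutoff is not constant this holds because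
`|s|` is bounded from below by `ρ'`. -/
lemma exists_norm_integral_homotopy_le (n : ℕ) {c M L C ρ ρ' : ℝ} (hc : 0 < c) (hM : 0 ≤ M)
    (hL : 0 ≤ L) (hC : 0 ≤ C) (hρ' : 0 < ρ') (k : ℕ) :
    ∃ B : ℝ, ∀ (F b : Cn n × Cn n → ℂ) (P : ℝ × Par n → Cn n × Cn n),
      IsNegativeHomotopy c M C ρ (k + 1) F b P →
      ∀ χ : Par n → ℝ, ContDiff ℝ ∞ χ → tsupport χ ⊆ Metric.closedBall 0 ρ →
        (∀ s, |χ s| ≤ 1) → (∀ s, ‖s‖ < ρ' → fderiv ℝ χ s = 0) →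
        (∀ s j, |fderiv ℝ χ s (Pi.single j 1)| ≤ L) →
      ∀ h : ℝ, 0 < h → h ≤ 1 →
      ‖(∫ s, (χ s : ℂ) * (Complex.exp (2 / (h : ℂ) * F (P (1, s))) * b (P (1, s))
            * volForm n fun j => fderiv ℝ P (1, s) (0, Pi.single j 1)))
        - ∫ s, (χ s : ℂ) * (Complex.exp (2 / (h : ℂ) * F (P (0, s))) * b (P (0, s))
            * volForm n fun j => fderiv ℝ P (0, s) (0, Pi.single j 1))‖ ≤ B * h ^ k := by
  set D : ℝ := ‖volFormR n‖ * M ^ (2 * n) with hD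
  have hD0 : 0 ≤ D := by positivity
  -- the bounds for the `∂̄` terms and for the terms with derivatives of the cutoff
  set B₁ : ℝ := (1 + 2 * n) * ((2 * C * M + C) * M * D) with hB₁
  set B₂ : ℝ := 2 * n * (L * (M * D)) / ρ' ^ (2 * (k + 1)) with hB₂
  set B₀ : ℝ := (B₁ + B₂) * ((k + 1).factorial * (1 / (2 * c)) ^ (k + 1)) with hB₀
  refine ⟨B₀ * volume.real (Metric.closedBall (0 : Par n) ρ), ?_⟩
  intro F b P hP χ hχ hχρ hχ1 hχ0 hχM h hh hh1
  obtain ⟨N, Q, hN, hρN, hPs, hQ, hF, hb, hPQ⟩ := hP.smooth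
  set G : Cn n × Cn n → ℂ := fun q => Complex.exp (2 / (h : ℂ) * F q) * b q with hG
  have hGs : ContDiffOn ℝ ∞ G Q := ((contDiffOn_const.mul hF).cexp).mul hb
  have hχc : HasCompactSupport χ :=
    (isCompact_closedBall (0 : Par n) ρ).of_isClosed_subset isClosed_closure hχρ
  have hB₀0 : 0 ≤ B₀ := by positivity
  have key := norm_integral_homotopy_sub_le hχ hχc hN ((prod_mono_right hχρ).trans hρN) hPs hQ hGs
    hPQ (B := B₀ * h ^ k) ?_
  · refine key.trans ?_
    rw [mul_right_comm]
    gcongr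
    exact (isCompact_closedBall (0 : Par n) ρ).measure_lt_top.ne
  intro t ht s hs
  have hsρ : ‖s‖ ≤ ρ := by simpa using hχρ hs
  have hq : P (t, s) ∈ Q := hPQ (hρN ⟨⟨by linarith [ht.1], by linarith [ht.2]⟩, hχρ hs⟩)
  have hFd : DifferentiableAt ℝ F (P (t, s)) :=
    (hF.contDiffAt (hQ.mem_nhds hq)).differentiableAt (by simp)
  have hbd : DifferentiableAt ℝ b (P (t, s)) :=
    (hb.contDiffAt (hQ.mem_nhds hq)).differentiableAt (by simp)
  set E : ℝ := Real.exp (-((2 * c) * ‖s‖ ^ 2 / h)) with hE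
  have hE0 : 0 < E := Real.exp_pos _
  have hexp : ‖Complex.exp (2 / (h : ℂ) * F (P (t, s)))‖ ≤ E := by
    rw [norm_exp_two_div_mul, hE]
    refine Real.exp_le_exp.2 ?_
    have h1 := mul_le_mul_of_nonneg_left (hP.neg t ht s hsρ) (show 0 ≤ 2 / h by positivity)
    refine h1.trans (le_of_eq ?_)
    field_simp
  have hbM := hP.amplitude t ht s hsρ
  set X : ℝ := ‖s‖ ^ (2 * (k + 1)) with hX
  have hX0 : 0 ≤ X := by positivity
  have hdBar : ∀ v, ‖v‖ ≤ M → ‖dBar G (P (t, s)) v‖ ≤ E * X / h * ((2 * C * M + C) * M) := by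
    intro v hv
    rw [hG, dBar_exp_mul hFd hbd, norm_mul]
    have h1 : ‖2 / (h : ℂ) * dBar F (P (t, s)) v * b (P (t, s))‖ ≤ 2 / h * (C * X * M) * M := by
      have h2 : ‖(2 / (h : ℂ))‖ = 2 / h := by simp [abs_of_pos hh]
      rw [norm_mul, norm_mul, h2]
      have := (hP.dBar_phase t ht s hsρ v).trans
        (mul_le_mul_of_nonneg_left hv (by positivity : 0 ≤ C * ‖s‖ ^ (2 * (k + 1))))
      gcongr
    have h3 : ‖dBar b (P (t, s)) v‖ ≤ C * X * M / h := by
      have := (hP.dBar_amplitude t ht s hsρ v).trans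
        (mul_le_mul_of_nonneg_left hv (by positivity : 0 ≤ C * ‖s‖ ^ (2 * (k + 1))))
      refine this.trans ?_
      rw [le_div_iff₀ hh]
      exact mul_le_of_le_one_right (by positivity) hh1
    calc _ ≤ E * (2 / h * (C * X * M) * M + C * X * M / h) := by
          gcongr
          exact (norm_add_le _ _).trans (add_le_add h1 h3)
      _ = _ := by field_simp
  have hvol : ‖volForm n fun j => fderiv ℝ P (t, s) (0, Pi.single j 1)‖ ≤ D :=
    norm_volForm_le _ (hP.deriv_space t ht s hsρ)
  have hflux : ∀ i, ‖fluxDensity P (t, s) i‖ ≤ D := by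
    intro i
    refine norm_volForm_le _ fun j => ?_
    by_cases hj : j = i
    · subst hj; simpa using hP.deriv_time t ht s hsρ
    · simpa [hj] using hP.deriv_space t ht s hsρ j
  have hcard : (Finset.univ : Finset (Fin n ⊕ Fin n)).card = 2 * n := by simp [two_mul]
  have hone : ‖(χ s : ℂ) * (dBar G (P (t, s)) (fderiv ℝ P (t, s) (1, 0))
            * volForm n (fun j => fderiv ℝ P (t, s) (0, Pi.single j 1))
          - ∑ i, dBar G (P (t, s)) (fderiv ℝ P (t, s) (0, Pi.single i 1)) * fluxDensity P (t, s) i)‖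
      ≤ B₁ * (X * E / h) := by
    rw [norm_mul, Complex.norm_real, Real.norm_eq_abs]
    refine (mul_le_of_le_one_left (norm_nonneg _) (hχ1 s)).trans ?_
    have h1 : ‖dBar G (P (t, s)) (fderiv ℝ P (t, s) (1, 0))
            * volForm n (fun j => fderiv ℝ P (t, s) (0, Pi.single j 1))‖
        ≤ E * X / h * ((2 * C * M + C) * M) * D := by
      rw [norm_mul]
      exact mul_le_mul (hdBar _ (hP.deriv_time t ht s hsρ)) hvol (norm_nonneg _) (by positivity)
    have h2 : ‖∑ i, dBar G (P (t, s)) (fderiv ℝ P (t, s) (0, Pi.single i 1))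
          * fluxDensity P (t, s) i‖ ≤ 2 * n * (E * X / h * ((2 * C * M + C) * M) * D) := by
      refine (norm_sum_le_of_le _ fun i _ => (norm_mul_le _ _).trans (mul_le_mul
        (hdBar _ (hP.deriv_space t ht s hsρ i)) (hflux i) (norm_nonneg _) (by positivity))).trans ?_
      rw [Finset.sum_const, hcard, nsmul_eq_mul]
      push_cast
      exact le_rfl
    refine (norm_sub_le _ _).trans ((add_le_add h1 h2).trans (le_of_eq ?_))
    rw [hB₁]
    ring
  have htwo : ‖∑ i, (fderiv ℝ χ s (Pi.single i 1) : ℂ) * (G (P (t, s)) * fluxDensity P (t, s) i)‖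
      ≤ B₂ * (X * E / h) := by
    rcases lt_or_ge ‖s‖ ρ' with hlt | hge
    · simp only [hχ0 s hlt, zero_apply, Complex.ofReal_zero, zero_mul, Finset.sum_const_zero,
        norm_zero]
      positivity
    have h1 : 1 ≤ X / ρ' ^ (2 * (k + 1)) := by
      rw [one_le_div (by positivity)]
      exact pow_le_pow_left₀ hρ'.le hge _
    have hterm : ∀ i, ‖(fderiv ℝ χ s (Pi.single i 1) : ℂ)
        * (G (P (t, s)) * fluxDensity P (t, s) i)‖ ≤ L * (E * M * D) := by
      intro i
      rw [norm_mul, norm_mul, Complex.norm_real, hG, norm_mul]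
      have := hχM s i
      have := hflux i
      simp only [Real.norm_eq_abs]
      gcongr
    refine (norm_sum_le_of_le _ fun i _ => hterm i).trans ?_
    rw [Finset.sum_const, hcard, nsmul_eq_mul]
    have h2 : (1 : ℝ) ≤ 1 / h := by rw [one_le_div hh]; exact hh1
    calc ((2 * n : ℕ) : ℝ) * (L * (E * M * D))
        = 2 * n * (L * (M * D)) * E * (1 * 1) := by push_cast; ring
      _ ≤ 2 * n * (L * (M * D)) * E * (X / ρ' ^ (2 * (k + 1)) * (1 / h)) := by gcongr
      _ = B₂ * (X * E / h) := by rw [hB₂]; field_simp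
  have hXE : X * E / h ≤ (k + 1).factorial * (1 / (2 * c)) ^ (k + 1) * h ^ k := by
    have := pow_mul_exp_neg_div_le (c := 2 * c) (x := ‖s‖ ^ 2) (by positivity) hh
      (by positivity) (k + 1)
    rw [← pow_mul] at this
    rw [div_le_iff₀ hh]
    refine this.trans (le_of_eq ?_)
    rw [div_pow, one_div, inv_pow]
    field_simp
    ring
  calc _ ≤ B₁ * (X * E / h) + B₂ * (X * E / h) := (norm_sub_le _ _).trans (add_le_add hone htwo)
    _ = (B₁ + B₂) * (X * E / h) := by ring
    _ ≤ (B₁ + B₂) * ((k + 1).factorial * (1 / (2 * c)) ^ (k + 1) * h ^ k) := by gcongr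
    _ = B₀ * h ^ k := by rw [hB₀]; ring

/-! ### Good contours near their critical points -/

/-- The real coordinates `(Re x, Im x)` of `x ∈ ℂⁿ`. -/
noncomputable def parCoord (n : ℕ) : Cn n ≃L[ℝ] Par n :=
  LinearEquiv.toContinuousLinearEquiv
    { toFun := fun x => Sum.elim (fun k => (x k).re) (fun k => (x k).im)
      invFun := fun u k => ⟨u (Sum.inl k), u (Sum.inr k)⟩
      map_add' := fun x y => by funext i; rcases i with i | i <;> simp
      map_smul' := fun c x => by funext i; rcases i with i | i <;> simp
      left_inv := fun x => by funext k; simp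
      right_inv := fun u => by funext i; rcases i with i | i <;> simp }

/-- The real coordinates of `z - w̄` for `(z, w) ∈ ℂⁿ × ℂⁿ`. -/
noncomputable def orientCoord (n : ℕ) : Cn n × Cn n →L[ℝ] Par n :=
  (parCoord n).toContinuousLinearMap.comp
    (ContinuousLinearMap.fst ℝ _ _ - (starL' ℝ : Cn n ≃L[ℝ] Cn n).toContinuousLinearMap.comp
      (ContinuousLinearMap.snd ℝ _ _))

lemma orientCoord_apply {n : ℕ} (ζ : Cn n × Cn n) :
    orientCoord n ζ = parCoord n (ζ.1 - star ζ.2) := rfl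

/-- The standard linear contour `{(z, -z̄)}`, parametrized such that `z - w̄` has the real
coordinates `u`. -/
noncomputable def stdContour (n : ℕ) : Par n →L[ℝ] Cn n × Cn n :=
  (1 / 2 : ℝ) • ((parCoord n).symm.toContinuousLinearMap.prod
    (-(starL' ℝ : Cn n ≃L[ℝ] Cn n).toContinuousLinearMap.comp
      (parCoord n).symm.toContinuousLinearMap))

lemma stdContour_orientCoord {n : ℕ} (ζ : Cn n × Cn n) :
    stdContour n (orientCoord n ζ) = skewPart n ζ := by
  rw [skewPart_apply, orientCoord_apply]
  simp [stdContour]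

/-- In particular, the tangent space is transverse to the anti-diagonal when `orientDet` is not
zero. -/
lemma orientDet_eq_det {n : ℕ} (g : Par n → Cn n × Cn n) (s : Par n) :
    orientDet g s = LinearMap.det ((orientCoord n).comp (fderiv ℝ g s) : Par n →ₗ[ℝ] Par n) := by
  rw [← LinearMap.det_toMatrix']
  unfold orientDet
  congr 1

lemma norm_skewPart_le {n : ℕ} (ζ : Cn n × Cn n) : ‖skewPart n ζ‖ ≤ ‖ζ‖ := by
  rw [skewPart_apply, norm_smul, Prod.norm_mk]
  have h1 := norm_fst_le ζ
  have h2 := norm_snd_le ζ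
  have h3 : ‖ζ.1 - star ζ.2‖ ≤ ‖ζ.1‖ + ‖ζ.2‖ := (norm_sub_le _ _).trans (by rw [norm_star])
  have h4 : ‖ζ.2 - star ζ.1‖ ≤ ‖ζ.2‖ + ‖ζ.1‖ := (norm_sub_le _ _).trans (by rw [norm_star])
  have h5 : max ‖ζ.1 - star ζ.2‖ ‖ζ.2 - star ζ.1‖ ≤ 2 * ‖ζ‖ := max_le (by linarith) (by linarith)
  rw [Real.norm_of_nonneg (by norm_num)]
  linarith

/-- The sup norm is bounded by the Euclidean norm. -/
lemma sq_norm_le_sum {n : ℕ} (ζ : Cn n × Cn n) :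
    ‖ζ‖ ^ 2 ≤ ∑ j, ‖ζ.1 j‖ ^ 2 + ∑ j, ‖ζ.2 j‖ ^ 2 := by
  have h : ∀ w : Cn n, ‖w‖ ^ 2 ≤ ∑ j, ‖w j‖ ^ 2 := by
    intro w
    have h0 : 0 ≤ ∑ j, ‖w j‖ ^ 2 := Finset.sum_nonneg fun j _ => by positivity
    rw [← Real.le_sqrt (norm_nonneg _) h0]
    refine (pi_norm_le_iff_of_nonneg (Real.sqrt_nonneg _)).2 fun j => Real.le_sqrt_of_sq_le ?_
    exact Finset.single_le_sum (f := fun j => ‖w j‖ ^ 2) (fun i _ => by positivity)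
      (Finset.mem_univ j)
  have h0 : ∀ w : Cn n, 0 ≤ ∑ j, ‖w j‖ ^ 2 := fun w => Finset.sum_nonneg fun j _ => by positivity
  rw [Prod.norm_def]
  rcases max_choice ‖ζ.1‖ ‖ζ.2‖ with h' | h' <;> rw [h']
  · linarith [h ζ.1, h0 ζ.2]
  · linarith [h ζ.2, h0 ζ.1]

/-- The pairs `(y, s)`, `y ∈ K`, such that `Γ(y)` passes through the critical point at the
parameter `s`. -/
def critSet {n : ℕ} (Γ : ContourFamily n) (K : Set (Cn n)) : Set (Cn n × Par n) :=
  {q | q.1 ∈ K ∧ q.2 ∈ Γ.dom ∧ Γ.map q.1 q.2 = (q.1, star q.1)}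

section GoodContour

variable {n : ℕ} {Ψ : Cn n × Cn n → ℂ} {W : Set (Cn n × Cn n)} {V : Set (Cn n)}
  {Γ : ContourFamily n} {K : Set (Cn n)}

/-- The tangent maps of the contours. -/
noncomputable def tangent (Γ : ContourFamily n) (q : Cn n × Par n) : Par n →L[ℝ] Cn n × Cn n :=
  fderiv ℝ (Γ.map q.1) q.2

lemma IsGoodContour.contDiffAt (hV : IsOpen V) (hΓ : IsGoodContour Ψ W V Γ) {y : Cn n} {s : Par n}
    (hy : y ∈ V) (hs : s ∈ Γ.dom) :
    ContDiffAt ℝ ∞ (fun q : Cn n × Par n => Γ.map q.1 q.2) (y, s) := by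
  obtain ⟨O, hO, hDO, hsm⟩ := hΓ.smooth
  exact hsm.contDiffAt ((hV.prod hO).mem_nhds ⟨hy, hDO hs⟩)

lemma IsGoodContour.contDiffAt_map (hV : IsOpen V) (hΓ : IsGoodContour Ψ W V Γ) {y : Cn n}
    {s : Par n} (hy : y ∈ V) (hs : s ∈ Γ.dom) : ContDiffAt ℝ ∞ (Γ.map y) s :=
  (hΓ.contDiffAt hV hy hs).comp s (f := fun s : Par n => (y, s)) (by fun_prop)

lemma IsGoodContour.continuousOn_map (hV : IsOpen V) (hΓ : IsGoodContour Ψ W V Γ) :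
    ContinuousOn (fun q : Cn n × Par n => Γ.map q.1 q.2) (V ×ˢ Γ.dom) := fun _ hq =>
  (hΓ.contDiffAt hV hq.1 hq.2).continuousAt.continuousWithinAt

lemma IsGoodContour.exists_contDiffOn_tangent (hV : IsOpen V) (hΓ : IsGoodContour Ψ W V Γ) :
    ∃ O : Set (Par n), IsOpen O ∧ Γ.dom ⊆ O ∧ ContDiffOn ℝ ∞ (tangent Γ) (V ×ˢ O) := by
  obtain ⟨O, hO, hDO, hsm⟩ := hΓ.smooth
  refine ⟨O, hO, hDO, ?_⟩
  have h1 : ContDiffOn ℝ ∞ (fun q : Cn n × Par n =>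
      (fderiv ℝ (fun q : Cn n × Par n => Γ.map q.1 q.2) q).comp
        (ContinuousLinearMap.inr ℝ (Cn n) (Par n))) (V ×ˢ O) :=
    (hsm.fderiv_of_isOpen (hV.prod hO) (m := ∞) (by simp)).clm_comp contDiffOn_const
  refine h1.congr fun q hq => ?_
  have h2 := ((hsm.contDiffAt ((hV.prod hO).mem_nhds hq)).differentiableAt (by simp)).hasFDerivAt
  have h3 : HasFDerivAt (Γ.map q.1) _ q.2 := h2.comp q.2 (f := fun s : Par n => (q.1, s))
    (hasFDerivAt_prodMk_right q.1 q.2)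
  exact h3.fderiv

lemma IsGoodContour.continuousOn_tangent (hV : IsOpen V) (hΓ : IsGoodContour Ψ W V Γ) :
    ContinuousOn (tangent Γ) (V ×ˢ Γ.dom) := by
  obtain ⟨O, -, hDO, h⟩ := hΓ.exists_contDiffOn_tangent hV
  exact h.continuousOn.mono (prod_mono_right hDO)

lemma critSet_subset (hKV : K ⊆ V) : critSet Γ K ⊆ V ×ˢ Γ.dom := fun _ hq => ⟨hKV hq.1, hq.2.1⟩

lemma IsGoodContour.isCompact_critSet (hV : IsOpen V) (hΓ : IsGoodContour Ψ W V Γ)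
    (hK : IsCompact K) (hKV : K ⊆ V) : IsCompact (critSet Γ K) := by
  have hc := hK.prod hΓ.compact_dom
  have hf : ContinuousOn (fun q : Cn n × Par n => Γ.map q.1 q.2 - antiDiag n q.1) (K ×ˢ Γ.dom) :=
    ((hΓ.continuousOn_map hV).mono (prod_mono_left hKV)).sub (by fun_prop)
  have hcl := hf.preimage_isClosed_of_isClosed hc.isClosed (isClosed_singleton (x := 0))
  refine hc.of_isClosed_subset ?_ fun q hq => ⟨hq.1, hq.2.1⟩
  convert hcl using 1
  ext q
  simp [critSet, sub_eq_zero, and_assoc]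

/-- By injectivity, the contour passes through the critical point only at an interior point. -/
lemma IsGoodContour.mem_interior (hΓ : IsGoodContour Ψ W V Γ) (hKV : K ⊆ V) {q : Cn n × Par n}
    (hq : q ∈ critSet Γ K) : q.2 ∈ interior Γ.dom := by
  obtain ⟨s, hs, hs'⟩ := hΓ.passes q.1 (hKV hq.1)
  have := hΓ.injOn q.1 (hKV hq.1) (interior_subset hs) hq.2.1 (hs'.trans hq.2.2.symm)
  rwa [this] at hs

/-- Away from the critical point the phase is bounded away from zero along the contours. -/
lemma IsGoodContour.exists_phase_le_neg (hV : IsOpen V) (hΓ : IsGoodContour Ψ W V Γ)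
    (hK : IsCompact K) (hKV : K ⊆ V) {ρ : ℝ} (hρ : 0 < ρ) :
    ∃ κ > 0, ∀ q ∈ critSet Γ K, ∀ s ∈ Γ.dom, ρ ≤ dist s q.2 →
      (phase Ψ q.1 (star q.1) (Γ.map q.1 s)).re ≤ -κ := by
  obtain ⟨C, hC, hgood⟩ := hΓ.good
  set f : (Cn n × Par n) × Par n → ℝ := fun p =>
    ‖Γ.map p.1.1 p.2 - antiDiag n p.1.1‖ ^ 2 with hf
  set S : Set ((Cn n × Par n) × Par n) := (critSet Γ K ×ˢ Γ.dom) ∩ {p | ρ ≤ dist p.2 p.1.2} with hS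
  have hSc : IsCompact S := ((hΓ.isCompact_critSet hV hK hKV).prod hΓ.compact_dom).inter_right
    (isClosed_le continuous_const (by fun_prop))
  have hfc : ContinuousOn f S := by
    have h1 : ContinuousOn (fun p : (Cn n × Par n) × Par n => Γ.map p.1.1 p.2) S :=
      (hΓ.continuousOn_map hV).comp (f := fun p : (Cn n × Par n) × Par n => (p.1.1, p.2))
        (by fun_prop) fun p hp => ⟨hKV hp.1.1.1, hp.1.2⟩
    exact ((h1.sub (by fun_prop)).norm).pow 2
  obtain ⟨κ, hκ, hκf⟩ := hSc.exists_forall_le' hfc (a := 0) fun p hp => by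
    have : Γ.map p.1.1 p.2 - antiDiag n p.1.1 ≠ 0 := fun h0 => by
      have h1 : Γ.map p.1.1 p.2 = Γ.map p.1.1 p.1.2 := (sub_eq_zero.1 h0).trans hp.1.1.2.2.symm
      have h2 := hΓ.injOn _ (hKV hp.1.1.1) hp.1.2 hp.1.1.2.1 h1
      have h3 : ρ ≤ dist p.2 p.1.2 := hp.2
      rw [h2, dist_self] at h3
      linarith
    exact pow_pos (norm_pos_iff.2 this) 2
  refine ⟨1 / C * κ, by positivity, fun q hq s hs hρs => ?_⟩
  refine (hgood q.1 (hKV hq.1) s hs).trans ?_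
  have h1 := hκf (q, s) ⟨⟨hq, hs⟩, hρs⟩
  have h2 := sq_norm_le_sum (Γ.map q.1 s - antiDiag n q.1)
  rw [neg_mul, neg_le_neg_iff]
  exact mul_le_mul_of_nonneg_left (h1.trans h2) (by positivity)

/-- The tangent space of a good contour at the critical point is negative for the Hessian of the
real part of the phase. -/
lemma IsGoodContour.exists_hessian_tangent_le (hV : IsOpen V) (hW : IsOpen W)
    (hΨ : ContDiffOn ℝ ∞ Ψ W) (hΓ : IsGoodContour Ψ W V Γ) (hKV : K ⊆ V) :
    ∃ c > 0, ∀ q ∈ critSet Γ K, ∀ σ : Par n,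
      (fderiv ℝ (fderiv ℝ Ψ) (q.1, star q.1) ((tangent Γ q σ).1, 0) (0, (tangent Γ q σ).2)).re
        ≤ -c * ‖tangent Γ q σ‖ ^ 2 := by
  obtain ⟨C, hC, hgood⟩ := hΓ.good
  refine ⟨1 / (2 * C), by positivity, fun q hq σ => ?_⟩
  obtain ⟨y, s⟩ := q
  have hy : y ∈ V := hKV hq.1
  have hs : s ∈ Γ.dom := hq.2.1
  have hmap : Γ.map y s = (y, star y) := hq.2.2
  have hint : s ∈ interior Γ.dom := hΓ.mem_interior hKV hq
  set H := fderiv ℝ (fderiv ℝ Ψ) (y, star y) with hH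
  obtain ⟨r, hr, htay⟩ := exists_phase_taylor hW hΨ (isCompact_singleton (x := y))
    (by rintro x rfl; rw [← hmap]; exact (hΓ.mem_domain x hy s hs).1)
    (ε := 1 / (2 * C)) (by positivity)
  set T := tangent Γ (y, s) with hT
  have hd : HasFDerivAt (Γ.map y) T s :=
    ((hΓ.contDiffAt_map hV hy hs).differentiableAt (by simp)).hasFDerivAt
  -- the estimate of the phase is rescaled to the difference quotients, which tend to `T σ`
  set ξ : ℝ → Cn n × Cn n := fun τ => τ⁻¹ • (Γ.map y (s + τ • σ) - Γ.map y s) with hξ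
  have hξlim : Tendsto ξ (𝓝[>] 0) (𝓝 (T σ)) := by
    have h1 : HasLineDerivAt ℝ (Γ.map y) (T σ) s σ := hd.hasLineDerivAt σ
    have h2 := h1.tendsto_slope_zero
    exact h2.mono_left (nhdsWithin_mono 0 fun x hx => ne_of_gt hx)
  set R : Cn n × Cn n → ℝ := fun ζ => (H (ζ.1, 0) (0, ζ.2)).re with hR
  have hRc : Continuous R := by
    have h1 : Continuous fun ζ : Cn n × Cn n => H (ζ.1, 0) :=
      H.continuous.comp (by fun_prop)
    exact Complex.continuous_re.comp (h1.clm_apply (by fun_prop))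
  have hRs : ∀ (τ : ℝ) ζ, R (τ • ζ) = τ ^ 2 * R ζ := by
    intro τ ζ
    have e1 : (((τ • ζ).1, 0) : Cn n × Cn n) = τ • (ζ.1, 0) := by simp
    have e2 : ((0, (τ • ζ).2) : Cn n × Cn n) = τ • (0, ζ.2) := by simp
    simp only [hR]
    rw [e1, e2]
    simp only [map_smul, smul_apply, Complex.smul_re, smul_eq_mul]
    ring
  have hline : Tendsto (fun τ : ℝ => s + τ • σ) (𝓝[>] 0) (𝓝 s) := by
    have : Continuous fun τ : ℝ => s + τ • σ := by fun_prop
    have h := this.tendsto 0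
    simp only [zero_smul, add_zero] at h
    exact h.mono_left nhdsWithin_le_nhds
  have hev1 : ∀ᶠ τ in 𝓝[>] (0 : ℝ), s + τ • σ ∈ Γ.dom :=
    (hline.eventually (isOpen_interior.mem_nhds hint)).mono fun τ h => interior_subset h
  have hev2 : ∀ᶠ τ in 𝓝[>] (0 : ℝ), ‖Γ.map y (s + τ • σ) - Γ.map y s‖ ≤ r := by
    have h1 := (hd.continuousAt.tendsto.comp hline).sub_const (Γ.map y s)
    rw [sub_self] at h1
    filter_upwards [h1.eventually (Metric.closedBall_mem_nhds 0 hr)] with τ hτ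
    simpa using hτ
  have hle : ∀ᶠ τ in 𝓝[>] (0 : ℝ), R (ξ τ) ≤ -(1 / (2 * C)) * ‖ξ τ‖ ^ 2 := by
    filter_upwards [hev1, hev2, self_mem_nhdsWithin] with τ h1 h2 hτ
    have hτ : 0 < τ := hτ
    set ζ := Γ.map y (s + τ • σ) - Γ.map y s with hζ
    have h3 := htay y rfl ζ h2
    have h4 : (y, star y) + ζ = Γ.map y (s + τ • σ) := by rw [hζ, hmap]; abel
    rw [h4] at h3
    have h5 := hgood y hy _ h1
    have h6 := sq_norm_le_sum ζ
    have h7 : ∑ j, ‖ζ.1 j‖ ^ 2 + ∑ j, ‖ζ.2 j‖ ^ 2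
        = ∑ j, ‖(Γ.map y (s + τ • σ)).1 j - y j‖ ^ 2
          + ∑ j, ‖(Γ.map y (s + τ • σ)).2 j - star (y j)‖ ^ 2 := by
      rw [hζ, hmap]; simp
    rw [h7] at h6
    have h8 : R ζ ≤ -(1 / (2 * C)) * ‖ζ‖ ^ 2 := by
      have h9 := (Complex.abs_re_le_norm _).trans h3
      rw [Complex.sub_re] at h9
      have h10 := (abs_le.1 h9).1
      have h11 := mul_le_mul_of_nonneg_left h6 (show 0 ≤ 1 / C by positivity)
      have h12 : 1 / C = 1 / (2 * C) + 1 / (2 * C) := by field_simp; norm_num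
      have h13 : (1 / C) * ‖ζ‖ ^ 2 = 1 / (2 * C) * ‖ζ‖ ^ 2 + 1 / (2 * C) * ‖ζ‖ ^ 2 := by
        rw [h12]; ring
      simp only [hR]
      linarith
    simp only [hξ]
    rw [hRs, norm_smul, mul_pow, norm_inv, Real.norm_of_nonneg hτ.le]
    have := mul_le_mul_of_nonneg_left h8 (show 0 ≤ (τ⁻¹) ^ 2 by positivity)
    linarith
  exact le_of_tendsto_of_tendsto ((hRc.tendsto _).comp hξlim)
    (((hξlim.norm).pow 2).const_mul _) hle

/-- The tangent maps are uniformly transverse to the anti-diagonal. -/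
lemma IsGoodContour.exists_le_norm_orientCoord_tangent (hV : IsOpen V)
    (hΓ : IsGoodContour Ψ W V Γ) (hK : IsCompact K) (hKV : K ⊆ V)
    (hdet : ∀ q ∈ critSet Γ K, orientDet (Γ.map q.1) q.2 ≠ 0) :
    ∃ c > 0, ∀ q ∈ critSet Γ K, ∀ σ : Par n,
      c * ‖σ‖ ≤ ‖orientCoord n (tangent Γ q σ)‖ ∧ c * ‖σ‖ ≤ ‖tangent Γ q σ‖ := by
  have hc := (hΓ.isCompact_critSet hV hK hKV).prod (isCompact_sphere (0 : Par n) 1)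
  have hcont : ContinuousOn (fun p : (Cn n × Par n) × Par n =>
      ‖orientCoord n (tangent Γ p.1 p.2)‖) (critSet Γ K ×ˢ Metric.sphere (0 : Par n) 1) := by
    have h1 : ContinuousOn (fun p : (Cn n × Par n) × Par n => tangent Γ p.1)
        (critSet Γ K ×ˢ Metric.sphere (0 : Par n) 1) :=
      ((hΓ.continuousOn_tangent hV).mono (critSet_subset hKV)).comp continuousOn_fst
        fun p hp => hp.1
    exact ((orientCoord n).continuous.comp_continuousOn (h1.clm_apply continuousOn_snd)).norm
  have hinj : ∀ q ∈ critSet Γ K, ∀ σ, orientCoord n (tangent Γ q σ) = 0 → σ = 0 := by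
    intro q hq σ h0
    have h2 := hdet q hq
    rw [orientDet_eq_det, ne_eq, LinearMap.det_eq_zero_iff_ker_ne_bot, not_not] at h2
    have : σ ∈ LinearMap.ker ((orientCoord n).comp (fderiv ℝ (Γ.map q.1) q.2) :
        Par n →ₗ[ℝ] Par n) := h0
    rwa [h2, Submodule.mem_bot] at this
  obtain ⟨c, hc0, hcle⟩ := hc.exists_forall_le' hcont (a := 0) fun p hp =>
    norm_pos_iff.2 fun h0 => by
      have h1 : ‖p.2‖ = 1 := by simpa using hp.2
      rw [hinj p.1 hp.1 p.2 h0, norm_zero] at h1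
      exact zero_ne_one h1
  have hmain : ∀ q ∈ critSet Γ K, ∀ σ : Par n, c * ‖σ‖ ≤ ‖orientCoord n (tangent Γ q σ)‖ := by
    intro q hq σ
    rcases eq_or_ne σ 0 with rfl | hσ
    · simp
    have hσ' : 0 < ‖σ‖ := norm_pos_iff.2 hσ
    have h1 := hcle (q, ‖σ‖⁻¹ • σ) ⟨hq, by simp [norm_smul, hσ'.ne']⟩
    simp only [map_smul, norm_smul, norm_inv, norm_norm] at h1
    rwa [inv_mul_eq_div, le_div_iff₀ hσ'] at h1
  set L := ‖orientCoord n‖ with hL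
  have hL0 : 0 ≤ L := norm_nonneg _
  refine ⟨c / (L + 1), by positivity, fun q hq σ => ⟨?_, ?_⟩⟩
  · refine le_trans ?_ (hmain q hq σ)
    gcongr
    exact div_le_self hc0.le (by linarith)
  · have h1 := (hmain q hq σ).trans ((orientCoord n).le_opNorm _)
    rw [div_mul_eq_mul_div, div_le_iff₀ (by positivity)]
    have := norm_nonneg (tangent Γ q σ)
    linarith

end GoodContour

/-! ### Deformation of a good contour to a linear one -/

/-- The linear homotopy from a contour, with the parameters translated such that the critical point
corresponds to `0`, to the standard linear contour `(y, ȳ) + {(z, -z̄)}`. The latter is parametrized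
by the skew part of the tangent map, so that `z - w̄` is constant in time to first order. -/
noncomputable def contourHomotopy {n : ℕ} (Γ : ContourFamily n) (q : Cn n × Par n)
    (p : ℝ × Par n) : Cn n × Cn n :=
  (1 - p.1) • Γ.map q.1 (q.2 + p.2)
    + p.1 • ((q.1, star q.1) + skewPart n (tangent Γ q p.2))

section

variable {n : ℕ} {Ψ : Cn n × Cn n → ℂ} {W : Set (Cn n × Cn n)} {V : Set (Cn n)}
  {Γ : ContourFamily n} {K : Set (Cn n)}

/-- First order expansion of the contours at the critical point, with uniform remainder. -/
lemma IsGoodContour.exists_first_order (hV : IsOpen V) (hΓ : IsGoodContour Ψ W V Γ)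
    (hK : IsCompact K) (hKV : K ⊆ V) {ε : ℝ} (hε : 0 < ε) :
    ∃ ρ > 0, ∀ q ∈ critSet Γ K, ∀ σ : Par n, ‖σ‖ ≤ ρ → q.2 + σ ∈ interior Γ.dom ∧
      ‖fderiv ℝ (Γ.map q.1) (q.2 + σ) - tangent Γ q‖ ≤ ε ∧
      ‖Γ.map q.1 (q.2 + σ) - (q.1, star q.1) - tangent Γ q σ‖ ≤ ε * ‖σ‖ := by
  obtain ⟨ρ, hρ, h⟩ := exists_forall_dist_le_of_isCompact (hΓ.isCompact_critSet hV hK hKV)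
    (hV.prod isOpen_interior) (fun q hq => ⟨hKV hq.1, hΓ.mem_interior hKV hq⟩)
    (Y := Par n →L[ℝ] Cn n × Cn n)
    ((hΓ.continuousOn_tangent hV).mono (prod_mono_right interior_subset)) hε
  have h' : ∀ q ∈ critSet Γ K, ∀ σ : Par n, ‖σ‖ ≤ ρ → q.2 + σ ∈ interior Γ.dom ∧
      ‖fderiv ℝ (Γ.map q.1) (q.2 + σ) - tangent Γ q‖ ≤ ε := by
    intro q hq σ hσ
    obtain ⟨h1, h2⟩ := h q hq (q.1, q.2 + σ) (by
      rw [dist_eq_norm]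
      have : ((q.1, q.2 + σ) : Cn n × Par n) - q = (0, σ) := by ext1 <;> simp
      rw [this]
      simpa using hσ)
    exact ⟨h1.2, by rwa [dist_eq_norm] at h2⟩
  refine ⟨ρ, hρ, fun q hq σ hσ => ⟨(h' q hq σ hσ).1, (h' q hq σ hσ).2, ?_⟩⟩
  have hmem : ∀ s ∈ Metric.closedBall q.2 ρ, s ∈ interior Γ.dom ∧
      ‖fderiv ℝ (Γ.map q.1) s - tangent Γ q‖ ≤ ε := fun s hs => by
    have := h' q hq (s - q.2) (by simpa [dist_eq_norm] using hs)
    rwa [add_sub_cancel] at this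
  have key := (convex_closedBall q.2 ρ).norm_image_sub_le_of_norm_hasFDerivWithin_le'
    (f := Γ.map q.1) (φ := tangent Γ q)
    (fun s hs => (((hΓ.contDiffAt_map hV (hKV hq.1) (interior_subset (hmem s hs).1)).differentiableAt
      (by simp)).hasFDerivAt).hasFDerivWithinAt) (fun s hs => (hmem s hs).2)
    (Metric.mem_closedBall_self hρ.le) (y := q.2 + σ) (by simpa using hσ)
  rwa [hq.2.2, add_sub_cancel_left] at key

lemma hasFDerivAt_contourHomotopy {q : Cn n × Par n} {t : ℝ} {σ : Par n}
    (hd : DifferentiableAt ℝ (Γ.map q.1) (q.2 + σ)) :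
    ∃ L : ℝ × Par n →L[ℝ] Cn n × Cn n, HasFDerivAt (contourHomotopy Γ q) L (t, σ) ∧
      ∀ τ v, L (τ, v) = τ • ((q.1, star q.1) + skewPart n (tangent Γ q σ) - Γ.map q.1 (q.2 + σ))
        + ((1 - t) • fderiv ℝ (Γ.map q.1) (q.2 + σ) v + t • skewPart n (tangent Γ q v)) := by
  have h1 : HasFDerivAt (fun p : ℝ × Par n => Γ.map q.1 (q.2 + p.2)) _ (t, σ) :=
    HasFDerivAt.comp (t, σ) (f := fun p : ℝ × Par n => q.2 + p.2) hd.hasFDerivAt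
      (hasFDerivAt_snd.const_add q.2)
  have h2 : HasFDerivAt (fun p : ℝ × Par n => (q.1, star q.1) + skewPart n (tangent Γ q p.2)) _
      (t, σ) := (((skewPart n).comp (tangent Γ q)).comp
        (ContinuousLinearMap.snd ℝ ℝ (Par n))).hasFDerivAt.const_add (q.1, star q.1)
  have h3 : HasFDerivAt (fun p : ℝ × Par n => p.1) (ContinuousLinearMap.fst ℝ ℝ (Par n)) (t, σ) :=
    hasFDerivAt_fst
  have h4 : HasFDerivAt (contourHomotopy Γ q) _ (t, σ) :=
    ((h3.const_sub 1).smul h1).add (h3.smul h2)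
  refine ⟨_, h4, fun τ v => ?_⟩
  change (1 - t) • fderiv ℝ (Γ.map q.1) (q.2 + σ) v + (-τ) • Γ.map q.1 (q.2 + σ)
    + (t • skewPart n (tangent Γ q v) + τ • ((q.1, star q.1) + skewPart n (tangent Γ q σ))) = _
  module

lemma norm_segment_le {E : Type*} [NormedAddCommGroup E] [NormedSpace ℝ E] {a b : E} {t B : ℝ}
    (ht : t ∈ Icc (0 : ℝ) 1) (ha : ‖a‖ ≤ B) (hb : ‖b‖ ≤ B) : ‖(1 - t) • a + t • b‖ ≤ B := by
  have h := (convex_closedBall (0 : E) B) (by simpa using ha : a ∈ _) (by simpa using hb : b ∈ _)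
    (sub_nonneg.2 ht.2) ht.1 (by ring)
  simpa using h

/-- The effect on the quadratic form `H((z, 0), (0, w))` of a perturbation of its argument. -/
lemma quadratic_perturbation {H : Cn n × Cn n →L[ℝ] Cn n × Cn n →L[ℝ] ℂ} {MH a e : ℝ}
    (hH : ‖H‖ ≤ MH) {ζ r : Cn n × Cn n} (hζ : ‖ζ‖ ≤ a) (hr : ‖r‖ ≤ e) :
    (H ((ζ + r).1, 0) (0, (ζ + r).2)).re
      ≤ (H (ζ.1, 0) (0, ζ.2)).re + MH * (2 * a * e + e ^ 2) := by
  have ha : 0 ≤ a := (norm_nonneg _).trans hζ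
  have he : 0 ≤ e := (norm_nonneg _).trans hr
  have hMH : 0 ≤ MH := (ContinuousLinearMap.opNorm_nonneg H).trans hH
  have hb : ∀ (z w : Cn n × Cn n) (x y : ℝ), ‖z‖ ≤ x → ‖w‖ ≤ y →
      (H (z.1, 0) (0, w.2)).re ≤ MH * (x * y) := by
    intro z w x y hz hw
    have h1 : ‖((z.1, 0) : Cn n × Cn n)‖ ≤ x := by simpa using (norm_fst_le z).trans hz
    have h2 : ‖((0, w.2) : Cn n × Cn n)‖ ≤ y := by simpa using (norm_snd_le w).trans hw
    have hx : 0 ≤ x := (norm_nonneg _).trans hz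
    calc (H (z.1, 0) (0, w.2)).re ≤ ‖H (z.1, 0) (0, w.2)‖ := Complex.re_le_norm _
      _ ≤ ‖H‖ * ‖((z.1, 0) : Cn n × Cn n)‖ * ‖((0, w.2) : Cn n × Cn n)‖ := H.le_opNorm₂ _ _
      _ ≤ MH * x * y := by gcongr
      _ = _ := by ring
  have e1 : (((ζ + r).1, 0) : Cn n × Cn n) = (ζ.1, 0) + (r.1, 0) := by simp
  have e2 : ((0, (ζ + r).2) : Cn n × Cn n) = (0, ζ.2) + (0, r.2) := by simp
  rw [e1, e2]
  simp only [map_add, add_apply, Complex.add_re]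
  have b1 := hb ζ r a e hζ hr
  have b2 := hb r ζ e a hr hζ
  have b3 := hb r r e e hr hr
  nlinarith

set_option maxHeartbeats 1000000 in
/-- Near the critical points, a good contour can be deformed to a linear one through contours along
which the phase is negative, with estimates which are uniform in the base point. -/
lemma IsGoodContour.exists_isNegativeHomotopy (hV : IsOpen V) (hW : IsOpen W)
    (hΨ : IsAlmostHolomorphic Ψ W) (hΓ : IsGoodContour Ψ W V Γ)
    (hK : IsCompact K) (hKV : K ⊆ V)
    (hdet : ∀ q ∈ critSet Γ K, orientDet (Γ.map q.1) q.2 ≠ 0) {Φ : Cn n → ℝ}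
    (hΦ : ∀ y ∈ K, ContDiffAt ℝ ∞ Φ y)
    (hΨΦ : ∀ y ∈ K, ∀ᶠ x in 𝓝 y, Ψ (x, star x) = (Φ x : ℂ))
    (hlevi : ∀ y ∈ K, ∀ ξ, 0 ≤ leviForm Φ y ξ)
    {U : Set (Cn n × Cn n)} (hU : IsOpen U) {b : Cn n × Cn n → ℂ} (hb : IsAlmostHolomorphic b U)
    (hKU : ∀ y ∈ K, (y, star y) ∈ U) :
    ∃ c > 0, ∃ M ≥ 0, ∃ ρ > 0, ∀ k : ℕ, ∃ C ≥ 0, ∀ q ∈ critSet Γ K,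
      (∀ σ, ‖σ‖ ≤ ρ → q.2 + σ ∈ Γ.dom) ∧
      IsNegativeHomotopy c M C ρ k (phase Ψ q.1 (star q.1)) b (contourHomotopy Γ q) := by
  obtain ⟨c₁, hc₁, hneg⟩ := hΓ.exists_hessian_tangent_le hV hW hΨ.smooth hKV
  obtain ⟨c₂, hc₂, hlow⟩ := hΓ.exists_le_norm_orientCoord_tangent hV hK hKV hdet
  obtain ⟨M₁', hM₁'⟩ := (hΓ.isCompact_critSet hV hK hKV).exists_bound_of_continuousOn
    ((hΓ.continuousOn_tangent hV).mono (critSet_subset hKV))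
  set M₁ := |M₁'| with hM₁def
  have hM₁0 : 0 ≤ M₁ := abs_nonneg _
  have hM₁ : ∀ q ∈ critSet Γ K, ∀ σ, ‖tangent Γ q σ‖ ≤ M₁ * ‖σ‖ := fun q hq σ =>
    (tangent Γ q).le_of_opNorm_le ((hM₁' q hq).trans (le_abs_self _)) σ
  have hKW : ∀ q ∈ critSet Γ K, (q.1, star q.1) ∈ W := fun q hq => by
    rw [← hq.2.2]; exact (hΓ.mem_domain q.1 (hKV hq.1) q.2 hq.2.1).1
  have hKW' : ∀ y ∈ K, (y, star y) ∈ W := fun y hy => by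
    obtain ⟨s, hs, hs'⟩ := hΓ.passes y (hKV hy)
    exact hKW (y, s) ⟨hy, interior_subset hs, hs'⟩
  have hHc : ContinuousOn (fderiv ℝ (fderiv ℝ Ψ)) W :=
    (hΨ.smooth.fderiv_of_isOpen hW (m := ∞) (by simp)).continuousOn_fderiv_of_isOpen hW (by simp)
  have hsub : antiDiag n '' K ⊆ W := by rintro _ ⟨y, hy, rfl⟩; exact hKW' y hy
  obtain ⟨MH', hMH'⟩ := (isCompact_antiDiag_image hK).exists_bound_of_continuousOn
    (E := Cn n × Cn n →L[ℝ] Cn n × Cn n →L[ℝ] ℂ) (hHc.mono hsub)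
  set MH := |MH'| with hMHdef
  have hMH0 : 0 ≤ MH := abs_nonneg _
  have hMH : ∀ y ∈ K, ‖fderiv ℝ (fderiv ℝ Ψ) (y, star y)‖ ≤ MH := fun y hy =>
    (hMH' (y, star y) ⟨y, hy, rfl⟩).trans (le_abs_self _)
  -- the quadratic part is at most `-c₀ |σ|²` along the homotopy; the nonlinearity of the contour and
  -- the Taylor remainder of the phase each use up a quarter of it
  set c₀ := c₁ * c₂ ^ 2 with hc₀def
  have hc₀ : 0 < c₀ := by positivity
  set A := MH * (2 * M₁ + 1) with hA
  have hA0 : 0 ≤ A := by positivity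
  set ε := min 1 (c₀ / (4 * (A + 1))) with hε
  have hε0 : 0 < ε := lt_min one_pos (by positivity)
  have hε1 : ε ≤ 1 := min_le_left _ _
  have hAε : A * ε ≤ c₀ / 4 := by
    have h1 : ε ≤ c₀ / (4 * (A + 1)) := min_le_right _ _
    rw [le_div_iff₀ (by positivity)] at h1
    nlinarith
  set M₂ := 4 * M₁ + 2 with hM₂
  have hM₂0 : 0 < M₂ := by positivity
  obtain ⟨ρ₀, hρ₀, hfirst⟩ := hΓ.exists_first_order hV hK hKV hε0
  obtain ⟨r₁, hr₁, htay⟩ := exists_phase_taylor hW hΨ.smooth hK hKW'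
    (ε := c₀ / (4 * M₂ ^ 2)) (by positivity)
  obtain ⟨r₂, hr₂, hdom, hphase⟩ := exists_norm_dBar_phase_le hW hΨ hK hKW'
  obtain ⟨r₃, hr₃, hbU, ⟨Mb, hMb⟩, hbbar⟩ := hb.exists_norm_dBar_add_le hU hK hKU
  set r := min r₁ (min r₂ r₃) with hr
  have hr0 : 0 < r := lt_min hr₁ (lt_min hr₂ hr₃)
  set ρ₁ := min ρ₀ (r / M₂) with hρ₁
  have hρ₁0 : 0 < ρ₁ := lt_min hρ₀ (by positivity)
  have hρr : ∀ x : ℝ, x ≤ ρ₁ → M₂ * x ≤ r := fun x hx => by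
    have := hx.trans (min_le_right _ _)
    rwa [le_div_iff₀ hM₂0, mul_comm] at this
  -- the decomposition of the homotopy into its linear part and a remainder
  have hdecomp : ∀ q ∈ critSet Γ K, ∀ t : ℝ, ∀ σ : Par n, ‖σ‖ ≤ ρ₁ → ∃ R : Cn n × Cn n,
      ‖R‖ ≤ ε * ‖σ‖ ∧ contourHomotopy Γ q (t, σ) = (q.1, star q.1)
        + (((1 - t) • tangent Γ q σ + t • skewPart n (tangent Γ q σ)) + (1 - t) • R) := by
    intro q hq t σ hσ
    refine ⟨_, (hfirst q hq σ (hσ.trans (min_le_left _ _))).2.2, ?_⟩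
    simp only [contourHomotopy]
    module
  have hnear : ∀ q ∈ critSet Γ K, ∀ t ∈ Ioo (-1 : ℝ) 2, ∀ σ : Par n, ‖σ‖ ≤ ρ₁ →
      ∃ ζ : Cn n × Cn n, ‖ζ‖ ≤ M₂ * ‖σ‖ ∧ contourHomotopy Γ q (t, σ) = (q.1, star q.1) + ζ := by
    intro q hq t ht σ hσ
    obtain ⟨R, hR, he⟩ := hdecomp q hq t σ hσ
    refine ⟨_, ?_, he⟩
    have h1 : |1 - t| ≤ 2 := abs_le.2 ⟨by linarith [ht.2], by linarith [ht.1]⟩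
    have h2 : |t| ≤ 2 := abs_le.2 ⟨by linarith [ht.1], ht.2.le⟩
    have h3 := hM₁ q hq σ
    have h4 := (norm_skewPart_le (tangent Γ q σ)).trans h3
    calc _ ≤ ‖(1 - t) • tangent Γ q σ‖ + ‖t • skewPart n (tangent Γ q σ)‖ + ‖(1 - t) • R‖ :=
          (norm_add_le _ _).trans (add_le_add_left (norm_add_le _ _) _)
      _ = |1 - t| * ‖tangent Γ q σ‖ + |t| * ‖skewPart n (tangent Γ q σ)‖ + |1 - t| * ‖R‖ := by
          simp only [norm_smul, Real.norm_eq_abs]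
      _ ≤ 2 * (M₁ * ‖σ‖) + 2 * (M₁ * ‖σ‖) + 2 * (1 * ‖σ‖) := by
          gcongr
          exact hR.trans (by gcongr)
      _ = M₂ * ‖σ‖ := by rw [hM₂]; ring
  have hI : Icc (0 : ℝ) 1 ⊆ Ioo (-1) 2 := fun t ht => ⟨by linarith [ht.1], by linarith [ht.2]⟩
  have hdiff : ∀ q ∈ critSet Γ K, ∀ σ : Par n, ‖σ‖ ≤ ρ₁ →
      ContDiffAt ℝ ∞ (Γ.map q.1) (q.2 + σ) := fun q hq σ hσ =>
    hΓ.contDiffAt_map hV (hKV hq.1)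
      (interior_subset (hfirst q hq σ (hσ.trans (min_le_left _ _))).1)
  set M := max |Mb| (max ((2 * M₁ + 1) * ρ₁) (2 * M₁ + 1)) with hM
  refine ⟨c₀ / 2, by positivity, M, (abs_nonneg Mb).trans (le_max_left _ _), ρ₁ / 2,
    by positivity, fun k => ?_⟩
  obtain ⟨Cp, hCp0, hCp⟩ := hphase (2 * k)
  obtain ⟨Cb, hCb0, hCb⟩ := hbbar (2 * k)
  refine ⟨max Cp Cb * M₂ ^ (2 * k), by positivity, fun q hq => ?_⟩
  have hhalf : ∀ σ : Par n, ‖σ‖ ≤ ρ₁ / 2 → ‖σ‖ ≤ ρ₁ := fun σ hσ => by linarith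
  refine ⟨fun σ hσ => interior_subset
    (hfirst q hq σ ((hhalf σ hσ).trans (min_le_left _ _))).1, ?_⟩
  have hy := hq.1
  have hrr : ∀ {ζ : Cn n × Cn n} {σ : Par n}, ‖σ‖ ≤ ρ₁ → ‖ζ‖ ≤ M₂ * ‖σ‖ → ‖ζ‖ ≤ r :=
    fun hσ hζ => hζ.trans (hρr _ hσ)
  have hle₁ : r ≤ r₁ := min_le_left _ _
  have hle₂ : r ≤ r₂ := (min_le_right _ _).trans (min_le_left _ _)
  have hle₃ : r ≤ r₃ := (min_le_right _ _).trans (min_le_right _ _)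
  constructor
  · refine ⟨Ioo (-1 : ℝ) 2 ×ˢ Metric.ball 0 ρ₁, phaseDomain W q.1 ∩ U,
      isOpen_Ioo.prod Metric.isOpen_ball,
      prod_mono_right (Metric.closedBall_subset_ball (by linarith)), ?_,
      (isOpen_phaseDomain hW q.1).inter hU,
      (contDiffOn_phase hΨ.smooth q.1).mono inter_subset_left, hb.smooth.mono inter_subset_right,
      ?_⟩
    · rintro ⟨t, σ⟩ ⟨-, hσ⟩
      have hσ' : ‖σ‖ ≤ ρ₁ := by simpa using (Metric.mem_ball.1 hσ).le
      have h1 : ContDiffAt ℝ ∞ (fun p : ℝ × Par n => Γ.map q.1 (q.2 + p.2)) (t, σ) :=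
        ContDiffAt.comp (t, σ) (f := fun p : ℝ × Par n => q.2 + p.2) (hdiff q hq σ hσ')
          (by fun_prop)
      have h2 : ContDiffAt ℝ ∞
          (fun p : ℝ × Par n => (q.1, star q.1) + skewPart n (tangent Γ q p.2)) (t, σ) :=
        contDiffAt_const.add (((skewPart n).comp (tangent Γ q)).contDiff.contDiffAt.comp _
          contDiffAt_snd)
      exact (((contDiffAt_const.sub contDiffAt_fst).smul h1).add
        (contDiffAt_fst.smul h2)).contDiffWithinAt
    · rintro ⟨t, σ⟩ ⟨ht, hσ⟩
      have hσ' : ‖σ‖ ≤ ρ₁ := by simpa using (Metric.mem_ball.1 hσ).le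
      obtain ⟨ζ, hζ, he⟩ := hnear q hq t ht σ hσ'
      rw [he]
      exact ⟨hdom q.1 hy ζ ((hrr hσ' hζ).trans hle₂), hbU q.1 hy ζ ((hrr hσ' hζ).trans hle₃)⟩
  · intro t ht σ hσ
    have hσ' := hhalf σ hσ
    obtain ⟨R, hR, he⟩ := hdecomp q hq t σ hσ'
    set ζ₀ := (1 - t) • tangent Γ q σ + t • skewPart n (tangent Γ q σ) with hζ₀
    have h1t : 0 ≤ 1 - t := by linarith [ht.2]
    have h3 := hM₁ q hq σ
    have h4 := (norm_skewPart_le (tangent Γ q σ)).trans h3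
    have hζ₀n : ‖ζ₀‖ ≤ M₁ * ‖σ‖ := norm_segment_le ht h3 h4
    have hRn : ‖(1 - t) • R‖ ≤ ε * ‖σ‖ := by
      rw [norm_smul, Real.norm_of_nonneg h1t]
      exact (mul_le_of_le_one_left (norm_nonneg _) (by linarith [ht.1])).trans hR
    have hζn : ‖ζ₀ + (1 - t) • R‖ ≤ M₂ * ‖σ‖ := by
      have := (norm_add_le ζ₀ ((1 - t) • R)).trans (add_le_add hζ₀n hRn)
      nlinarith [norm_nonneg σ, mul_nonneg hM₁0 (norm_nonneg σ),
        mul_le_mul_of_nonneg_right hε1 (norm_nonneg σ)]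
    have h5 := htay q.1 hy _ ((hrr hσ' hζn).trans hle₁)
    rw [he]
    have h6 := (Complex.abs_re_le_norm _).trans h5
    rw [Complex.sub_re] at h6
    have h7 := (abs_le.1 h6).2
    have h8 := quadratic_perturbation (hMH q.1 hy) hζ₀n hRn
    have h9 := re_mixed_hessian_contract_le hW hΨ (hKW q hq) (hΦ q.1 hy) (hΨΦ q.1 hy)
      (hlevi q.1 hy) (tangent Γ q σ) ht hζ₀
    have h10 := hneg q hq σ
    have h11 : c₂ ^ 2 * ‖σ‖ ^ 2 ≤ ‖tangent Γ q σ‖ ^ 2 := by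
      rw [← mul_pow]
      exact pow_le_pow_left₀ (by positivity) (hlow q hq σ).2 2
    have h12 : MH * (2 * (M₁ * ‖σ‖) * (ε * ‖σ‖) + (ε * ‖σ‖) ^ 2) ≤ c₀ / 4 * ‖σ‖ ^ 2 := by
      have : MH * (2 * (M₁ * ‖σ‖) * (ε * ‖σ‖) + (ε * ‖σ‖) ^ 2)
          ≤ MH * (2 * (M₁ * ‖σ‖) * (ε * ‖σ‖) + 1 * ε * ‖σ‖ ^ 2) := by
        rw [mul_pow, pow_two ε]
        gcongr
      refine this.trans ?_
      have e : MH * (2 * (M₁ * ‖σ‖) * (ε * ‖σ‖) + 1 * ε * ‖σ‖ ^ 2) = A * ε * ‖σ‖ ^ 2 := by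
        rw [hA]; ring
      rw [e]
      gcongr
    have h13 : c₀ / (4 * M₂ ^ 2) * ‖ζ₀ + (1 - t) • R‖ ^ 2 ≤ c₀ / 4 * ‖σ‖ ^ 2 := by
      calc _ ≤ c₀ / (4 * M₂ ^ 2) * (M₂ * ‖σ‖) ^ 2 := by gcongr
        _ = _ := by field_simp
    have h14 := mul_le_mul_of_nonneg_left h11 hc₁.le
    rw [← mul_assoc, ← hc₀def] at h14
    linarith
  · intro t ht σ hσ
    obtain ⟨ζ, hζ, he⟩ := hnear q hq t (hI ht) σ (hhalf σ hσ)
    rw [he]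
    exact (hMb q.1 hy ζ ((hrr (hhalf σ hσ) hζ).trans hle₃)).trans
      ((le_abs_self _).trans (le_max_left _ _))
  · intro t ht σ hσ
    have hσ' := hhalf σ hσ
    obtain ⟨L, hL, hL'⟩ := hasFDerivAt_contourHomotopy (t := t)
      ((hdiff q hq σ hσ').differentiableAt (by simp))
    rw [hL.fderiv, hL']
    simp only [one_smul, map_zero, smul_zero, add_zero]
    have h1 := (hfirst q hq σ (hσ'.trans (min_le_left _ _))).2.2
    have h3 := hM₁ q hq σ
    have h4 := (norm_skewPart_le (tangent Γ q σ)).trans h3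
    have e : (q.1, star q.1) + skewPart n (tangent Γ q σ) - Γ.map q.1 (q.2 + σ)
        = skewPart n (tangent Γ q σ) - tangent Γ q σ
          - (Γ.map q.1 (q.2 + σ) - (q.1, star q.1) - tangent Γ q σ) := by abel
    rw [e]
    have h5 : ε * ‖σ‖ ≤ ‖σ‖ := mul_le_of_le_one_left (norm_nonneg _) hε1
    calc _ ≤ M₁ * ‖σ‖ + M₁ * ‖σ‖ + ‖σ‖ :=
          (norm_sub_le _ _).trans (add_le_add ((norm_sub_le _ _).trans (add_le_add h4 h3))
            (h1.trans h5))
      _ = (2 * M₁ + 1) * ‖σ‖ := by ring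
      _ ≤ (2 * M₁ + 1) * ρ₁ := by gcongr
      _ ≤ M := (le_max_left _ _).trans (le_max_right _ _)
  · intro t ht σ hσ j
    have hσ' := hhalf σ hσ
    obtain ⟨L, hL, hL'⟩ := hasFDerivAt_contourHomotopy (t := t)
      ((hdiff q hq σ hσ').differentiableAt (by simp))
    rw [hL.fderiv, hL', zero_smul, zero_add]
    set e : Par n := Pi.single j 1 with he
    have hen : ‖e‖ = 1 := by rw [he, Pi.norm_single, norm_one]
    have h3 := hM₁ q hq e
    rw [hen, mul_one] at h3
    have h4 := (norm_skewPart_le (tangent Γ q e)).trans h3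
    have h5 : ‖fderiv ℝ (Γ.map q.1) (q.2 + σ) e‖ ≤ M₁ + 1 := by
      have h6 := (hfirst q hq σ (hσ'.trans (min_le_left _ _))).2.1
      have h7 := (fderiv ℝ (Γ.map q.1) (q.2 + σ) - tangent Γ q).le_of_opNorm_le h6 e
      rw [hen, mul_one, sub_apply] at h7
      have h8 := norm_add_le (tangent Γ q e)
        (fderiv ℝ (Γ.map q.1) (q.2 + σ) e - tangent Γ q e)
      rw [add_sub_cancel] at h8
      linarith
    exact (norm_segment_le ht (h5.trans (by linarith)) (h4.trans (by linarith))).trans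
      ((le_max_right _ _).trans (le_max_right _ _) : 2 * M₁ + 1 ≤ M)
  all_goals
    intro t ht σ hσ v
    obtain ⟨ζ, hζ, he⟩ := hnear q hq t (hI ht) σ (hhalf σ hσ)
    rw [he]
    have hpow : ‖ζ‖ ^ (2 * k) ≤ M₂ ^ (2 * k) * ‖σ‖ ^ (2 * k) := by
      rw [← mul_pow]
      exact pow_le_pow_left₀ (norm_nonneg _) hζ _
  · calc _ ≤ Cp * ‖ζ‖ ^ (2 * k) * ‖v‖ := hCp q.1 hy ζ ((hrr (hhalf σ hσ) hζ).trans hle₂) v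
      _ ≤ max Cp Cb * (M₂ ^ (2 * k) * ‖σ‖ ^ (2 * k)) * ‖v‖ := by
          gcongr
          exact le_max_left _ _
      _ = _ := by ring
  · calc _ ≤ Cb * ‖ζ‖ ^ (2 * k) * ‖v‖ := hCb q.1 hy ζ ((hrr (hhalf σ hσ) hζ).trans hle₃) v
      _ ≤ max Cp Cb * (M₂ ^ (2 * k) * ‖σ‖ ^ (2 * k)) * ‖v‖ := by
          gcongr
          exact le_max_right _ _
      _ = _ := by ring

end

/-! ### Comparison with the standard linear contour -/

/-- The integral over the standard linear contour through `(y, ȳ)`, with a cutoff `χ`. -/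
noncomputable def stdIntegral {n : ℕ} (Ψ b : Cn n × Cn n → ℂ) (χ : Par n → ℝ) (h : ℝ) (y : Cn n) :
    ℂ :=
  (∫ u, (χ u : ℂ) * (Complex.exp (2 / (h : ℂ)
      * phase Ψ y (star y) ((y, star y) + stdContour n u)) * b ((y, star y) + stdContour n u)))
    * volForm n fun j => stdContour n (Pi.single j 1)

lemma volForm_comp_linear {n : ℕ} (S : Par n →L[ℝ] Cn n × Cn n) (A : Par n →L[ℝ] Par n) :
    volForm n (fun j => S (A (Pi.single j 1)))
      = ((LinearMap.det (A : Par n →ₗ[ℝ] Par n) : ℝ) : ℂ) * volForm n fun j => S (Pi.single j 1) := by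
  have h1 : ∀ v : Par n, S v = ∑ i, v i • S (Pi.single i 1) := fun v => by
    have h2 : v = ∑ i, v i • (Pi.single i 1 : Par n) := by
      funext k
      simp [Finset.sum_apply, Pi.single_apply]
    conv_lhs => rw [h2]
    simp only [map_sum, map_smul]
  rw [volForm_apply, volForm_apply, ← LinearMap.det_toMatrix', mul_comm]
  have h2 : (((LinearMap.toMatrix' (A : Par n →ₗ[ℝ] Par n)).det : ℝ) : ℂ)
      = ((LinearMap.toMatrix' (A : Par n →ₗ[ℝ] Par n)).map Complex.ofRealHom).det :=
    Complex.ofRealHom.map_det _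
  rw [h2, ← Matrix.det_mul]
  congr 1
  ext k j
  rw [Matrix.mul_apply, Matrix.of_apply, h1 (A (Pi.single j 1))]
  simp only [Matrix.of_apply, Matrix.map_apply, LinearMap.toMatrix'_apply]
  rcases k with k | k
  · simp only [Sum.elim_inl, Prod.fst_sum, Finset.sum_apply]
    refine Finset.sum_congr rfl fun i _ => ?_
    simp [mul_comm]
  · simp only [Sum.elim_inr, Prod.snd_sum, Finset.sum_apply]
    refine Finset.sum_congr rfl fun i _ => ?_
    simp [mul_comm]

/-- Linear change of variables. -/
lemma integral_comp_linear {n : ℕ} (A : Par n →L[ℝ] Par n)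
    (hA : LinearMap.det (A : Par n →ₗ[ℝ] Par n) ≠ 0) (f : Par n → ℂ) :
    ∫ u, f u = |LinearMap.det (A : Par n →ₗ[ℝ] Par n)| • ∫ s, f (A s) := by
  have hb : Function.Bijective A := by
    have h := LinearMap.equivOfDetNeZero (A : Par n →ₗ[ℝ] Par n) hA
    exact (LinearMap.equivOfDetNeZero (A : Par n →ₗ[ℝ] Par n) hA).bijective
  have h1 := integral_image_eq_integral_abs_det_fderiv_smul (volume : Measure (Par n))
    MeasurableSet.univ (f := A) (f' := fun _ => A) (fun x _ => A.hasFDerivWithinAt)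
    hb.1.injOn f
  rw [image_univ, hb.2.range_eq, Measure.restrict_univ, integral_smul] at h1
  exact h1

/-- The integral over the standard linear contour does not depend on the linear parametrization, up
to the sign of its determinant. -/
lemma integral_linear_contour {n : ℕ} {Ψ b : Cn n × Cn n → ℂ} {χ : Par n → ℝ} {h : ℝ} {y : Cn n}
    (T : Par n →L[ℝ] Cn n × Cn n) {d : ℝ}
    (hd : d = LinearMap.det ((orientCoord n).comp T : Par n →ₗ[ℝ] Par n)) (hd0 : d ≠ 0) :
    ∫ s, (χ (orientCoord n (T s)) : ℂ) * (Complex.exp (2 / (h : ℂ)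
        * phase Ψ y (star y) ((y, star y) + skewPart n (T s))) * b ((y, star y) + skewPart n (T s))
        * volForm n fun j => skewPart n (T (Pi.single j 1)))
      = ((d / |d| : ℝ) : ℂ) * stdIntegral Ψ b χ h y := by
  set A := (orientCoord n).comp T with hA
  have hsk : ∀ s, skewPart n (T s) = stdContour n (A s) := fun s =>
    (stdContour_orientCoord (T s)).symm
  have hAs : ∀ s, orientCoord n (T s) = A s := fun s => rfl
  have hdet := volForm_comp_linear (stdContour n) A
  rw [← hd] at hdet
  have h1 := integral_comp_linear A (by rw [← hd]; exact hd0) fun u => (χ u : ℂ) *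
    (Complex.exp (2 / (h : ℂ) * phase Ψ y (star y) ((y, star y) + stdContour n u))
      * b ((y, star y) + stdContour n u))
  rw [← hd] at h1
  have hc : ((|d| : ℝ) : ℂ) ≠ 0 := by exact_mod_cast abs_ne_zero.2 hd0
  simp only [hsk, hAs, hdet, stdIntegral, ← mul_assoc] at h1 ⊢
  rw [integral_mul_const, integral_mul_const, h1, Complex.real_smul]
  push_cast
  field_simp

section

variable {n : ℕ} {Ψ : Cn n × Cn n → ℂ} {W : Set (Cn n × Cn n)} {V : Set (Cn n)}
  {Γ : ContourFamily n} {K : Set (Cn n)} {U : Set (Cn n × Cn n)} {b : Cn n × Cn n → ℂ}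

lemma IsGoodContour.continuousOn_integrand (hV : IsOpen V) (hΨ : ContDiffOn ℝ ∞ Ψ W)
    (hΓ : IsGoodContour Ψ W V Γ) (hb : ContinuousOn b U) (hΓU : ∀ y ∈ V, MapsTo (Γ.map y) Γ.dom U)
    {y : Cn n} (hy : y ∈ V) (h : ℝ) :
    ContinuousOn (fun s => Complex.exp (2 / (h : ℂ) * phase Ψ y (star y) (Γ.map y s))
      * b (Γ.map y s) * pullbackDensity (Γ.map y) s) Γ.dom := by
  have h1 : ContinuousOn (Γ.map y) Γ.dom := fun s hs =>
    (hΓ.contDiffAt_map hV hy hs).continuousAt.continuousWithinAt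
  have h2 : ContinuousOn (fun s => phase Ψ y (star y) (Γ.map y s)) Γ.dom :=
    (contDiffOn_phase hΨ y).continuousOn.comp h1 fun s hs => hΓ.mem_domain y hy s hs
  have h3 : ContinuousOn (fun s => tangent Γ (y, s)) Γ.dom :=
    (hΓ.continuousOn_tangent hV).comp (f := fun s : Par n => (y, s)) (by fun_prop)
      fun s hs => ⟨hy, hs⟩
  have h4 : ContinuousOn (pullbackDensity (Γ.map y)) Γ.dom := by
    have : pullbackDensity (Γ.map y)
        = fun s => volFormR n fun j => tangent Γ (y, s) (Pi.single j 1) := by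
      funext s; rw [pullbackDensity_eq_volForm]; rfl
    rw [this]
    exact (volFormR n).cont.comp_continuousOn
      (continuousOn_pi.2 fun j => h3.clm_apply continuousOn_const)
  exact ((continuousOn_const.mul h2).cexp.mul (hb.comp h1 (hΓU y hy))).mul h4

/-- Up to `O(h^∞)`, the integral over a good contour is that over the standard linear contour, with
the sign given by the orientation. -/
lemma IsGoodContour.exists_norm_integral_sub_stdIntegral_le (hV : IsOpen V) (hW : IsOpen W)
    (hΨ : IsAlmostHolomorphic Ψ W) (hΓ : IsGoodContour Ψ W V Γ)
    (hK : IsCompact K) (hKV : K ⊆ V)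
    (hdet : ∀ q ∈ critSet Γ K, orientDet (Γ.map q.1) q.2 ≠ 0) {Φ : Cn n → ℝ}
    (hΦ : ∀ y ∈ K, ContDiffAt ℝ ∞ Φ y)
    (hΨΦ : ∀ y ∈ K, ∀ᶠ x in 𝓝 y, Ψ (x, star x) = (Φ x : ℂ))
    (hlevi : ∀ y ∈ K, ∀ ξ, 0 ≤ leviForm Φ y ξ)
    (hU : IsOpen U) (hb : IsAlmostHolomorphic b U) (hΓU : ∀ y ∈ V, MapsTo (Γ.map y) Γ.dom U) :
    ∃ η > 0, ∀ χ : Par n → ℝ, ContDiff ℝ ∞ χ → (∀ u, |χ u| ≤ 1) →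
      (∀ u, η ≤ ‖u‖ → χ u = 0) → (∀ᶠ u in 𝓝 0, χ u = 1) →
      ∀ N : ℕ, ∃ C : ℝ, ∀ h : ℝ, 0 < h → h ≤ 1 → ∀ q ∈ critSet Γ K,
        ‖(∫ s in Γ.dom, Complex.exp (2 / (h : ℂ) * phase Ψ q.1 (star q.1) (Γ.map q.1 s))
            * b (Γ.map q.1 s) * pullbackDensity (Γ.map q.1) s)
          - ((orientDet (Γ.map q.1) q.2 / |orientDet (Γ.map q.1) q.2| : ℝ) : ℂ)
            * stdIntegral Ψ b χ h q.1‖ ≤ C * h ^ N := by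
  have hKU : ∀ y ∈ K, (y, star y) ∈ U := fun y hy => by
    obtain ⟨s, hs, hs'⟩ := hΓ.passes y (hKV hy)
    rw [← hs']
    exact hΓU y (hKV hy) (interior_subset hs)
  obtain ⟨c, hc, M, hM, ρ, hρ, hhom⟩ :=
    hΓ.exists_isNegativeHomotopy hV hW hΨ hK hKV hdet hΦ hΨΦ hlevi hU hb hKU
  obtain ⟨c₂, hc₂, hlow⟩ := hΓ.exists_le_norm_orientCoord_tangent hV hK hKV hdet
  have hKdom := hK.prod hΓ.compact_dom
  obtain ⟨M₁', hM₁'⟩ := hKdom.exists_bound_of_continuousOn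
    ((hΓ.continuousOn_tangent hV).mono (prod_mono_left hKV))
  set M₁ := |M₁'|
  have hM₁0 : 0 ≤ M₁ := abs_nonneg _
  have hM₁ : ∀ q ∈ K ×ˢ Γ.dom, ‖tangent Γ q‖ ≤ M₁ := fun q hq =>
    (hM₁' q hq).trans (le_abs_self _)
  obtain ⟨Mb', hMb'⟩ := hKdom.exists_bound_of_continuousOn
    (hb.smooth.continuousOn.comp ((hΓ.continuousOn_map hV).mono (prod_mono_left hKV))
      fun q hq => hΓU q.1 (hKV hq.1) hq.2)
  set Mb := |Mb'|
  have hMb0 : 0 ≤ Mb := abs_nonneg _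
  have hMb : ∀ q ∈ K ×ˢ Γ.dom, ‖b (Γ.map q.1 q.2)‖ ≤ Mb := fun q hq =>
    (hMb' q hq).trans (le_abs_self _)
  refine ⟨c₂ * ρ, by positivity, fun χ hχ hχ1 hχ0 hχev N => ?_⟩
  -- the cutoff, transported to the parameter domain of the contour
  set LA := ‖orientCoord n‖ * M₁ with hLA
  have hLA0 : 0 ≤ LA := by positivity
  set A : Cn n × Par n → Par n →L[ℝ] Par n := fun q => (orientCoord n).comp (tangent Γ q) with hA
  have hAle : ∀ q ∈ critSet Γ K, ∀ σ, ‖A q σ‖ ≤ LA * ‖σ‖ := fun q hq σ =>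
    (A q).le_of_opNorm_le ((ContinuousLinearMap.opNorm_comp_le _ _).trans
      (mul_le_mul_of_nonneg_left (hM₁ q ⟨hq.1, hq.2.1⟩) (norm_nonneg _))) σ
  obtain ⟨η₁, hη₁, hχη₁⟩ := Metric.eventually_nhds_iff_ball.1 hχev
  set ρ' := η₁ / (LA + 1) with hρ'
  have hρ'0 : 0 < ρ' := by positivity
  have hsmall : ∀ q ∈ critSet Γ K, ∀ σ : Par n, ‖σ‖ < ρ' → A q σ ∈ Metric.ball 0 η₁ := by
    intro q hq σ hσ
    rw [mem_ball_zero_iff]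
    rw [hρ', lt_div_iff₀ (by positivity)] at hσ
    have := hAle q hq σ
    nlinarith [norm_nonneg σ]
  have hχc : HasCompactSupport χ := by
    refine HasCompactSupport.intro (isCompact_closedBall (0 : Par n) (c₂ * ρ)) fun u hu => ?_
    rw [mem_closedBall_zero_iff, not_le] at hu
    exact hχ0 u hu.le
  obtain ⟨Bχ, hBχ⟩ := (hχc.fderiv (𝕜 := ℝ)).exists_bound_of_continuous
    (hχ.continuous_fderiv (by simp))
  have hBχ0 : 0 ≤ Bχ := (norm_nonneg _).trans (hBχ 0)
  obtain ⟨C, hC, hneg⟩ := hhom (N + 1)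
  obtain ⟨B, hB⟩ := exists_norm_integral_homotopy_le n (ρ := ρ) hc hM
    (show 0 ≤ Bχ * LA by positivity) hC hρ'0 N
  obtain ⟨κ, hκ, hfar⟩ := hΓ.exists_phase_le_neg hV hK hKV hρ'0
  set D := ‖volFormR n‖ * M₁ ^ (2 * n) with hD
  have hD0 : 0 ≤ D := by positivity
  refine ⟨2 * Mb * D * (N.factorial * (1 / (2 * κ)) ^ N) * volume.real Γ.dom + B,
    fun h hh hh1 q hq => ?_⟩
  obtain ⟨hball, hP⟩ := hneg q hq
  have hy : q.1 ∈ V := hKV hq.1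
  set F := phase Ψ q.1 (star q.1) with hF
  set Y : Par n → ℂ := fun s => Complex.exp (2 / (h : ℂ) * F (Γ.map q.1 s))
            * b (Γ.map q.1 s) * pullbackDensity (Γ.map q.1) s with hY
  have hYc : ContinuousOn Y Γ.dom :=
    hΓ.continuousOn_integrand hV hΨ.smooth hb.smooth.continuousOn hΓU hy h
  set χ' : Par n → ℝ := fun σ => χ (A q σ) with hχ'
  have hχ's : ContDiff ℝ ∞ χ' := hχ.comp (A q).contDiff
  have hχ'd : ∀ σ, HasFDerivAt χ' ((fderiv ℝ χ (A q σ)).comp (A q)) σ := fun σ =>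
    (hχ.differentiable (by simp) _).hasFDerivAt.comp σ (A q).hasFDerivAt
  have hχ'0 : ∀ σ, ρ ≤ ‖σ‖ → χ' σ = 0 := fun σ hσ => by
    refine hχ0 _ (le_trans ?_ (hlow q hq σ).1)
    gcongr
  have hχ'supp : tsupport χ' ⊆ Metric.closedBall 0 ρ := by
    refine closure_minimal (fun σ hσ => ?_) Metric.isClosed_closedBall
    rw [mem_closedBall_zero_iff]
    by_contra hcon
    exact hσ (hχ'0 σ (not_le.1 hcon).le)
  have hχ'1 : ∀ σ, ‖σ‖ < ρ' → χ' σ = 1 := fun σ hσ => hχη₁ _ (hsmall q hq σ hσ)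
  have hχ'f : ∀ σ, ‖σ‖ < ρ' → fderiv ℝ χ' σ = 0 := by
    intro σ hσ
    have : χ' =ᶠ[𝓝 σ] fun _ => (1 : ℝ) := by
      filter_upwards [(isOpen_lt continuous_norm continuous_const).mem_nhds hσ] with τ hτ
      exact hχ'1 τ hτ
    rw [this.fderiv_eq, fderiv_fun_const]
    rfl
  have hχ'b : ∀ σ j, |fderiv ℝ χ' σ (Pi.single j 1)| ≤ Bχ * LA := by
    intro σ j
    rw [(hχ'd σ).fderiv, ContinuousLinearMap.comp_apply, ← Real.norm_eq_abs]
    refine ((fderiv ℝ χ (A q σ)).le_of_opNorm_le (hBχ _) _).trans ?_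
    gcongr
    simpa [Pi.norm_single] using hAle q hq (Pi.single j 1)
  have key := hB F b _ hP χ' hχ's hχ'supp (fun s => hχ1 _) hχ'f hχ'b h hh hh1
  have hd : ∀ σ : Par n, ‖σ‖ ≤ ρ → DifferentiableAt ℝ (Γ.map q.1) (q.2 + σ) := fun σ hσ =>
    (hΓ.contDiffAt_map hV hy (hball σ hσ)).differentiableAt (by simp)
  -- the end `t = 1` of the homotopy is the linear contour
  have hend : ∫ s, (χ' s : ℂ) * (Complex.exp (2 / (h : ℂ) * F (contourHomotopy Γ q (1, s)))
      * b (contourHomotopy Γ q (1, s))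
      * volForm n fun j => fderiv ℝ (contourHomotopy Γ q) (1, s) (0, Pi.single j 1))
      = ((orientDet (Γ.map q.1) q.2 / |orientDet (Γ.map q.1) q.2| : ℝ) : ℂ)
            * stdIntegral Ψ b χ h q.1 := by
    rw [← integral_linear_contour (tangent Γ q) (orientDet_eq_det _ _) (hdet q hq)]
    refine integral_congr_ae (Eventually.of_forall fun σ => ?_)
    by_cases hσ : ‖σ‖ ≤ ρ
    · obtain ⟨L, hL, hL'⟩ := hasFDerivAt_contourHomotopy (t := 1) (hd σ hσ)
      have e : contourHomotopy Γ q (1, σ) = (q.1, star q.1) + skewPart n (tangent Γ q σ) := by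
        simp [contourHomotopy]
      simp only [hL.fderiv, hL', e]
      simp [hχ', hA, hF]
    · have h0 := hχ'0 σ (not_le.1 hσ).le
      have h0' : χ (orientCoord n (tangent Γ q σ)) = 0 := h0
      simp [h0, h0']
  -- the end `t = 0` is the given contour, cut off near the critical point
  have hstart : ∫ s, (χ' s : ℂ) * (Complex.exp (2 / (h : ℂ) * F (contourHomotopy Γ q (0, s)))
      * b (contourHomotopy Γ q (0, s))
      * volForm n fun j => fderiv ℝ (contourHomotopy Γ q) (0, s) (0, Pi.single j 1))
      = ∫ s in Γ.dom, (χ' (s - q.2) : ℂ) * Y s := by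
    rw [setIntegral_eq_integral_of_forall_compl_eq_zero (s := Γ.dom),
      ← integral_add_left_eq_self (fun s => (χ' (s - q.2) : ℂ) * Y s) q.2]
    · refine integral_congr_ae (Eventually.of_forall fun σ => ?_)
      by_cases hσ : ‖σ‖ ≤ ρ
      · obtain ⟨L, hL, hL'⟩ := hasFDerivAt_contourHomotopy (t := 0) (hd σ hσ)
        have e : contourHomotopy Γ q (0, σ) = Γ.map q.1 (q.2 + σ) := by
          simp [contourHomotopy]
        simp only [hL.fderiv, hL', e, hY, add_sub_cancel_left, pullbackDensity_eq_volForm]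
        simp
      · have h0 := hχ'0 σ (not_le.1 hσ).le
        simp [h0]
    · intro s hs
      have : χ' (s - q.2) = 0 := by
        refine hχ'0 _ ?_
        by_contra hcon
        exact hs (by simpa using hball (s - q.2) (not_le.1 hcon).le)
      simp [this]
  rw [hend, hstart] at key
  -- away from the critical point the integrand is exponentially small
  have hcut : ‖(∫ s in Γ.dom, Y s) - ∫ s in Γ.dom, (χ' (s - q.2) : ℂ) * Y s‖
      ≤ 2 * Mb * D * (N.factorial * (1 / (2 * κ)) ^ N) * volume.real Γ.dom * h ^ N := by
    have hχ'c : Continuous fun s : Par n => (χ' (s - q.2) : ℂ) :=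
      Complex.continuous_ofReal.comp (hχ's.continuous.comp (by fun_prop))
    have hχYi : IntegrableOn (fun s => (χ' (s - q.2) : ℂ) * Y s) Γ.dom :=
      (hχ'c.continuousOn.mul hYc).integrableOn_compact hΓ.compact_dom
    rw [← integral_sub (hYc.integrableOn_compact hΓ.compact_dom) hχYi]
    have hpt : ∀ s ∈ Γ.dom, ‖Y s - (χ' (s - q.2) : ℂ) * Y s‖
        ≤ 2 * Mb * D * (N.factorial * (1 / (2 * κ)) ^ N) * h ^ N := by
      intro s hs
      rcases lt_or_ge ‖s - q.2‖ ρ' with hlt | hge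
      · rw [hχ'1 _ hlt]
        simp
        positivity
      have h1 : ‖Complex.exp (2 / (h : ℂ) * F (Γ.map q.1 s))‖
          ≤ N.factorial * (1 / (2 * κ)) ^ N * h ^ N := by
        rw [norm_exp_two_div_mul]
        have h2 := hfar q hq s hs (by rwa [dist_eq_norm])
        have h3 := pow_mul_exp_neg_div_le (c := 2 * κ) (x := 1) (by positivity) hh zero_le_one N
        have h4 : Real.exp (2 / h * (F (Γ.map q.1 s)).re) ≤ Real.exp (-(2 * κ * 1 / h)) := by
          refine Real.exp_le_exp.2 ?_
          have := mul_le_mul_of_nonneg_left h2 (show 0 ≤ 2 / h by positivity)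
          refine this.trans (le_of_eq ?_)
          field_simp
        rw [one_pow, one_mul] at h3
        refine h4.trans (h3.trans (le_of_eq ?_))
        rw [div_pow, div_pow, one_pow]
        ring
      have h5 : ‖pullbackDensity (Γ.map q.1) s‖ ≤ D := by
        rw [pullbackDensity_eq_volForm]
        refine norm_volForm_le _ fun j => ?_
        have := (tangent Γ (q.1, s)).le_of_opNorm_le (hM₁ (q.1, s) ⟨hq.1, hs⟩) (Pi.single j 1)
        simpa [tangent, Pi.norm_single] using this
      have h6 : ‖(1 - (χ' (s - q.2) : ℂ))‖ ≤ 2 := by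
        have h7 : ‖((χ' (s - q.2) : ℝ) : ℂ)‖ ≤ 1 := by
          rw [Complex.norm_real, Real.norm_eq_abs]; exact hχ1 _
        refine (norm_sub_le _ _).trans ?_
        rw [norm_one]
        linarith
      have e : Y s - (χ' (s - q.2) : ℂ) * Y s = (1 - (χ' (s - q.2) : ℂ)) * Y s := by ring
      rw [e, norm_mul, hY, norm_mul, norm_mul]
      have h8 := hMb (q.1, s) ⟨hq.1, hs⟩
      calc _ ≤ 2 * ((N.factorial * (1 / (2 * κ)) ^ N * h ^ N) * Mb * D) := by gcongr
        _ = _ := by ring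
    refine (norm_setIntegral_le_of_norm_le_const hΓ.compact_dom.measure_lt_top hpt).trans
      (le_of_eq ?_)
    ring
  calc _ ≤ _ := norm_sub_le_norm_sub_add_norm_sub _ (∫ s in Γ.dom, (χ' (s - q.2) : ℂ) * Y s) _
    _ ≤ 2 * Mb * D * (N.factorial * (1 / (2 * κ)) ^ N) * volume.real Γ.dom * h ^ N + B * h ^ N :=
        add_le_add hcut (by rw [norm_sub_rev]; exact key)
    _ = _ := by ring

end

/-! ### Comparison of two contours -/

/-- The oscillatory integral over `Γ(y)` with amplitude `b`, without the factor `h⁻ⁿ`. -/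
noncomputable def contourIntegral {n : ℕ} (Ψ : Cn n × Cn n → ℂ) (Γ : ContourFamily n)
    (b : Cn n × Cn n → ℂ) (h : ℝ) (y : Cn n) : ℂ :=
  ∫ s in Γ.dom, Complex.exp (2 / (h : ℂ) * phase Ψ y (star y) (Γ.map y s)) * b (Γ.map y s)
    * pullbackDensity (Γ.map y) s

lemma opA_eq_contourIntegral {n : ℕ} (Ψ : Cn n × Cn n → ℂ) (Γ : ContourFamily n)
    (a : ℝ → Cn n × Cn n → ℂ) (h : ℝ) (y : Cn n) :
    opA Ψ Γ a h y = 1 / (h : ℂ) ^ n * contourIntegral Ψ Γ (a h) h y := rfl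

section

variable {n : ℕ} {Ψ : Cn n × Cn n → ℂ} {W : Set (Cn n × Cn n)} {V : Set (Cn n)}
  {Γ Γ₀ : ContourFamily n} {K : Set (Cn n)} {U : Set (Cn n × Cn n)} {b : Cn n × Cn n → ℂ}

lemma SameOrientation.symm (h : SameOrientation V Γ Γ₀) : SameOrientation V Γ₀ Γ :=
  fun y hy s hs s₀ hs₀ e e₀ => by rw [mul_comm]; exact h y hy s₀ hs₀ s hs e₀ e

/-- The determinants of both contours are not zero, as they are compared at a point through which
both contours pass. -/
lemma SameOrientation.orientDet_ne_zero (h : SameOrientation V Γ Γ₀)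
    (hΓ₀ : IsGoodContour Ψ W V Γ₀) (hKV : K ⊆ V) {q : Cn n × Par n} (hq : q ∈ critSet Γ K) :
    orientDet (Γ.map q.1) q.2 ≠ 0 := by
  obtain ⟨s₀, hs₀, e⟩ := hΓ₀.passes q.1 (hKV hq.1)
  exact left_ne_zero_of_mul (h q.1 (hKV hq.1) q.2 hq.2.1 s₀ (interior_subset hs₀) hq.2.2 e).ne'

lemma div_abs_eq_of_mul_pos {x y : ℝ} (h : 0 < x * y) : x / |x| = y / |y| := by
  rcases pos_and_pos_or_neg_and_neg_of_mul_pos h with ⟨hx, hy⟩ | ⟨hx, hy⟩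
  · rw [abs_of_pos hx, abs_of_pos hy, div_self hx.ne', div_self hy.ne']
  · rw [abs_of_neg hx, abs_of_neg hy, div_neg_self hx.ne, div_neg_self hy.ne]

/-- For a single almost holomorphic amplitude the two integrals agree up to `O(h^∞)`: both are
compared with the integral over the standard contour, with a common cutoff and a common sign. -/
lemma exists_norm_contourIntegral_sub_le (hV : IsOpen V) (hW : IsOpen W)
    (hΨ : IsAlmostHolomorphic Ψ W) (hΓ : IsGoodContour Ψ W V Γ) (hΓ₀ : IsGoodContour Ψ W V Γ₀)
    (hor : SameOrientation V Γ Γ₀) (hK : IsCompact K) (hKV : K ⊆ V) {Φ : Cn n → ℝ}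
    (hΦ : ∀ y ∈ K, ContDiffAt ℝ ∞ Φ y)
    (hΨΦ : ∀ y ∈ K, ∀ᶠ x in 𝓝 y, Ψ (x, star x) = (Φ x : ℂ))
    (hlevi : ∀ y ∈ K, ∀ ξ, 0 ≤ leviForm Φ y ξ)
    (hU : IsOpen U) (hb : IsAlmostHolomorphic b U) (hΓU : ∀ y ∈ V, MapsTo (Γ.map y) Γ.dom U)
    (hΓ₀U : ∀ y ∈ V, MapsTo (Γ₀.map y) Γ₀.dom U) (N : ℕ) :
    ∃ C : ℝ, ∀ h : ℝ, 0 < h → h ≤ 1 → ∀ y ∈ K,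
      ‖contourIntegral Ψ Γ b h y - contourIntegral Ψ Γ₀ b h y‖ ≤ C * h ^ N := by
  obtain ⟨η, hη, H⟩ := hΓ.exists_norm_integral_sub_stdIntegral_le hV hW hΨ hK hKV
    (fun q hq => hor.orientDet_ne_zero hΓ₀ hKV hq) hΦ hΨΦ hlevi hU hb hΓU
  obtain ⟨η₀, hη₀, H₀⟩ := hΓ₀.exists_norm_integral_sub_stdIntegral_le hV hW hΨ hK hKV
    (fun q hq => hor.symm.orientDet_ne_zero hΓ hKV hq) hΦ hΨΦ hlevi hU hb hΓ₀U
  have hm : 0 < min η η₀ := lt_min hη hη₀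
  let χ : ContDiffBump (0 : Par n) := ⟨min η η₀ / 2, min η η₀, by positivity, by linarith⟩
  have hχ1 : ∀ u, |χ u| ≤ 1 := fun u => by rw [abs_of_nonneg χ.nonneg]; exact χ.le_one
  have hχ0 : ∀ u, min η η₀ ≤ ‖u‖ → χ u = 0 := fun u hu =>
    χ.zero_of_le_dist (by rwa [dist_zero_right])
  obtain ⟨C, hC⟩ := H χ χ.contDiff hχ1 (fun u hu => hχ0 u ((min_le_left _ _).trans hu))
    χ.eventuallyEq_one N
  obtain ⟨C₀, hC₀⟩ := H₀ χ χ.contDiff hχ1 (fun u hu => hχ0 u ((min_le_right _ _).trans hu))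
    χ.eventuallyEq_one N
  refine ⟨C + C₀, fun h hh hh1 y hy => ?_⟩
  obtain ⟨s, hs, e⟩ := hΓ.passes y (hKV hy)
  obtain ⟨s₀, hs₀, e₀⟩ := hΓ₀.passes y (hKV hy)
  have h1 := hC h hh hh1 (y, s) ⟨hy, interior_subset hs, e⟩
  have h2 := hC₀ h hh hh1 (y, s₀) ⟨hy, interior_subset hs₀, e₀⟩
  have h3 := div_abs_eq_of_mul_pos
    (hor y (hKV hy) s (interior_subset hs) s₀ (interior_subset hs₀) e e₀)
  simp only [h3] at h1
  rw [add_mul]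
  refine (norm_sub_le_norm_sub_add_norm_sub _ _ _).trans (add_le_add h1 ?_)
  rw [norm_sub_rev]
  exact h2

/-- On a good contour the exponential factor is bounded by `1`, so that the integral is bounded by
the supremum of the amplitude. -/
lemma IsGoodContour.exists_norm_contourIntegral_le (hV : IsOpen V) (hΓ : IsGoodContour Ψ W V Γ)
    (hK : IsCompact K) (hKV : K ⊆ V) :
    ∃ C : ℝ, 0 ≤ C ∧ ∀ h : ℝ, 0 < h → ∀ y ∈ K, ∀ (b : Cn n × Cn n → ℂ) (B : ℝ),
      (∀ s ∈ Γ.dom, ‖b (Γ.map y s)‖ ≤ B) → 0 ≤ B → ‖contourIntegral Ψ Γ b h y‖ ≤ C * B := by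
  obtain ⟨M, hM⟩ := (hK.prod hΓ.compact_dom).exists_bound_of_continuousOn
    ((hΓ.continuousOn_tangent hV).mono (prod_mono_left hKV))
  refine ⟨‖volFormR n‖ * |M| ^ (2 * n) * volume.real Γ.dom, by positivity,
    fun h hh y hy b B hB hB0 => ?_⟩
  have hpt : ∀ s ∈ Γ.dom, ‖Complex.exp (2 / (h : ℂ) * phase Ψ y (star y) (Γ.map y s))
      * b (Γ.map y s) * pullbackDensity (Γ.map y) s‖
      ≤ 1 * B * (‖volFormR n‖ * |M| ^ (2 * n)) := by
    intro s hs
    rw [norm_mul, norm_mul]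
    gcongr
    · rw [norm_exp_two_div_mul, Real.exp_le_one_iff]
      obtain ⟨C, hC, hgood⟩ := hΓ.good
      refine mul_nonpos_of_nonneg_of_nonpos (by positivity) ((hgood y (hKV hy) s hs).trans ?_)
      rw [neg_mul, neg_nonpos]
      positivity
    · exact hB s hs
    · rw [pullbackDensity_eq_volForm]
      refine norm_volForm_le _ fun j => ?_
      have := (tangent Γ (y, s)).le_of_opNorm_le ((hM (y, s) ⟨hy, hs⟩).trans (le_abs_self M))
        (Pi.single j 1)
      simpa [tangent, Pi.norm_single] using this
  refine (norm_setIntegral_le_of_norm_le_const hΓ.compact_dom.measure_lt_top hpt).trans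
    (le_of_eq ?_)
  ring

lemma IsGoodContour.isCompact_image (hV : IsOpen V) (hΓ : IsGoodContour Ψ W V Γ)
    (hK : IsCompact K) (hKV : K ⊆ V) :
    IsCompact ((fun q : Cn n × Par n => Γ.map q.1 q.2) '' (K ×ˢ Γ.dom)) :=
  (hK.prod hΓ.compact_dom).image_of_continuousOn
    ((hΓ.continuousOn_map hV).mono (prod_mono_left hKV))

lemma IsGoodContour.contourIntegral_add (hV : IsOpen V) (hΨ : ContDiffOn ℝ ∞ Ψ W)
    (hΓ : IsGoodContour Ψ W V Γ) (hΓU : ∀ y ∈ V, MapsTo (Γ.map y) Γ.dom U) {b c : Cn n × Cn n → ℂ}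
    (hb : ContinuousOn b U) (hc : ContinuousOn c U) {y : Cn n} (hy : y ∈ V) (h : ℝ) :
    contourIntegral Ψ Γ (fun p => b p + c p) h y
      = contourIntegral Ψ Γ b h y + contourIntegral Ψ Γ c h y := by
  unfold contourIntegral
  rw [← integral_add
    ((hΓ.continuousOn_integrand hV hΨ hb hΓU hy h).integrableOn_compact hΓ.compact_dom)
    ((hΓ.continuousOn_integrand hV hΨ hc hΓU hy h).integrableOn_compact hΓ.compact_dom)]
  congr 1
  funext s
  ring

lemma contourIntegral_const_mul (Ψ : Cn n × Cn n → ℂ) (Γ : ContourFamily n) (z : ℂ)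
    (b : Cn n × Cn n → ℂ) (h : ℝ) (y : Cn n) :
    contourIntegral Ψ Γ (fun p => z * b p) h y = z * contourIntegral Ψ Γ b h y := by
  unfold contourIntegral
  rw [← integral_const_mul]
  congr 1
  funext s
  ring

lemma IsGoodContour.contourIntegral_sum (hV : IsOpen V) (hΨ : ContDiffOn ℝ ∞ Ψ W)
    (hΓ : IsGoodContour Ψ W V Γ) (hΓU : ∀ y ∈ V, MapsTo (Γ.map y) Γ.dom U)
    {b : ℕ → Cn n × Cn n → ℂ} (hb : ∀ j, ContinuousOn (b j) U) {y : Cn n} (hy : y ∈ V) (h : ℝ)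
    (N : ℕ) :
    contourIntegral Ψ Γ (fun p => ∑ j ∈ Finset.range N, b j p) h y
      = ∑ j ∈ Finset.range N, contourIntegral Ψ Γ (b j) h y := by
  induction N with
  | zero => simp [contourIntegral]
  | succ N ih =>
    simp only [Finset.sum_range_succ]
    rw [hΓ.contourIntegral_add hV hΨ hΓU (continuousOn_finsetSum _ fun j _ => hb j) (hb N) hy, ih]

/-- The difference of the two operators is `O(h^∞)`, uniformly on compact sets. -/
lemma exists_norm_opA_sub_le (hV : IsOpen V) (hW : IsOpen W)
    (hΨ : IsAlmostHolomorphic Ψ W) (hΓ : IsGoodContour Ψ W V Γ) (hΓ₀ : IsGoodContour Ψ W V Γ₀)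
    (hor : SameOrientation V Γ Γ₀) (hK : IsCompact K) (hKV : K ⊆ V) {Φ : Cn n → ℝ}
    (hΦ : ∀ y ∈ K, ContDiffAt ℝ ∞ Φ y)
    (hΨΦ : ∀ y ∈ K, ∀ᶠ x in 𝓝 y, Ψ (x, star x) = (Φ x : ℂ))
    (hlevi : ∀ y ∈ K, ∀ ξ, 0 ≤ leviForm Φ y ξ) (hU : IsOpen U)
    (hΓU : ∀ y ∈ V, MapsTo (Γ.map y) Γ.dom U) (hΓ₀U : ∀ y ∈ V, MapsTo (Γ₀.map y) Γ₀.dom U)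
    {a : ℝ → Cn n × Cn n → ℂ} (ha : IsAdmissibleAmplitude a U) (N : ℕ) :
    ∃ C : ℝ, ∀ᶠ h in 𝓝[>] (0 : ℝ), ∀ y ∈ K, ‖opA Ψ Γ a h y - opA Ψ Γ₀ a h y‖ ≤ C * h ^ N := by
  obtain ⟨aj, haj, hexp⟩ := ha.expansion
  obtain ⟨c, hc0, hc⟩ := hΓ.exists_norm_contourIntegral_le hV hK hKV
  obtain ⟨c₀, hc₀0, hc₀⟩ := hΓ₀.exists_norm_contourIntegral_le hV hK hKV
  have himg : (fun q : Cn n × Par n => Γ.map q.1 q.2) '' (K ×ˢ Γ.dom) ⊆ U := by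
    rintro _ ⟨q, hq, rfl⟩
    exact hΓU q.1 (hKV hq.1) hq.2
  have himg₀ : (fun q : Cn n × Par n => Γ₀.map q.1 q.2) '' (K ×ˢ Γ₀.dom) ⊆ U := by
    rintro _ ⟨q, hq, rfl⟩
    exact hΓ₀U q.1 (hKV hq.1) hq.2
  -- `n` additional terms of the expansion make up for the factor `h⁻ⁿ`
  obtain ⟨B, hB⟩ := (hexp (N + n)).bound _ himg (hΓ.isCompact_image hV hK hKV) 0
  obtain ⟨B₀, hB₀⟩ := (hexp (N + n)).bound _ himg₀ (hΓ₀.isCompact_image hV hK hKV) 0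
  choose C hC using fun j => exists_norm_contourIntegral_sub_le hV hW hΨ hΓ hΓ₀ hor hK hKV hΦ hΨΦ
    hlevi hU (haj j) hΓU hΓ₀U (N + n)
  refine ⟨∑ j ∈ Finset.range (N + n), |C j| + c * |B| + c₀ * |B₀|, ?_⟩
  filter_upwards [hB, hB₀, (hexp (N + n)).smooth, Ioc_mem_nhdsGT (zero_lt_one (α := ℝ))]
    with h hBh hB₀h hsm hh y hy
  obtain ⟨hh0, hh1⟩ := hh
  set r : Cn n × Cn n → ℂ := fun p => a h p - ∑ j ∈ Finset.range (N + n), (h : ℂ) ^ j * aj j p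
    with hr
  have ha' : a h = fun p => r p + ∑ j ∈ Finset.range (N + n), (h : ℂ) ^ j * aj j p := by
    funext p
    simp [hr]
  have hajc : ∀ j, ContinuousOn (fun p => (h : ℂ) ^ j * aj j p) U := fun j =>
    continuousOn_const.mul (haj j).smooth.continuousOn
  have hsplit : ∀ {Γ : ContourFamily n}, IsGoodContour Ψ W V Γ →
      (∀ y ∈ V, MapsTo (Γ.map y) Γ.dom U) →
      contourIntegral Ψ Γ (a h) h y = contourIntegral Ψ Γ r h y
        + ∑ j ∈ Finset.range (N + n), (h : ℂ) ^ j * contourIntegral Ψ Γ (aj j) h y := by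
    intro Γ hΓ hΓU
    rw [ha', hΓ.contourIntegral_add hV hΨ.smooth hΓU hsm.continuousOn
      (continuousOn_finsetSum _ fun j _ => hajc j) (hKV hy),
      hΓ.contourIntegral_sum hV hΨ.smooth hΓU hajc (hKV hy)]
    simp only [contourIntegral_const_mul]
  have hhN : 0 ≤ h ^ (N + n) := by positivity
  have e1 : ‖contourIntegral Ψ Γ r h y‖ ≤ c * (|B| * h ^ (N + n)) := by
    refine hc h hh0 y hy r _ (fun s hs => ?_) (by positivity)
    have := hBh _ (mem_image_of_mem _ (show (y, s) ∈ K ×ˢ Γ.dom from ⟨hy, hs⟩))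
    rw [norm_iteratedFDeriv_zero] at this
    exact this.trans (mul_le_mul_of_nonneg_right (le_abs_self B) hhN)
  have e2 : ‖contourIntegral Ψ Γ₀ r h y‖ ≤ c₀ * (|B₀| * h ^ (N + n)) := by
    refine hc₀ h hh0 y hy r _ (fun s hs => ?_) (by positivity)
    have := hB₀h _ (mem_image_of_mem _ (show (y, s) ∈ K ×ˢ Γ₀.dom from ⟨hy, hs⟩))
    rw [norm_iteratedFDeriv_zero] at this
    exact this.trans (mul_le_mul_of_nonneg_right (le_abs_self B₀) hhN)
  have e3 : ‖∑ j ∈ Finset.range (N + n), (h : ℂ) ^ j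
      * (contourIntegral Ψ Γ (aj j) h y - contourIntegral Ψ Γ₀ (aj j) h y)‖
      ≤ (∑ j ∈ Finset.range (N + n), |C j|) * h ^ (N + n) := by
    rw [Finset.sum_mul]
    refine norm_sum_le_of_le _ fun j _ => ?_
    rw [norm_mul, norm_pow, Complex.norm_real, Real.norm_of_nonneg hh0.le]
    calc _ ≤ 1 * (|C j| * h ^ (N + n)) := by
          gcongr
          · exact pow_le_one₀ hh0.le hh1
          · exact (hC j h hh0 hh1 y hy).trans
              (mul_le_mul_of_nonneg_right (le_abs_self _) hhN)
      _ = _ := one_mul _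
  have key : contourIntegral Ψ Γ (a h) h y - contourIntegral Ψ Γ₀ (a h) h y
      = ∑ j ∈ Finset.range (N + n), (h : ℂ) ^ j
        * (contourIntegral Ψ Γ (aj j) h y - contourIntegral Ψ Γ₀ (aj j) h y)
        + contourIntegral Ψ Γ r h y - contourIntegral Ψ Γ₀ r h y := by
    rw [hsplit hΓ hΓU, hsplit hΓ₀ hΓ₀U]
    simp only [mul_sub, Finset.sum_sub_distrib]
    ring
  rw [opA_eq_contourIntegral, opA_eq_contourIntegral, ← mul_sub, norm_mul, norm_div, norm_one,
    norm_pow, Complex.norm_real, Real.norm_of_nonneg hh0.le, one_div_mul_eq_div, div_le_iff₀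
    (by positivity), key]
  refine ((norm_sub_le _ _).trans (add_le_add (norm_add_le _ _) le_rfl)).trans ?_
  refine (add_le_add (add_le_add e3 e1) e2).trans (le_of_eq ?_)
  rw [pow_add]
  ring

end

/-! ### Temperate families of functions -/

section Temperate

variable {E F G : Type*} [NormedAddCommGroup E] [NormedSpace ℝ E] [NormedAddCommGroup F]
  [NormedSpace ℝ F] [NormedAddCommGroup G] [NormedSpace ℝ G]

/-- Every derivative of `f(·; h)` grows at most like a power of `1 / h` as `h → 0⁺`, uniformly on
the set `S`. -/
def IsTemperate (f : ℝ → E → F) (S : Set E) : Prop :=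
  ∀ k : ℕ, ∃ M : ℕ, ∃ C : ℝ, ∀ᶠ h in 𝓝[>] (0 : ℝ), ∀ p ∈ S,
    ‖iteratedFDeriv ℝ k (f h) p‖ * h ^ M ≤ C

lemma eventually_pos_le_one : ∀ᶠ h in 𝓝[>] (0 : ℝ), 0 < h ∧ h ≤ 1 :=
  Ioc_mem_nhdsGT (zero_lt_one (α := ℝ))

lemma mul_pow_le_of_le {x C h : ℝ} (hx : 0 ≤ x) (hh : 0 < h) (hh1 : h ≤ 1) {M N : ℕ} (hMN : M ≤ N)
    (h1 : x * h ^ M ≤ C) : x * h ^ N ≤ C :=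
  (mul_le_mul_of_nonneg_left (pow_le_pow_of_le_one hh.le hh1 hMN) hx).trans h1

/-- Finitely many derivatives have a common exponent and a common constant. -/
lemma IsTemperate.exists_uniform {f : ℝ → E → F} {S : Set E} (hf : IsTemperate f S) (k : ℕ) :
    ∃ M : ℕ, ∃ C : ℝ, 0 ≤ C ∧ ∀ᶠ h in 𝓝[>] (0 : ℝ), ∀ p ∈ S, ∀ i ≤ k,
      ‖iteratedFDeriv ℝ i (f h) p‖ * h ^ M ≤ C := by
  choose M C hC using hf
  refine ⟨∑ i ∈ Finset.range (k + 1), M i, ∑ i ∈ Finset.range (k + 1), |C i|,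
    Finset.sum_nonneg fun _ _ => abs_nonneg _, ?_⟩
  have hall : ∀ᶠ h in 𝓝[>] (0 : ℝ), ∀ i ∈ Finset.range (k + 1), ∀ p ∈ S,
      ‖iteratedFDeriv ℝ i (f h) p‖ * h ^ M i ≤ C i :=
    (Finset.eventually_all _).2 fun i _ => hC i
  filter_upwards [hall, eventually_pos_le_one] with h hh hh1 p hp i hi
  have hi' : i ∈ Finset.range (k + 1) := Finset.mem_range.2 (by omega)
  refine mul_pow_le_of_le (norm_nonneg _) hh1.1 hh1.2
    (Finset.single_le_sum (f := M) (fun _ _ => Nat.zero_le _) hi') ((hh i hi' p hp).trans ?_)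
  exact (le_abs_self _).trans
    (Finset.single_le_sum (f := fun i => |C i|) (fun _ _ => abs_nonneg _) hi')

lemma IsTemperate.of_contDiffOn {f : E → F} {S N : Set E} (hN : IsOpen N) (hS : IsCompact S)
    (hSN : S ⊆ N) (hf : ContDiffOn ℝ ∞ f N) : IsTemperate (fun _ => f) S := by
  intro k
  have h1 : ContinuousOn (iteratedFDeriv ℝ k f) N :=
    (hf.continuousOn_iteratedFDerivWithin (m := k) (mod_cast le_top) hN.uniqueDiffOn).congr
      fun x hx => (iteratedFDerivWithin_of_isOpen k hN hx).symm
  obtain ⟨C, hC⟩ := hS.exists_bound_of_continuousOn (h1.mono hSN)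
  exact ⟨0, C, Eventually.of_forall fun h p hp => by simpa using hC p hp⟩

lemma IsTemperate.mul {f g : ℝ → E → ℂ} {S N : Set E} (hN : IsOpen N) (hSN : S ⊆ N)
    (hf : IsTemperate f S) (hg : IsTemperate g S)
    (hfN : ∀ᶠ h in 𝓝[>] (0 : ℝ), ContDiffOn ℝ ∞ (f h) N)
    (hgN : ∀ᶠ h in 𝓝[>] (0 : ℝ), ContDiffOn ℝ ∞ (g h) N) :
    IsTemperate (fun h p => f h p * g h p) S := by
  intro k
  obtain ⟨M, C, hC0, hC⟩ := hf.exists_uniform k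
  obtain ⟨M', C', hC'0, hC'⟩ := hg.exists_uniform k
  refine ⟨M + M', ∑ i ∈ Finset.range (k + 1), (k.choose i : ℝ) * C * C', ?_⟩
  filter_upwards [hC, hC', hfN, hgN, eventually_pos_le_one] with h h1 h2 h3 h4 hh p hp
  have hpow : 0 ≤ h ^ M := pow_nonneg hh.1.le _
  have hpow' : 0 ≤ h ^ M' := pow_nonneg hh.1.le _
  have key := norm_iteratedFDerivWithin_mul_le h3 h4 hN.uniqueDiffOn (hSN hp) (n := k)
    (mod_cast le_top)
  simp only [iteratedFDerivWithin_of_isOpen _ hN (hSN hp)] at key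
  refine (mul_le_mul_of_nonneg_right key (pow_nonneg hh.1.le _)).trans ?_
  rw [Finset.sum_mul]
  refine Finset.sum_le_sum fun i hi => ?_
  have hi' : i ≤ k := by simpa [Nat.lt_succ_iff] using hi
  calc _ = (k.choose i : ℝ) * (‖iteratedFDeriv ℝ i (f h) p‖ * h ^ M)
        * (‖iteratedFDeriv ℝ (k - i) (g h) p‖ * h ^ M') := by rw [pow_add]; ring
    _ ≤ _ := by
      gcongr
      · exact h1 p hp i hi'
      · exact h2 p hp _ (Nat.sub_le _ _)

lemma norm_iteratedFDeriv_comp_le_of_isOpen {g : F → G} {f : E → F} {s : Set E} {t : Set F}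
    (hs : IsOpen s) (ht : IsOpen t) (hg : ContDiffOn ℝ ∞ g t) (hf : ContDiffOn ℝ ∞ f s)
    (hst : MapsTo f s t) {x : E} (hx : x ∈ s) {k : ℕ} {C D : ℝ}
    (hC : ∀ i ≤ k, ‖iteratedFDeriv ℝ i g (f x)‖ ≤ C)
    (hD : ∀ i, 1 ≤ i → i ≤ k → ‖iteratedFDeriv ℝ i f x‖ ≤ D ^ i) :
    ‖iteratedFDeriv ℝ k (g ∘ f) x‖ ≤ k.factorial * C * D ^ k := by
  rw [← iteratedFDerivWithin_of_isOpen k hs hx]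
  refine norm_iteratedFDerivWithin_comp_le hg hf (n := k) (mod_cast le_top) ht.uniqueDiffOn
    hs.uniqueDiffOn hst hx (fun i hi => ?_) fun i hi hi' => ?_
  · rw [iteratedFDerivWithin_of_isOpen i ht (hst hx)]
    exact hC i hi
  · rw [iteratedFDerivWithin_of_isOpen i hs hx]
    exact hD i hi hi'

lemma exists_norm_iteratedFDeriv_le {f : E → F} {S N : Set E} (hN : IsOpen N)
    (hS : IsCompact S) (hSN : S ⊆ N) (hf : ContDiffOn ℝ ∞ f N) (k : ℕ) :
    ∃ D : ℝ, 1 ≤ D ∧ ∀ p ∈ S, ∀ i ≤ k, ‖iteratedFDeriv ℝ i f p‖ ≤ D := by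
  have h1 : ∀ i : ℕ, ContinuousOn (iteratedFDeriv ℝ i f) N := fun i =>
    (hf.continuousOn_iteratedFDerivWithin (m := i) (mod_cast le_top) hN.uniqueDiffOn).congr
      fun x hx => (iteratedFDerivWithin_of_isOpen i hN hx).symm
  choose C hC using fun i => hS.exists_bound_of_continuousOn ((h1 i).mono hSN)
  refine ⟨1 + ∑ i ∈ Finset.range (k + 1), |C i|,
    le_add_of_nonneg_right (Finset.sum_nonneg fun _ _ => abs_nonneg _), fun p hp i hi => ?_⟩
  have h2 := Finset.single_le_sum (f := fun i => |C i|) (fun _ _ => abs_nonneg _)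
    (Finset.mem_range.2 (Nat.lt_succ_of_le hi))
  have h3 := (hC i p hp).trans (le_abs_self _)
  linarith

lemma IsTemperate.comp {g : ℝ → F → G} {f : E → F} {S N : Set E} {U : Set F} (hN : IsOpen N)
    (hU : IsOpen U) (hS : IsCompact S) (hSN : S ⊆ N) (hf : ContDiffOn ℝ ∞ f N)
    (hfU : MapsTo f N U) (hg : ∀ᶠ h in 𝓝[>] (0 : ℝ), ContDiffOn ℝ ∞ (g h) U)
    (hgt : IsTemperate g (f '' S)) : IsTemperate (fun h => g h ∘ f) S := by
  intro k
  obtain ⟨M, C, hC0, hC⟩ := hgt.exists_uniform k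
  obtain ⟨D, hD1, hD⟩ := exists_norm_iteratedFDeriv_le hN hS hSN hf k
  refine ⟨M, k.factorial * C * D ^ k, ?_⟩
  filter_upwards [hC, hg, eventually_pos_le_one] with h h1 h2 hh p hp
  have hpow : 0 < h ^ M := pow_pos hh.1 _
  have key := norm_iteratedFDeriv_comp_le_of_isOpen hN hU h2 hf hfU (hSN hp) (k := k)
    (C := C / h ^ M) (D := D) (fun i hi => (le_div_iff₀ hpow).2 (h1 _ (mem_image_of_mem f hp) i hi))
    fun i hi hi' => (hD p hp i hi').trans (le_self_pow₀ hD1 (by omega))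
  rw [← le_div_iff₀ hpow]
  refine key.trans (le_of_eq ?_)
  ring

/-- In the left half plane every derivative of the exponential is bounded. The derivatives are taken
over `ℝ`. -/
lemma norm_iteratedFDeriv_cexp_le (k : ℕ) {z : ℂ} (hz : z.re ≤ 0) :
    ‖iteratedFDeriv ℝ k Complex.exp z‖ ≤ ‖iteratedFDeriv ℝ k Complex.exp 0‖ := by
  have h1 : (fun w : ℂ => Complex.exp (z + w)) = Complex.exp z • Complex.exp := by
    funext w
    simp [Complex.exp_add]
  have h2 := iteratedFDeriv_comp_add_left (𝕜 := ℝ) (f := Complex.exp) k z (x := 0)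
  rw [h1, iteratedFDeriv_const_smul_apply (Complex.contDiff_exp.contDiffAt), add_zero] at h2
  rw [← h2, norm_smul, Complex.norm_exp]
  exact mul_le_of_le_one_left (norm_nonneg _) (Real.exp_le_one_iff.2 hz)

lemma IsTemperate.cexp {φ : E → ℂ} {S N : Set E} (hN : IsOpen N) (hS : IsCompact S) (hSN : S ⊆ N)
    (hφ : ContDiffOn ℝ ∞ φ N) (hre : ∀ p ∈ S, (φ p).re ≤ 0) :
    IsTemperate (fun (h : ℝ) p => Complex.exp (2 / (h : ℂ) * φ p)) S := by
  intro k
  obtain ⟨D, hD1, hD⟩ := exists_norm_iteratedFDeriv_le hN hS hSN hφ k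
  set C := ∑ i ∈ Finset.range (k + 1), ‖iteratedFDeriv ℝ i Complex.exp 0‖ with hC
  refine ⟨k, k.factorial * C * (2 * D) ^ k, ?_⟩
  filter_upwards [eventually_pos_le_one] with h hh p hp
  have hpow : 0 < h ^ k := pow_pos hh.1 _
  have hsm : ContDiffOn ℝ ∞ (fun p => (2 / (h : ℂ)) * φ p) N := contDiffOn_const.mul hφ
  have hn : ‖(2 / (h : ℂ))‖ = 2 / h := by
    rw [norm_div, Complex.norm_real, Real.norm_of_nonneg hh.1.le]
    simp
  have h2h : 1 ≤ 2 / h * D := by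
    have : 1 ≤ 2 / h := by rw [le_div_iff₀ hh.1]; linarith [hh.2]
    nlinarith
  have hre' : ((2 / (h : ℂ)) * φ p).re ≤ 0 := by
    have e : (2 / (h : ℂ)) = ((2 / h : ℝ) : ℂ) := by push_cast; rfl
    rw [e, Complex.re_ofReal_mul]
    exact mul_nonpos_of_nonneg_of_nonpos (div_nonneg zero_le_two hh.1.le) (hre p hp)
  have key := norm_iteratedFDeriv_comp_le_of_isOpen (g := Complex.exp)
    (f := fun p => (2 / (h : ℂ)) * φ p) hN isOpen_univ
    (Complex.contDiff_exp.contDiffOn) hsm (mapsTo_univ _ _) (hSN hp) (k := k) (C := C)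
    (D := 2 / h * D) (fun i hi => (norm_iteratedFDeriv_cexp_le i hre').trans
      (Finset.single_le_sum (f := fun i => ‖iteratedFDeriv ℝ i Complex.exp 0‖)
        (fun _ _ => norm_nonneg _) (Finset.mem_range.2 (Nat.lt_succ_of_le hi))))
    fun i hi hi' => by
      have e : (fun p => (2 / (h : ℂ)) * φ p) = (2 / (h : ℂ)) • φ := rfl
      rw [e, iteratedFDeriv_const_smul_apply
        ((hφ.contDiffAt (hN.mem_nhds (hSN hp))).of_le (mod_cast le_top)), norm_smul, hn]
      refine le_trans ?_ (le_self_pow₀ h2h (by omega))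
      have : 0 < 2 / h := div_pos two_pos hh.1
      gcongr
      exact hD p hp i hi'
  rw [← le_div_iff₀ hpow]
  refine key.trans (le_of_eq ?_)
  rw [mul_pow, mul_pow, div_pow]
  ring

lemma norm_iteratedFDeriv_prodMk_left_le {f : E × F → G} {N : Set (E × F)} (hN : IsOpen N)
    (hf : ContDiffOn ℝ ∞ f N) {y : E} {s : F} (hys : (y, s) ∈ N) (k : ℕ) :
    ‖iteratedFDeriv ℝ k (fun z => f (z, s)) y‖ ≤ ‖iteratedFDeriv ℝ k f (y, s)‖ := by
  set f' : E × F → G := fun q => f (q + (0, s)) with hf'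
  set N' : Set (E × F) := (fun q => q + (0, s)) ⁻¹' N with hN'
  have hN'o : IsOpen N' := hN.preimage (by fun_prop)
  have hf's : ContDiffOn ℝ ∞ f' N' := hf.comp (by fun_prop) fun q hq => hq
  set L := ContinuousLinearMap.inl ℝ E F with hL
  have e1 : (fun z => f (z, s)) = f' ∘ L := by
    funext z
    simp [hf', hL]
  have hLo : IsOpen (L ⁻¹' N') := hN'o.preimage L.continuous
  have hy : y ∈ L ⁻¹' N' := by simpa [hN', hL] using hys
  have h1 := L.iteratedFDerivWithin_comp_right hf's hN'o.uniqueDiffOn hLo.uniqueDiffOn hy (i := k)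
    (mod_cast le_top)
  rw [iteratedFDerivWithin_of_isOpen k hLo hy, iteratedFDerivWithin_of_isOpen k hN'o hy] at h1
  have h2 : iteratedFDeriv ℝ k f' (L y) = iteratedFDeriv ℝ k f (y, s) := by
    rw [hf', iteratedFDeriv_comp_add_right]
    simp [hL]
  rw [e1, h1, h2]
  refine (ContinuousMultilinearMap.norm_compContinuousLinearMap_le _ _).trans ?_
  refine mul_le_of_le_one_right (norm_nonneg _) (Finset.prod_le_one (fun _ _ => norm_nonneg _)
    fun _ _ => ContinuousLinearMap.norm_inl_le_one ℝ E F)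

end Temperate

/-! ### Smoothness of the operators and bounds on their derivatives -/

section

variable {n : ℕ} {Ψ : Cn n × Cn n → ℂ} {W : Set (Cn n × Cn n)} {V : Set (Cn n)}
  {Γ : ContourFamily n} {K : Set (Cn n)} {U : Set (Cn n × Cn n)}

lemma IsAdmissibleAmplitude.isBigOPow_zero {a : ℝ → Cn n × Cn n → ℂ}
    (ha : IsAdmissibleAmplitude a U) : IsBigOPow a U 0 := by
  obtain ⟨aj, -, hexp⟩ := ha.expansion
  simpa using hexp 0

/-- The ingredients of the integrand are jointly smooth in `(y, s)` near `V × D`. For the phase this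
uses `(y, ȳ) ∈ W`, which holds because the contour passes through that point. -/
lemma IsGoodContour.exists_contDiffOn_integrand (hV : IsOpen V) (hW : IsOpen W)
    (hΨ : ContDiffOn ℝ ∞ Ψ W) (hΓ : IsGoodContour Ψ W V Γ) (hU : IsOpen U)
    (hΓU : ∀ y ∈ V, MapsTo (Γ.map y) Γ.dom U) :
    ∃ N : Set (Cn n × Par n), IsOpen N ∧ V ×ˢ Γ.dom ⊆ N ∧
      ContDiffOn ℝ ∞ (fun q : Cn n × Par n => Γ.map q.1 q.2) N ∧
      MapsTo (fun q : Cn n × Par n => Γ.map q.1 q.2) N U ∧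
      ContDiffOn ℝ ∞ (fun q : Cn n × Par n => phase Ψ q.1 (star q.1) (Γ.map q.1 q.2)) N ∧
      ContDiffOn ℝ ∞ (fun q : Cn n × Par n => pullbackDensity (Γ.map q.1) q.2) N := by
  obtain ⟨O, hO, hDO, hsm⟩ := hΓ.smooth
  obtain ⟨O', hO', hDO', hsm'⟩ := hΓ.exists_contDiffOn_tangent hV
  set g : Cn n × Par n → Cn n × Cn n := fun q => Γ.map q.1 q.2 with hg
  set N₀ : Set (Cn n × Par n) := V ×ˢ (O ∩ O') with hN₀
  have hN₀o : IsOpen N₀ := hV.prod (hO.inter hO')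
  have hg₀ : ContDiffOn ℝ ∞ g N₀ := hsm.mono (prod_mono_right inter_subset_left)
  set P : Cn n × Par n → (Cn n × Cn n) × (Cn n × Cn n) := fun q => (g q, (q.1, star q.1)) with hP
  have hstar : ContDiff ℝ ∞ fun q : Cn n × Par n => star q.1 :=
    (starL' ℝ : Cn n ≃L[ℝ] Cn n).contDiff.comp contDiff_fst
  have hP₀ : ContDiffOn ℝ ∞ P N₀ := hg₀.prodMk (contDiff_fst.prodMk hstar).contDiffOn
  set Q : Set ((Cn n × Cn n) × (Cn n × Cn n)) :=
    {p | p.1 ∈ U ∧ p.1 ∈ W ∧ (p.1.1, p.2.2) ∈ W ∧ (p.2.1, p.1.2) ∈ W ∧ p.2 ∈ W} with hQ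
  have hQo : IsOpen Q :=
    (hU.preimage continuous_fst).inter ((hW.preimage continuous_fst).inter
      ((hW.preimage (f := fun p : (Cn n × Cn n) × (Cn n × Cn n) => (p.1.1, p.2.2))
        (by fun_prop)).inter
      ((hW.preimage (f := fun p : (Cn n × Cn n) × (Cn n × Cn n) => (p.2.1, p.1.2))
        (by fun_prop)).inter (hW.preimage continuous_snd))))
  have hNo : IsOpen (N₀ ∩ P ⁻¹' Q) := hP₀.continuousOn.isOpen_inter_preimage hN₀o hQo
  have hPN : ContDiffOn ℝ ∞ P (N₀ ∩ P ⁻¹' Q) := hP₀.mono inter_subset_left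
  refine ⟨N₀ ∩ P ⁻¹' Q, hNo, ?_, hg₀.mono inter_subset_left, fun q hq => hq.2.1, ?_, ?_⟩
  · rintro ⟨y, s⟩ ⟨hy, hs⟩
    obtain ⟨h1, h2, h3⟩ := hΓ.mem_domain y hy s hs
    obtain ⟨s', hs', e⟩ := hΓ.passes y hy
    have h4 := (hΓ.mem_domain y hy s' (interior_subset hs')).1
    rw [e] at h4
    exact ⟨⟨hy, hDO hs, hDO' hs⟩, hΓU y hy hs, h1, h2, h3, h4⟩
  · have hph : ContDiffOn ℝ ∞ (fun p : (Cn n × Cn n) × (Cn n × Cn n) =>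
        Ψ p.1 - Ψ (p.1.1, p.2.2) - Ψ (p.2.1, p.1.2) + Ψ p.2) Q := by
      refine ((ContDiffOn.sub ?_ ?_).sub ?_).add ?_
      · exact hΨ.comp contDiff_fst.contDiffOn fun p hp => hp.2.1
      · exact hΨ.comp (f := fun p : (Cn n × Cn n) × (Cn n × Cn n) => (p.1.1, p.2.2))
          (by fun_prop) fun p hp => hp.2.2.1
      · exact hΨ.comp (f := fun p : (Cn n × Cn n) × (Cn n × Cn n) => (p.2.1, p.1.2))
          (by fun_prop) fun p hp => hp.2.2.2.1
      · exact hΨ.comp contDiff_snd.contDiffOn fun p hp => hp.2.2.2.2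
    exact hph.comp hPN fun q hq => hq.2
  · have e : (fun q : Cn n × Par n => pullbackDensity (Γ.map q.1) q.2)
        = fun q => volFormR n fun j => tangent Γ q (Pi.single j 1) := by
      funext q
      rw [pullbackDensity_eq_volForm]
      rfl
    rw [e]
    refine (volFormR n).contDiff.comp_contDiffOn (contDiffOn_pi.2 fun j => ?_)
    refine (hsm'.mono ?_).clm_apply contDiffOn_const
    exact fun q hq => ⟨hq.1.1, hq.1.2.2⟩

/-- The operator is smooth in `y`, and its derivatives are temperate: along good contours the
exponential factor is bounded by `1`, and each differentiation costs one factor `1 / h`. -/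
lemma IsGoodContour.contDiffOn_opA_and_isTemperate (hV : IsOpen V) (hW : IsOpen W)
    (hΨ : ContDiffOn ℝ ∞ Ψ W) (hΓ : IsGoodContour Ψ W V Γ) (hU : IsOpen U)
    (hΓU : ∀ y ∈ V, MapsTo (Γ.map y) Γ.dom U) {a : ℝ → Cn n × Cn n → ℂ}
    (ha : IsAdmissibleAmplitude a U) :
    (∀ᶠ h in 𝓝[>] (0 : ℝ), ContDiffOn ℝ ∞ (opA Ψ Γ a h) V) ∧
      ∀ K ⊆ V, IsCompact K → IsTemperate (opA Ψ Γ a) K := by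
  obtain ⟨N, hN, hVN, hg, hgU, hφ, hJ⟩ := hΓ.exists_contDiffOn_integrand hV hW hΨ hU hΓU
  have ha0 := ha.isBigOPow_zero
  set f : ℝ → Cn n × Par n → ℂ := fun h q =>
    Complex.exp (2 / (h : ℂ) * phase Ψ q.1 (star q.1) (Γ.map q.1 q.2)) * a h (Γ.map q.1 q.2)
      * pullbackDensity (Γ.map q.1) q.2 with hf
  have hexp : ∀ h : ℝ, ContDiffOn ℝ ∞ (fun q : Cn n × Par n =>
      Complex.exp (2 / (h : ℂ) * phase Ψ q.1 (star q.1) (Γ.map q.1 q.2))) N := fun h =>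
    (contDiffOn_const.mul hφ).cexp
  have haN : ∀ᶠ h in 𝓝[>] (0 : ℝ), ContDiffOn ℝ ∞ (a h ∘ fun q : Cn n × Par n =>
      Γ.map q.1 q.2) N := ha0.smooth.mono fun h hh => hh.comp hg hgU
  have hfN : ∀ᶠ h in 𝓝[>] (0 : ℝ), ContDiffOn ℝ ∞ (f h) N := by
    filter_upwards [haN] with h hh
    exact ((hexp h).mul hh).mul hJ
  have hint := fun (k : ℕ) (h : ℝ) (hh : ContDiffOn ℝ ∞ (f h) N) =>
    contDiffOn_setIntegral_and_bound (μ := volume) hV hΓ.compact_dom hN hVN k hh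
  refine ⟨hfN.mono fun h hh => ?_, fun K hKV hK k => ?_⟩
  · refine contDiffOn_const.mul (contDiffOn_infty.2 fun k => (hint k h hh).1)
  · have hS := hK.prod hΓ.compact_dom
    have hSV : K ×ˢ Γ.dom ⊆ V ×ˢ Γ.dom := prod_mono_left hKV
    have hSN := hSV.trans hVN
    obtain ⟨C₀, hC₀, hgood⟩ := hΓ.good
    have t1 : IsTemperate (fun (h : ℝ) (q : Cn n × Par n) =>
        Complex.exp (2 / (h : ℂ) * phase Ψ q.1 (star q.1) (Γ.map q.1 q.2))) (K ×ˢ Γ.dom) := by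
      refine IsTemperate.cexp hN hS hSN hφ fun q hq =>
        (hgood q.1 (hKV hq.1) q.2 hq.2).trans ?_
      rw [neg_mul, neg_nonpos]
      positivity
    have t2 : IsTemperate (fun h => a h ∘ fun q : Cn n × Par n => Γ.map q.1 q.2) (K ×ˢ Γ.dom) := by
      refine IsTemperate.comp hN hU hS hSN hg hgU ha0.smooth fun i => ?_
      obtain ⟨C, hC⟩ := ha0.bound _ ((image_mono hSN).trans (image_subset_iff.2 hgU))
        (hΓ.isCompact_image hV hK hKV) i
      exact ⟨0, C, hC.mono fun h hh p hp => by simpa using hh p hp⟩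
    have t3 : IsTemperate (fun (_ : ℝ) (q : Cn n × Par n) => pullbackDensity (Γ.map q.1) q.2)
        (K ×ˢ Γ.dom) := IsTemperate.of_contDiffOn hN hS hSN hJ
    have t4 : IsTemperate f (K ×ˢ Γ.dom) :=
      (t1.mul hN hSN t2 (Eventually.of_forall hexp) haN).mul hN hSN t3
        (haN.mono fun h hh => (hexp h).mul hh) (Eventually.of_forall fun _ => hJ)
    obtain ⟨M, C, hC⟩ := t4 k
    refine ⟨n + M, C * volume.real Γ.dom, ?_⟩
    filter_upwards [hC, hfN, eventually_pos_le_one] with h h1 h2 hh y hy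
    have hpow : 0 < h ^ M := pow_pos hh.1 _
    have hpn : 0 < h ^ n := pow_pos hh.1 _
    obtain ⟨i1, i2⟩ := hint k h h2
    have i3 := i2 y (hKV hy) (C / h ^ M) fun s hs =>
      (norm_iteratedFDeriv_prodMk_left_le hN h2 (hSN ⟨hy, hs⟩) k).trans
        ((le_div_iff₀ hpow).2 (h1 (y, s) ⟨hy, hs⟩))
    have e : opA Ψ Γ a h = (1 / (h : ℂ) ^ n) • fun z => ∫ s in Γ.dom, f h (z, s) := rfl
    rw [e, iteratedFDeriv_const_smul_apply (i1.contDiffAt (hV.mem_nhds (hKV hy))), norm_smul,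
      norm_div, norm_one, norm_pow, Complex.norm_real, Real.norm_of_nonneg hh.1.le]
    have hh0 : 0 < h := hh.1
    calc _ ≤ 1 / h ^ n * (C / h ^ M * volume.real Γ.dom) * h ^ (n + M) := by gcongr
      _ = _ := by
        rw [pow_add]
        field_simp

end

end ContourFIO

open ContourFIO in
theorem mainTheorem4 (n : ℕ) (Ω : Set (ContourFIO.Cn n)) (hΩ : IsOpen Ω)
    (Φ : ContourFIO.Cn n → ℝ) (hΦ : ContourFIO.IsStrictlyPSH Φ Ω)
    (x₀ : ContourFIO.Cn n) (hx₀ : x₀ ∈ Ω)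
    (W : Set (ContourFIO.Cn n × ContourFIO.Cn n)) (hW : IsOpen W) (hx₀W : (x₀, star x₀) ∈ W)
    (Ψ : ContourFIO.Cn n × ContourFIO.Cn n → ℂ)
    (hΨ : ContourFIO.IsAlmostHolomorphic Ψ W)
    (hΨΦ : ∀ᶠ x in 𝓝 x₀, Ψ (x, star x) = (Φ x : ℂ)) :
    ∃ V₀ : Set (ContourFIO.Cn n), IsOpen V₀ ∧ x₀ ∈ V₀ ∧
      IsCompact (closure V₀) ∧ closure V₀ ⊆ Ω ∧
      ∀ V ⊆ V₀, IsOpen V →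
      ∀ Γ Γ₀ : ContourFIO.ContourFamily n,
        ContourFIO.IsGoodContour Ψ W V Γ → ContourFIO.IsGoodContour Ψ W V Γ₀ →
        ContourFIO.SameOrientation V Γ Γ₀ →
      ∀ (U : Set (ContourFIO.Cn n × ContourFIO.Cn n)), IsOpen U →
        (∀ y ∈ V, MapsTo (Γ.map y) Γ.dom U) → (∀ y ∈ V, MapsTo (Γ₀.map y) Γ₀.dom U) →
      ∀ a : ℝ → ContourFIO.Cn n × ContourFIO.Cn n → ℂ,
        ContourFIO.IsAdmissibleAmplitude a U →
        ContourFIO.IsBigOInfty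
          (fun h y => ContourFIO.opA Ψ Γ a h y - ContourFIO.opA Ψ Γ₀ a h y) V := by
  obtain ⟨r, hr, hball⟩ := Metric.eventually_nhds_iff_ball.1
    (hΨΦ.eventually_nhds.and (hΩ.mem_nhds hx₀))
  have hcl : closure (Metric.ball x₀ (r / 2)) ⊆ Metric.ball x₀ r :=
    Metric.closure_ball_subset_closedBall.trans (Metric.closedBall_subset_ball (by linarith))
  -- a ball so small that its closure lies in `Ω` and `Ψ(x, x̄) = Φ(x)` holds near it
  refine ⟨Metric.ball x₀ (r / 2), Metric.isOpen_ball, Metric.mem_ball_self (by positivity),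
    (isCompact_closedBall x₀ (r / 2)).of_isClosed_subset isClosed_closure
      Metric.closure_ball_subset_closedBall, fun x hx => (hball x (hcl hx)).2, ?_⟩
  intro V hVV₀ hV Γ Γ₀ hΓ hΓ₀ hor U hU hΓU hΓ₀U a ha
  have hV' : ∀ y ∈ V, (∀ᶠ x in 𝓝 y, Ψ (x, star x) = (Φ x : ℂ)) ∧ y ∈ Ω := fun y hy =>
    hball y (hcl (subset_closure (hVV₀ hy)))
  obtain ⟨c, -, hc⟩ := hΦ.levi
  obtain ⟨s1, b1⟩ := hΓ.contDiffOn_opA_and_isTemperate hV hW hΨ.smooth hU hΓU ha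
  obtain ⟨s2, b2⟩ := hΓ₀.contDiffOn_opA_and_isTemperate hV hW hΨ.smooth hU hΓ₀U ha
  refine isBigOInfty_of_sup hV ?_ (fun K hKV hK k => ?_) fun K hKV hK N => ?_
  · filter_upwards [s1, s2] with h h1 h2 using h1.sub h2
  · obtain ⟨M₁, C₁, h1⟩ := b1 K hKV hK k
    obtain ⟨M₂, C₂, h2⟩ := b2 K hKV hK k
    refine ⟨M₁ + M₂, C₁ + C₂, ?_⟩
    filter_upwards [s1, s2, h1, h2, eventually_pos_le_one] with h s1 s2 h1 h2 hh p hp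
    have hsm : ∀ {f : Cn n → ℂ}, ContDiffOn ℝ ∞ f V → ContDiffAt ℝ k f p := fun hf =>
      (hf.contDiffAt (hV.mem_nhds (hKV hp))).of_le (mod_cast le_top)
    have e : (fun y => opA Ψ Γ a h y - opA Ψ Γ₀ a h y) = opA Ψ Γ a h - opA Ψ Γ₀ a h := rfl
    rw [e, iteratedFDeriv_sub_apply (hsm s1) (hsm s2)]
    refine (mul_le_mul_of_nonneg_right (norm_sub_le _ _) (pow_nonneg hh.1.le _)).trans ?_
    rw [add_mul]
    exact add_le_add
      (mul_pow_le_of_le (norm_nonneg _) hh.1 hh.2 (Nat.le_add_right _ _) (h1 p hp))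
      (mul_pow_le_of_le (norm_nonneg _) hh.1 hh.2 (Nat.le_add_left _ _) (h2 p hp))
  · refine exists_norm_opA_sub_le hV hW hΨ hΓ hΓ₀ hor hK hKV (Φ := Φ)
      (fun y hy => hΦ.smooth.contDiffAt (hΩ.mem_nhds (hV' y (hKV hy)).2))
      (fun y hy => (hV' y (hKV hy)).1) (fun y hy ξ => ?_) hU hΓU hΓ₀U ha N
    obtain ⟨hc0, hlevi⟩ := hc y (hV' y (hKV hy)).2
    exact (mul_nonneg hc0.le (Finset.sum_nonneg fun j _ => by positivity)).trans (hlevi ξ)
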